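/- Let $E$ be a finite set and let $\eta=(\eta_x)_{x\in E}$ be a centered Gaussian vector whose covariance $G(x,y)=\mathbb E[\eta_x\eta_y]$, $x,y\in E$, is a positive definite matrix. Then the following are equivalent. (i) The vector $\eta^2=(\eta_x^2)_{x\in E}$ is infinitely divisible, that is, for every integer $n\ge 1$ it has the same law as a sum of $n$ independent identically distributed random vectors in $\mathbb R^E$. (ii) There exist a function $d:E\to\mathbb R$ and the Green function $g$ of a transient symmetric Markov process with state space $E$ such that $$G(x,y)=d(x)\,g(x,y)\,d(y)\qquad\text{for all }x,y\in E.$$ Here a Markov process with state space $E$ is a time-homogeneous, continuous-time Markov process $(X_t)_{t\ge 0}$ with right-continuous paths in $E\cup\{\Delta\}$ (discrete topology), where $\Delta$ is an absorbing cemetery point, started from $x$ under $\mathbb P_x$ for each $x\in E$. Write $P_t(x,y)=\mathbb P_x(X_t=y)$ for $x,y\in E$. The process is transient if $U(x,y)=\int_0^\infty P_t(x,y)\,dt<\infty$ for all $x,y\in E$. It is symmetric with respect to a measure $m$ on $E$ with $0<m(\{x\})<\infty$ for every $x\in E$ if $m(\{x\})P_t(x,y)=m(\{y\})P_t(y,x)$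 for all $t\ge 0$ and $x,y\in E$. A Green function of a transient symmetric Markov process is the density $g(x,y)=U(x,y)/m(\{y\})$ of its potential with respect to such a measure $m$. -/

import Mathlib

open MeasureTheory ProbabilityTheory Filter Topology
open scoped NNReal ENNReal

/-- A probability measure `μ` on `E → ℝ` is infinitely divisible if, for every `n ≥ 1`, it is the
law of a sum of `n` independent identically distributed random vectors (with common law `ν`). -/
def IsInfinitelyDivisibleLaw {E : Type*} [Fintype E] (μ : Measure (E → ℝ)) : Prop :=
  ∀ n : ℕ, 1 ≤ n → ∃ ν : Measure (E → ℝ), IsProbabilityMeasure ν ∧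
    μ = (Measure.pi (fun _ : Fin n => ν)).map (fun v => ∑ i, v i)

/-- A (time-homogeneous, continuous-time) Markov process with finite discrete state space `E`,
possibly with killing. The value `none` is the cemetery point; `P x` is the law of the process
started from `x`. -/
structure FiniteMarkovProcess.{u} (E : Type u) [Fintype E] where
  /-- the sample space -/
  Ω : Type u
  [mΩ : MeasurableSpace Ω]
  /-- the probability measure under which the process starts at `x` -/
  P : E → Measure Ω
  isProbabilityMeasure : ∀ x, IsProbabilityMeasure (P x)
  /-- the position at time `t` -/
  X : ℝ≥0 → Ω → Option E
  measurableSet_eq : ∀ t z, MeasurableSet {ω | X t ω = z}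
  /-- right-continuity of the paths, for the discrete topology on the state space -/
  right_continuous : ∀ ω t, ∀ᶠ s in 𝓝[>] t, X s ω = X t ω
  /-- the cemetery point is absorbing -/
  absorbing : ∀ ω s t, s ≤ t → X s ω = none → X t ω = none
  /-- the process starts at `x` under `P x` -/
  start : ∀ x, P x {ω | X 0 ω = some x} = 1
  /-- the Markov property at time `s`, with respect to the history `σ(X u, u ≤ s)` -/
  markov : ∀ (x y : E) (s t : ℝ≥0) (A : Set Ω),
    MeasurableSet[⨆ (u : ℝ≥0) (_ : u ≤ s), MeasurableSpace.comap (X u) ⊤] A →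
      P x (A ∩ {ω | X (s + t) ω = some y}) =
        ∑ z : E, P x (A ∩ {ω | X s ω = some z}) * P z {ω | X t ω = some y}

namespace FiniteMarkovProcess

variable {E : Type*} [Fintype E]

/-- The transition function `P_t(x, y)`, the probability of being at `y` at time `t` when started
from `x`. -/
noncomputable def transition (Y : FiniteMarkovProcess E) (t : ℝ≥0) (x y : E) : ℝ≥0∞ :=
  Y.P x {ω | Y.X t ω = some y}

/-- The potential `U(x, {y}) = ∫₀^∞ P_t(x, y) dt`, the expected total time spent at `y` by the
process started from `x`. -/
noncomputable def potential (Y : FiniteMarkovProcess E) (x y : E) : ℝ≥0∞ :=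
  ∫⁻ t in Set.Ioi (0 : ℝ), Y.transition t.toNNReal x y

/-- The process is transient if all its expected total occupation times are finite. -/
def IsTransient (Y : FiniteMarkovProcess E) : Prop :=
  ∀ x y, Y.potential x y < ∞

/-- The process is symmetric with respect to the measure with point masses `m x`. -/
def IsSymmetric (Y : FiniteMarkovProcess E) (m : E → ℝ) : Prop :=
  ∀ t x y, ENNReal.ofReal (m x) * Y.transition t x y = ENNReal.ofReal (m y) * Y.transition t y x

/-- The density `g(x, y)` of the potential `U(x, dy)` with respect to the measure with point
masses `m y`, assumed positive (meaningful for a transient process). -/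
noncomputable def potentialDensity (Y : FiniteMarkovProcess E) (m : E → ℝ) (x y : E) : ℝ :=
  (Y.potential x y).toReal / m y

end FiniteMarkovProcess

/-- `g` is the Green function of a transient symmetric Markov process with state space `E`: its
potential density with respect to some reference measure, charging all points, for which the
process is symmetric. -/
def IsSymmetricTransientGreenFunction {E : Type*} [Fintype E] (g : E → E → ℝ) : Prop :=
  ∃ (Y : FiniteMarkovProcess E) (m : E → ℝ), (∀ x, 0 < m x) ∧ Y.IsTransient ∧ Y.IsSymmetric m ∧
    ∀ x y, g x y = Y.potentialDensity m x y

/-! Put A = (2G)⁻¹. Diagonalising G together with a diagonal matrix Λ ≥ 0 gives E exp(-∑ λ_x η_x²) =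
(det A / det(A + Λ))^(1/2) (`integral_exp_neg_sum_mul_sq`). Both conditions are equivalent to a
third, due in substance to Griffiths and Bapat: for some diagonal matrix D with nonzero entries, D
G⁻¹ D has nonpositive off-diagonal entries.

From a Green function to the signs: if U is the potential and P_t the semigroup, then (1 - P_t) U =
∫₀ᵗ P_s ds, so U⁻¹ is the limit of (1 - P_t)/t, whose off-diagonal entries are nonpositive
(`FiniteMarkovProcess.inverse_potential_offDiag_nonpos`).

From the signs to infinite divisibility: write A = c - B with c large, so that D B D⁻¹ is entrywise
nonnegative. Then det(A + Λ) = ∏ (c + λ_x) · det(1 - uB) with u = (c + Λ)⁻¹, and -log det(1 - uB) =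
∑ tr((uB)^k)/k is a series in the functions 1/(c + λ_x) with nonnegative coefficients. These are
Laplace transforms of positive measures, a class closed under sums, products and exponentials. Hence
every positive power of det A / det(A + Λ) is a Laplace transform (`isLaplaceTransform_det_rpow`);
the power 1/(2n) gives an n-th root of the law.

From infinite divisibility to the signs: the n-th roots φ^(1/n) of the Laplace transform φ have
nonnegative alternating differences, hence so has log φ = lim n(φ^(1/n) - 1). Expanding log det(A +
Λ) for large Λ, the leading term of the difference over a set S is a sum over cyclic words through
all points of S, and gives ∑ ∏ (-A(w_i, w_{i+1})) ≥ 0 (`sum_cyclic_words_nonneg`). A shortest cycle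
with a wrong sign would violate this, so a signature can be built one point at a time
(`exists_signature_of_cyclic_sums_nonneg`).

From the signs to a Green function: a further positive scaling makes the row sums of D G⁻¹ D
positive. Up to a constant the resulting matrix is 1 - p with p symmetric and strictly
substochastic, and its inverse ∑ p^k is the potential of the chain that jumps at rate one with
kernel p. This chain is constructed explicitly (`JumpChain.process`). -/

/-! ### Linear algebra: spectra, traces of powers, simultaneous diagonalisation. -/

section MatrixAux

variable {E : Type*} [Fintype E] [DecidableEq E]

/-- A diagonal matrix with positive entries times a symmetric matrix has real spectrum: this gives
the traces of its powers and its characteristic determinants. -/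
lemma exists_spectrum_diagonal_mul (u : E → ℝ) (hu : ∀ x, 0 < u x) (B : Matrix E E ℝ)
    (hB : B.IsSymm) :
    ∃ e : E → ℝ, (∀ k : ℕ, ((Matrix.diagonal u * B) ^ k).trace = ∑ i, e i ^ k) ∧
      (∀ r : ℝ, (1 - r • (Matrix.diagonal u * B)).det = ∏ i, (1 - r * e i)) ∧
      ((Matrix.diagonal (fun x => (u x)⁻¹) - B).PosDef → ∀ i, e i < 1) ∧
      ((Matrix.diagonal (fun x => (u x)⁻¹) + B).PosDef → ∀ i, -1 < e i) := by
  -- With R = √u, the matrix uB is similar to the symmetric matrix RBR, whose eigenvalues are the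
  -- required `e`.
  set R : Matrix E E ℝ := Matrix.diagonal (fun x => √(u x)) with hR
  set Ri : Matrix E E ℝ := Matrix.diagonal (fun x => (√(u x))⁻¹) with hRi
  have hs : ∀ x, √(u x) ≠ 0 := fun x => (Real.sqrt_pos.2 (hu x)).ne'
  have hRRi : R * Ri = 1 := by
    rw [hR, hRi, Matrix.diagonal_mul_diagonal, ← Matrix.diagonal_one]
    congr 1; ext x; exact mul_inv_cancel₀ (hs x)
  have hRiR : Ri * R = 1 := by
    rw [hR, hRi, Matrix.diagonal_mul_diagonal, ← Matrix.diagonal_one]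
    congr 1; ext x; exact inv_mul_cancel₀ (hs x)
  have hRR : R * R = Matrix.diagonal u := by
    rw [hR, Matrix.diagonal_mul_diagonal]
    congr 1; ext x; exact Real.mul_self_sqrt (hu x).le
  set S : Matrix E E ℝ := R * B * R with hS
  have hRH : R.IsHermitian := Matrix.isHermitian_diagonal _
  have hSH : S.IsHermitian := by
    have hB' : B.conjTranspose = B := by
      rw [Matrix.conjTranspose_eq_transpose_of_trivial, hB.eq]
    rw [Matrix.IsHermitian, hS, Matrix.conjTranspose_mul, Matrix.conjTranspose_mul, hRH.eq, hB',
      Matrix.mul_assoc]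
  have hconj : Matrix.diagonal u * B = R * S * Ri := by
    rw [← hRR, hS]
    simp only [Matrix.mul_assoc, hRRi, Matrix.mul_one]
  set V : Matrix E E ℝ := (hSH.eigenvectorUnitary : Matrix E E ℝ)
  set W : Matrix E E ℝ := star V
  have hVW : V * W = 1 := Unitary.mul_star_self_of_mem hSH.eigenvectorUnitary.2
  have hWV : W * V = 1 := Unitary.star_mul_self_of_mem hSH.eigenvectorUnitary.2
  set e := hSH.eigenvalues with he
  have hspec : S = V * Matrix.diagonal e * W := by
    have := hSH.spectral_theorem
    simpa [Unitary.conjStarAlgAut_apply] using this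
  set P := R * V
  set Q := W * Ri
  have hPQ : P * Q = 1 := by
    simp only [P, Q]
    rw [Matrix.mul_assoc, ← Matrix.mul_assoc V, hVW, Matrix.one_mul, hRRi]
  have hQP : Q * P = 1 := by
    simp only [P, Q]
    rw [Matrix.mul_assoc, ← Matrix.mul_assoc Ri, hRiR, Matrix.one_mul, hWV]
  have hM : Matrix.diagonal u * B = P * Matrix.diagonal e * Q := by
    rw [hconj, hspec]; simp only [P, Q, Matrix.mul_assoc]
  refine ⟨e, fun k => ?_, fun r => ?_, fun h i => ?_, fun h i => ?_⟩
  · have : (Matrix.diagonal u * B) ^ k = P * Matrix.diagonal (fun i => e i ^ k) * Q := by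
      induction k with
      | zero => simp [hPQ]
      | succ k ih =>
        rw [pow_succ, ih, hM]
        calc P * Matrix.diagonal (fun i => e i ^ k) * Q * (P * Matrix.diagonal e * Q)
            = P * Matrix.diagonal (fun i => e i ^ k) * (Q * P) * Matrix.diagonal e * Q := by
              simp only [Matrix.mul_assoc]
          _ = _ := by
              rw [hQP, Matrix.mul_one, Matrix.mul_assoc P, Matrix.diagonal_mul_diagonal]
              simp only [pow_succ]
    rw [this, Matrix.trace_mul_comm, ← Matrix.mul_assoc, hQP, Matrix.one_mul, Matrix.trace_diagonal]
  · have : 1 - r • (Matrix.diagonal u * B) = P * Matrix.diagonal (fun i => 1 - r * e i) * Q := by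
      have h1 : Matrix.diagonal (fun i => 1 - r * e i) = 1 - r • Matrix.diagonal e := by
        rw [← Matrix.diagonal_one, ← Matrix.diagonal_smul, Matrix.diagonal_sub]; rfl
      rw [hM, h1, Matrix.mul_sub, Matrix.sub_mul, Matrix.mul_one, hPQ, Matrix.mul_smul,
        Matrix.smul_mul]
    rw [this, Matrix.det_mul, Matrix.det_mul, mul_right_comm, ← Matrix.det_mul, hPQ,
      Matrix.det_one, one_mul, Matrix.det_diagonal]
  -- The congruence by RV turns u⁻¹ + sB into diag(1 + s·e). Taking s = ∓1 converts the two
  -- positivity assumptions into the bounds on `e`.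
  all_goals
    have hquad : ∀ s : ℝ, Matrix.diagonal (fun i => 1 + s * e i) =
        (R * V).transpose * (Matrix.diagonal (fun x => (u x)⁻¹) + s • B) * (R * V) := by
      intro s
      have hWt : V.transpose = W := rfl
      have hRt : R.transpose = R := Matrix.diagonal_transpose _
      have h2 : R * Matrix.diagonal (fun x => (u x)⁻¹) * R = 1 := by
        rw [hR, Matrix.diagonal_mul_diagonal, Matrix.diagonal_mul_diagonal, ← Matrix.diagonal_one]
        congr 1; ext x
        rw [mul_right_comm, Real.mul_self_sqrt (hu x).le, mul_inv_cancel₀ (hu x).ne']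
      have h3 : W * S * V = Matrix.diagonal e := by
        rw [hspec]
        calc W * (V * Matrix.diagonal e * W) * V = (W * V) * Matrix.diagonal e * (W * V) := by
              simp only [Matrix.mul_assoc]
          _ = _ := by rw [hWV, Matrix.one_mul, Matrix.mul_one]
      have h1 : Matrix.diagonal (fun i => 1 + s * e i) = 1 + s • Matrix.diagonal e := by
        rw [← Matrix.diagonal_one, ← Matrix.diagonal_smul, Matrix.diagonal_add]; rfl
      rw [h1, Matrix.transpose_mul, hWt, hRt]
      calc (1 : Matrix E E ℝ) + s • Matrix.diagonal e
          = W * (R * Matrix.diagonal (fun x => (u x)⁻¹) * R) * V + s • (W * S * V) := by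
            rw [h2, Matrix.mul_one, hWV, h3]
        _ = _ := by
            simp only [hS, Matrix.mul_add, Matrix.add_mul, Matrix.mul_assoc, Matrix.mul_smul,
              Matrix.smul_mul]
    have hinj : Function.Injective (R * V).mulVec :=
      Matrix.mulVec_injective_of_isUnit (by
        refine (Matrix.isUnit_iff_isUnit_det _).2 ?_
        have := congrArg Matrix.det hPQ
        rw [Matrix.det_mul, Matrix.det_one] at this
        exact IsUnit.of_mul_eq_one _ this)
  · have hd := hquad (-1)
    rw [neg_one_smul, ← sub_eq_add_neg] at hd
    have := h.conjTranspose_mul_mul_same hinj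
    rw [Matrix.conjTranspose_eq_transpose_of_trivial, ← hd, Matrix.posDef_diagonal_iff] at this
    linarith [this i]
  · have hd := hquad 1
    rw [one_smul] at hd
    have := h.conjTranspose_mul_mul_same hinj
    rw [Matrix.conjTranspose_eq_transpose_of_trivial, ← hd, Matrix.posDef_diagonal_iff] at this
    linarith [this i]

/-- The trace expansion of the logarithm of a determinant. -/
lemma hasSum_trace_pow_neg_log_det (u : E → ℝ) (hu : ∀ x, 0 < u x) (B : Matrix E E ℝ)
    (hB : B.IsSymm) (h1 : (Matrix.diagonal (fun x => (u x)⁻¹) - B).PosDef)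
    (h2 : (Matrix.diagonal (fun x => (u x)⁻¹) + B).PosDef) :
    HasSum (fun k : ℕ => ((Matrix.diagonal u * B) ^ (k + 1)).trace / (k + 1))
      (-Real.log (1 - Matrix.diagonal u * B).det) ∧ 0 < (1 - Matrix.diagonal u * B).det := by
  obtain ⟨e, htr, hdet, hlt, hgt⟩ := exists_spectrum_diagonal_mul u hu B hB
  have hd := hdet 1
  simp only [one_smul, one_mul] at hd
  have hpos : ∀ i, 0 < 1 - e i := fun i => sub_pos.2 (hlt h1 i)
  rw [hd]
  refine ⟨?_, Finset.prod_pos fun i _ => hpos i⟩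
  rw [Real.log_prod (fun i _ => (hpos i).ne'), ← Finset.sum_neg_distrib]
  have : ∀ k : ℕ, ((Matrix.diagonal u * B) ^ (k + 1)).trace / ((k : ℝ) + 1) =
      ∑ i, e i ^ (k + 1) / ((k : ℝ) + 1) := by
    intro k; rw [htr, Finset.sum_div]
  simp only [this]
  exact hasSum_sum fun i _ => Real.hasSum_pow_div_log_of_abs_lt_one
    (abs_lt.2 ⟨hgt h2 i, hlt h1 i⟩)

/-- Entries of matrix powers as sums over words. -/
lemma trace_pow_eq_sum_prod (M : Matrix E E ℝ) (n : ℕ) :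
    (M ^ (n + 1)).trace = ∑ w : Fin (n + 1) → E, ∏ i, M (w i) (w (i + 1)) := by
  have key : ∀ (n : ℕ) (x y : E), (M ^ (n + 1)) x y =
      ∑ v : Fin n → E, ∏ i : Fin (n + 1),
        M ((Fin.cons x v : Fin (n + 1) → E) i) ((Fin.snoc v y : Fin (n + 1) → E) i) := by
    intro n
    induction n with
    | zero => intro x y; simp [Fin.snoc]
    | succ n ih =>
      intro x y
      rw [pow_succ', Matrix.mul_apply]
      rw [← (Fin.consEquiv (fun _ : Fin (n + 1) => E)).sum_comp, Fintype.sum_prod_type]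
      refine Finset.sum_congr rfl fun z _ => ?_
      rw [ih, Finset.mul_sum]
      refine Finset.sum_congr rfl fun v _ => ?_
      rw [Fin.prod_univ_succ (n := n + 1)]
      have h : (Fin.snoc ((Fin.consEquiv (fun _ : Fin (n + 1) => E)) (z, v)) y : Fin (n + 2) → E) =
          Fin.cons z (Fin.snoc v y : Fin (n + 1) → E) :=
        (Fin.cons_snoc_eq_snoc_cons z v y).symm
      rw [h]
      simp only [Fin.cons_zero, Fin.cons_succ]
      rfl
  -- Addition in `Fin (n + 1)` wraps around, so appending the initial letter at the end is the
  -- cyclic shift of the word.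
  have hcyc : ∀ (x : E) (v : Fin n → E) (i : Fin (n + 1)),
      (Fin.snoc v x : Fin (n + 1) → E) i = (Fin.cons x v : Fin (n + 1) → E) (i + 1) := by
    intro x v i
    induction i using Fin.lastCases with
    | last => simp
    | cast i => simp [Fin.coeSucc_eq_succ]
  rw [Matrix.trace, ← (Fin.consEquiv (fun _ : Fin (n + 1) => E)).sum_comp, Fintype.sum_prod_type]
  refine Finset.sum_congr rfl fun x _ => ?_
  rw [Matrix.diag_apply, key]
  refine Finset.sum_congr rfl fun v _ => ?_
  refine Finset.prod_congr rfl fun i _ => ?_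
  rw [hcyc]; rfl

/-- Simultaneous diagonalisation of a covariance matrix and a diagonal quadratic form. -/
lemma exists_simultaneous_diagonalization (G : Matrix E E ℝ) (hG : G.PosDef) (l : E → ℝ)
    (hl : ∀ x, 0 ≤ l x) :
    ∃ (L : Matrix E E ℝ) (e : E → ℝ), (∀ i, 0 ≤ e i) ∧ L * G * L.transpose = 1 ∧
      L.transpose * Matrix.diagonal e * L = Matrix.diagonal l := by
  -- With G = BᵀB and an orthogonal V diagonalising B·diag(l)·Bᵀ, the matrix L = Vᵀ(B⁻¹)ᵀ reduces
  -- both forms at once.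
  obtain ⟨B, hBG⟩ : ∃ B : Matrix E E ℝ, G = B.transpose * B := by
    open scoped MatrixOrder Matrix.Norms.L2Operator in
    exact CStarAlgebra.nonneg_iff_eq_star_mul_self.mp hG.posSemidef.nonneg
  have hBdet : IsUnit B.det := by
    rw [isUnit_iff_ne_zero]
    intro h0
    have := hG.det_pos
    rw [hBG, Matrix.det_mul, h0, mul_zero] at this
    exact lt_irrefl _ this
  have hBB : B * B⁻¹ = 1 := Matrix.mul_nonsing_inv _ hBdet
  have hBB' : B⁻¹ * B = 1 := Matrix.nonsing_inv_mul _ hBdet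
  have hS : (B * Matrix.diagonal l * B.transpose).PosSemidef := by
    have := (Matrix.PosSemidef.diagonal (n := E) (R := ℝ) (d := l) hl).mul_mul_conjTranspose_same B
    rwa [Matrix.conjTranspose_eq_transpose_of_trivial] at this
  have hSH := hS.isHermitian
  set V : Matrix E E ℝ := (hSH.eigenvectorUnitary : Matrix E E ℝ)
  set W : Matrix E E ℝ := V.transpose
  have hVW : V * W = 1 := Unitary.mul_star_self_of_mem hSH.eigenvectorUnitary.2
  have hWV : W * V = 1 := Unitary.star_mul_self_of_mem hSH.eigenvectorUnitary.2
  have hspec : B * Matrix.diagonal l * B.transpose = V * Matrix.diagonal hSH.eigenvalues * W := by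
    have := hSH.spectral_theorem
    rw [Unitary.conjStarAlgAut_apply] at this
    exact this
  have hT1 : B⁻¹.transpose * B.transpose = 1 := by
    rw [← Matrix.transpose_mul, hBB, Matrix.transpose_one]
  have hT2 : B.transpose * B⁻¹.transpose = 1 := by
    rw [← Matrix.transpose_mul, hBB', Matrix.transpose_one]
  have hWt : W.transpose = V := Matrix.transpose_transpose _
  refine ⟨W * B⁻¹.transpose, hSH.eigenvalues, hS.eigenvalues_nonneg, ?_, ?_⟩
  · rw [Matrix.transpose_mul, Matrix.transpose_transpose, hWt, hBG]
    calc W * B⁻¹.transpose * (B.transpose * B) * (B⁻¹ * V)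
        = W * (B⁻¹.transpose * B.transpose) * (B * B⁻¹) * V := by simp only [Matrix.mul_assoc]
      _ = 1 := by rw [hT1, hBB, Matrix.mul_one, Matrix.mul_one, hWV]
  · rw [Matrix.transpose_mul, Matrix.transpose_transpose, hWt]
    calc B⁻¹ * V * Matrix.diagonal hSH.eigenvalues * (W * B⁻¹.transpose)
        = B⁻¹ * (V * Matrix.diagonal hSH.eigenvalues * W) * B⁻¹.transpose := by
          simp only [Matrix.mul_assoc]
      _ = (B⁻¹ * B) * Matrix.diagonal l * (B.transpose * B⁻¹.transpose) := by
          rw [← hspec]; simp only [Matrix.mul_assoc]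
      _ = _ := by rw [hBB', hT2, Matrix.one_mul, Matrix.mul_one]

end MatrixAux

/-! ### Laplace transform of the squares of a Gaussian vector. -/

section GaussianSquares

/-- The Laplace transform of the square of a standard Gaussian variable. -/
lemma integral_exp_neg_mul_sq_gaussianReal (e : ℝ) (he : 0 ≤ e) :
    ∫ z, Real.exp (-(e * z ^ 2)) ∂(gaussianReal 0 1) = √((1 + 2 * e)⁻¹) := by
  rw [integral_gaussianReal_eq_integral_smul one_ne_zero]
  have : ∀ z : ℝ, gaussianPDFReal 0 1 z • Real.exp (-(e * z ^ 2)) =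
      (√(2 * Real.pi))⁻¹ * Real.exp (-(e + 1 / 2) * z ^ 2) := by
    intro z
    rw [gaussianPDFReal, smul_eq_mul, mul_assoc, ← Real.exp_add]
    simp only [NNReal.coe_one, mul_one, sub_zero]
    congr 2; ring
  simp only [this]
  rw [integral_const_mul, integral_gaussian, ← Real.sqrt_inv, ← Real.sqrt_mul (by positivity)]
  congr 1
  have := Real.pi_pos
  field_simp
  ring

variable {E Ω : Type*} [Fintype E] [DecidableEq E] [MeasurableSpace Ω] {μ : Measure Ω}
    [IsProbabilityMeasure μ] {η : E → Ω → ℝ} {G : Matrix E E ℝ}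

/-- The Laplace transform of the square of a centered Gaussian vector. -/
lemma integral_exp_neg_sum_mul_sq (hη : HasGaussianLaw (fun ω x => η x ω) μ)
    (hcentered : ∀ x, ∫ ω, η x ω ∂μ = 0) (hcov : ∀ x y, cov[η x, η y; μ] = G x y)
    (hG : G.PosDef) (l : E → ℝ) (hl : ∀ x, 0 ≤ l x) :
    ∫ ω, Real.exp (-∑ x, l x * η x ω ^ 2) ∂μ =
      √(((2 : ℝ) • G)⁻¹.det / (((2 : ℝ) • G)⁻¹ + Matrix.diagonal l).det) := by
  obtain ⟨L, e, he, hLG, hLe⟩ := exists_simultaneous_diagonalization G hG l hl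
  -- The vector ξ = Lη has covariance LGLᵀ = 1, so its coordinates are independent standard
  -- Gaussians, and ∑ l η² = ∑ e ξ². The integral factorises.
  set ξ : E → Ω → ℝ := fun i ω => ∑ x, L i x * η x ω with hξ
  have hηm : ∀ x, MemLp (η x) 2 μ := fun x => (hη.eval x).memLp_two
  have hξG : HasGaussianLaw (fun ω i => ξ i ω) μ :=
    hη.map_fun (ContinuousLinearMap.pi fun i =>
      ∑ x, L i x • (ContinuousLinearMap.proj x : (E → ℝ) →L[ℝ] ℝ)) |>.congr (by
        refine ae_of_all _ fun ω => ?_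
        ext i
        simp [hξ])
  have hξcov : ∀ i j, cov[ξ i, ξ j; μ] = (1 : Matrix E E ℝ) i j := by
    intro i j
    rw [hξ, covariance_fun_sum_fun_sum (fun x => (hηm x).const_mul _)
      (fun x => (hηm x).const_mul _), ← hLG, Matrix.mul_apply]
    simp only [covariance_const_mul_left, covariance_const_mul_right, hcov, Matrix.mul_apply,
      Matrix.transpose_apply, Finset.sum_mul]
    rw [Finset.sum_comm]
    refine Finset.sum_congr rfl fun y _ => Finset.sum_congr rfl fun x _ => by ring
  have hξmean : ∀ i, ∫ ω, ξ i ω ∂μ = 0 := by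
    intro i
    simp only [hξ]
    rw [integral_finsetSum _ fun x _ => ((hηm x).integrable (by norm_num)).const_mul _]
    simp [integral_const_mul, hcentered]
  have hind : iIndepFun ξ μ := hξG.iIndepFun_of_covariance_eq_zero fun i j hij => by
    rw [hξcov, Matrix.one_apply_ne hij]
  have hlaw : ∀ i, μ.map (ξ i) = gaussianReal 0 1 := by
    intro i
    have hi := hξG.eval i
    rw [hi.map_eq_gaussianReal, hξmean, ← covariance_self hi.aemeasurable, hξcov]
    simp
  have hquad : ∀ ω, ∑ x, l x * η x ω ^ 2 = ∑ i, e i * ξ i ω ^ 2 := by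
    intro ω
    have h1 : ∑ x, l x * η x ω ^ 2 =
        (fun x => η x ω) ⬝ᵥ (Matrix.diagonal l).mulVec (fun x => η x ω) := by
      simp only [dotProduct, Matrix.mulVec_diagonal]
      exact Finset.sum_congr rfl fun x _ => by ring
    have h2 : ∑ i, e i * ξ i ω ^ 2 =
        (L.mulVec fun x => η x ω) ⬝ᵥ (Matrix.diagonal e).mulVec (L.mulVec fun x => η x ω) := by
      simp only [dotProduct, Matrix.mulVec_diagonal]
      exact Finset.sum_congr rfl fun x _ => by simp only [hξ, Matrix.mulVec, dotProduct]; ring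
    rw [h1, h2, ← hLe, ← Matrix.mulVec_mulVec, ← Matrix.mulVec_mulVec, Matrix.dotProduct_mulVec,
      Matrix.vecMul_transpose]
  have hLHS : ∫ ω, Real.exp (-∑ x, l x * η x ω ^ 2) ∂μ = ∏ i, √((1 + 2 * e i)⁻¹) := by
    simp only [hquad, ← Finset.sum_neg_distrib, Real.exp_sum]
    rw [hind.integral_fun_prod_comp (f := fun i z => Real.exp (-(e i * z ^ 2)))
      (fun i => (hξG.eval i).aemeasurable) (fun i => by fun_prop)]
    refine Finset.prod_congr rfl fun i _ => ?_
    rw [← integral_exp_neg_mul_sq_gaussianReal _ (he i), ← hlaw i,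
      integral_map (hξG.eval i).aemeasurable (by fun_prop)]
  rw [hLHS, ← Real.sqrt_prod _ fun i _ => inv_nonneg.2 (by linarith [he i])]
  congr 1
  have hLdet : L.det * L.transpose.det ≠ 0 := by
    intro h0
    have := congrArg Matrix.det hLG
    rw [Matrix.det_mul, Matrix.det_mul, mul_right_comm, h0, zero_mul, Matrix.det_one] at this
    exact zero_ne_one this
  -- Both determinants carry the factors det L, det Lᵀ and the same power of 1/2; these cancel in
  -- the quotient and leave ∏ (1 + 2e)⁻¹.
  have hA : ((2 : ℝ) • G)⁻¹ = (1 / 2 : ℝ) • (L.transpose * L) := by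
    refine Matrix.inv_eq_left_inv ?_
    have h1 : G * L.transpose * L = 1 := by
      rw [Matrix.mul_assoc] at hLG
      exact mul_eq_one_comm.1 hLG
    have h2 : L.transpose * L * G = 1 := by
      rw [Matrix.mul_assoc] at h1
      exact mul_eq_one_comm.1 h1
    rw [Matrix.smul_mul, Matrix.mul_smul, smul_smul, h2]; norm_num
  have hAL : ((2 : ℝ) • G)⁻¹ + Matrix.diagonal l =
      (1 / 2 : ℝ) • (L.transpose * Matrix.diagonal (fun i => 1 + 2 * e i) * L) := by
    have h1 : Matrix.diagonal (fun i => 1 + 2 * e i) = 1 + (2 : ℝ) • Matrix.diagonal e := by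
      rw [← Matrix.diagonal_one, ← Matrix.diagonal_smul, Matrix.diagonal_add]; rfl
    rw [hA, ← hLe, h1, Matrix.mul_add, Matrix.add_mul, smul_add, Matrix.mul_one, Matrix.mul_smul,
      Matrix.smul_mul, smul_smul]
    norm_num
  rw [hAL, hA, Matrix.det_smul, Matrix.det_smul, Matrix.det_mul, Matrix.det_mul, Matrix.det_mul,
    Matrix.det_diagonal, Finset.prod_inv_distrib]
  have h3 : ∏ i, (1 + 2 * e i) ≠ 0 := Finset.prod_ne_zero_iff.2 fun i _ => by
    have := he i; positivity
  have h4 := left_ne_zero_of_mul hLdet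
  have h5 := right_ne_zero_of_mul hLdet
  field_simp

end GaussianSquares

/-! ### Laplace transforms of measures on the nonnegative orthant. -/

section LaplaceTransform

variable {E : Type*} [Fintype E]

/-- The exponential `v ↦ exp (-⟨l, v⟩)` on the nonnegative orthant. -/
noncomputable def negExp (l v : E → ℝ≥0) : ℝ := Real.exp (-∑ x, (l x : ℝ) * v x)

lemma negExp_nonneg (l v : E → ℝ≥0) : 0 ≤ negExp l v := (Real.exp_pos _).le

lemma negExp_le_one (l v : E → ℝ≥0) : negExp l v ≤ 1 :=
  Real.exp_le_one_iff.2 (neg_nonpos.2 (by positivity))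

@[fun_prop]
lemma continuous_negExp (l : E → ℝ≥0) : Continuous (negExp l) := by
  unfold negExp; fun_prop

lemma negExp_add_left (l m v : E → ℝ≥0) : negExp (l + m) v = negExp l v * negExp m v := by
  simp only [negExp, ← Real.exp_add, ← neg_add, ← Finset.sum_add_distrib, Pi.add_apply,
    NNReal.coe_add, add_mul]

lemma negExp_add_right (l v w : E → ℝ≥0) : negExp l (v + w) = negExp l v * negExp l w := by
  simp only [negExp, ← Real.exp_add, ← neg_add, ← Finset.sum_add_distrib, Pi.add_apply,
    NNReal.coe_add, mul_add]

lemma negExp_zero_left (v : E → ℝ≥0) : negExp 0 v = 1 := by simp [negExp]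

lemma negExp_zero_right (l : E → ℝ≥0) : negExp l 0 = 1 := by simp [negExp]

lemma negExp_sum_right {ι : Type*} (s : Finset ι) (l : E → ℝ≥0) (v : ι → E → ℝ≥0) :
    negExp l (∑ i ∈ s, v i) = ∏ i ∈ s, negExp l (v i) := by
  classical
  induction s using Finset.induction_on with
  | empty => simp [negExp_zero_right]
  | insert i s hi ih => rw [Finset.sum_insert hi, Finset.prod_insert hi, negExp_add_right, ih]

/-- Exponentials as bounded continuous functions. -/
noncomputable def negExpBCF (l : E → ℝ≥0) : BoundedContinuousFunction (E → ℝ≥0) ℝ :=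
  BoundedContinuousFunction.ofNormedAddCommGroup (negExp l) (by fun_prop) 1 fun v => by
    rw [Real.norm_of_nonneg (negExp_nonneg _ _)]; exact negExp_le_one _ _

@[simp] lemma negExpBCF_apply (l v : E → ℝ≥0) : negExpBCF l v = negExp l v := rfl

/-- The monoid of exponentials. -/
noncomputable def negExpSubmonoid (E : Type*) [Fintype E] :
    Submonoid (BoundedContinuousFunction (E → ℝ≥0) ℝ) where
  carrier := Set.range negExpBCF
  mul_mem' := by
    rintro _ _ ⟨l, rfl⟩ ⟨m, rfl⟩
    exact ⟨l + m, by ext v; simp [negExp_add_left]⟩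
  one_mem' := ⟨0, by ext v; simp [negExp_zero_left]⟩

/-- The algebra of linear combinations of exponentials. -/
noncomputable def negExpAlgebra (E : Type*) [Fintype E] :
    StarSubalgebra ℝ (BoundedContinuousFunction (E → ℝ≥0) ℝ) where
  toSubalgebra := Algebra.adjoin ℝ (negExpSubmonoid E : Set (BoundedContinuousFunction _ ℝ))
  star_mem' := by
    intro g hg
    have : star g = g := by ext v; simp
    rwa [this]

/-- A finite measure on the nonnegative orthant is determined by its Laplace transform. -/
theorem ext_of_laplaceTransform {P P' : Measure (E → ℝ≥0)} [IsFiniteMeasure P]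
    [IsFiniteMeasure P'] (h : ∀ l, ∫ v, negExp l v ∂P = ∫ v, negExp l v ∂P') : P = P' := by
  classical
  -- A Stone–Weierstrass argument: a point-separating algebra of bounded continuous functions
  -- determines a finite measure. Exponentials are closed under multiplication, so the algebra they
  -- generate is just their linear span.
  refine ext_of_forall_mem_subalgebra_integral_eq_of_pseudoEMetric_complete_countable
    (𝕜 := ℝ) (A := negExpAlgebra E) ?_ ?_
  · intro v w hvw
    obtain ⟨x, hx⟩ := Function.ne_iff.1 hvw
    refine ⟨negExp (Pi.single x 1), ⟨(negExpBCF (Pi.single x 1)).toContinuousMap,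
      ⟨negExpBCF (Pi.single x 1), Algebra.subset_adjoin ⟨_, rfl⟩, rfl⟩, rfl⟩, ?_⟩
    have hsum : ∀ v : E → ℝ≥0, ∑ y, ((Pi.single x 1 : E → ℝ≥0) y : ℝ) * v y = v x := by
      intro v
      rw [Finset.sum_eq_single x]
      · simp
      · intro y _ hy; simp [Pi.single_eq_of_ne hy]
      · simp
    simp only [negExp, hsum]
    intro h
    exact hx (NNReal.coe_injective (neg_injective (Real.exp_injective h)))
  · intro g hg
    have hg' : g ∈ Submodule.span ℝ (negExpSubmonoid E : Set (BoundedContinuousFunction _ ℝ)) := by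
      have h1 := Algebra.adjoin_eq_span ℝ
        (negExpSubmonoid E : Set (BoundedContinuousFunction (E → ℝ≥0) ℝ))
      rw [Submonoid.closure_eq] at h1
      rw [← h1]
      exact hg
    clear hg
    induction hg' using Submodule.span_induction with
    | mem g hg => obtain ⟨l, rfl⟩ := hg; exact h l
    | zero => simp
    | add f g _ _ hf hg =>
      simp only [BoundedContinuousFunction.coe_add, Pi.add_apply]
      rw [integral_add (f.integrable _) (g.integrable _),
        integral_add (f.integrable _) (g.integrable _), hf, hg]
    | smul c g _ hg =>
      simp only [BoundedContinuousFunction.coe_smul, smul_eq_mul]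
      rw [integral_const_mul, integral_const_mul, hg]

/-- `g` is the Laplace transform of an s-finite measure on the nonnegative orthant. -/
def IsLaplaceTransform (g : (E → ℝ≥0) → ℝ) : Prop :=
  (∀ l, 0 ≤ g l) ∧ ∃ ν : Measure (E → ℝ≥0), SFinite ν ∧
    ∀ l, ∫⁻ v, ENNReal.ofReal (negExp l v) ∂ν = ENNReal.ofReal (g l)

namespace IsLaplaceTransform

variable {f g : (E → ℝ≥0) → ℝ}

lemma const {c : ℝ} (hc : 0 ≤ c) : IsLaplaceTransform (fun _ : E → ℝ≥0 => c) := by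
  refine ⟨fun _ => hc, ENNReal.ofReal c • Measure.dirac 0, inferInstance, fun l => ?_⟩
  rw [lintegral_smul_measure, lintegral_dirac' _ (by fun_prop), negExp_zero_right]
  simp

/-- The measures are added. S-finiteness is preserved by countable sums and still suffices for the
product measures in `mul`. -/
lemma of_hasSum {ι : Type*} [Countable ι] {f : ι → (E → ℝ≥0) → ℝ}
    (hf : ∀ i, IsLaplaceTransform (f i)) (h : ∀ l, HasSum (fun i => f i l) (g l)) :
    IsLaplaceTransform g := by
  choose hf0 ν hν hL using hf
  refine ⟨fun l => (h l).nonneg fun i => hf0 i l, Measure.sum ν, inferInstance, fun l => ?_⟩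
  rw [lintegral_sum_measure, ← (h l).tsum_eq,
    ENNReal.ofReal_tsum_of_nonneg (fun i => hf0 i l) (h l).summable]
  exact tsum_congr fun i => hL i l

lemma sum {ι : Type*} [Fintype ι] {f : ι → (E → ℝ≥0) → ℝ}
    (hf : ∀ i, IsLaplaceTransform (f i)) : IsLaplaceTransform (fun l => ∑ i, f i l) :=
  of_hasSum hf fun _ => hasSum_fintype _

/-- The product is the transform of the convolution. -/
lemma mul (hf : IsLaplaceTransform f) (hg : IsLaplaceTransform g) :
    IsLaplaceTransform (fun l => f l * g l) := by
  obtain ⟨hf0, ν, hν, hfL⟩ := hf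
  obtain ⟨hg0, ν', hν', hgL⟩ := hg
  refine ⟨fun l => mul_nonneg (hf0 l) (hg0 l), (ν.prod ν').map (fun p => p.1 + p.2), inferInstance,
    fun l => ?_⟩
  rw [lintegral_map (by fun_prop) (by fun_prop), ENNReal.ofReal_mul (hf0 l), ← hfL, ← hgL,
    ← lintegral_prod_mul (by fun_prop) (by fun_prop)]
  simp only [negExp_add_right, ENNReal.ofReal_mul (negExp_nonneg _ _)]

lemma pow (hf : IsLaplaceTransform f) (n : ℕ) : IsLaplaceTransform (fun l => f l ^ n) := by
  induction n with
  | zero => simpa using const zero_le_one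
  | succ n ih => simpa only [pow_succ] using ih.mul hf

lemma prod {ι : Type*} (s : Finset ι) {f : ι → (E → ℝ≥0) → ℝ}
    (hf : ∀ i, IsLaplaceTransform (f i)) : IsLaplaceTransform (fun l => ∏ i ∈ s, f i l) := by
  classical
  induction s using Finset.induction_on with
  | empty => simpa using const zero_le_one
  | insert i s hi ih => simpa only [Finset.prod_insert hi] using (hf i).mul ih

/-- The exponential series of convolution powers, as for a compound Poisson law. -/
lemma exp (hf : IsLaplaceTransform f) : IsLaplaceTransform (fun l => Real.exp (f l)) := by
  refine of_hasSum (f := fun (n : ℕ) l => ((n.factorial : ℝ)⁻¹) * f l ^ n)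
    (fun n => (const (by positivity)).mul (hf.pow n)) fun l => ?_
  have := NormedSpace.exp_series_hasSum_exp' (𝕂 := ℝ) (f l)
  rw [← Real.exp_eq_exp_ℝ] at this
  simpa using this

/-- Powers of `1 / (c + l x)` are Laplace transforms of multiples of Gamma distributions. -/
lemma gamma [DecidableEq E] (x : E) {c β : ℝ} (hc : 0 < c) (hβ : 0 < β) :
    IsLaplaceTransform (fun l : E → ℝ≥0 => ((c + l x)⁻¹) ^ β) := by
  have hpos : ∀ l : E → ℝ≥0, 0 < c + l x := fun l => by positivity
  have hprob := isProbabilityMeasure_gammaMeasure hβ hc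
  refine ⟨fun l => by have := hpos l; positivity,
    ENNReal.ofReal ((c⁻¹) ^ β) • (gammaMeasure β c).map (fun t => Pi.single x t.toNNReal),
    inferInstance, fun l => ?_⟩
  have hm : Measurable (fun t : ℝ => (Pi.single x t.toNNReal : E → ℝ≥0)) := by
    refine measurable_pi_lambda _ fun y => ?_
    by_cases h : y = x
    · subst h; simpa using measurable_real_toNNReal
    · simp [Pi.single_eq_of_ne h]
  rw [lintegral_smul_measure, lintegral_map (by fun_prop) hm, gammaMeasure,
    lintegral_withDensity_eq_lintegral_mul _ (f := gammaPDF β c)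
      (measurable_gammaPDFReal _ _).ennreal_ofReal (by fun_prop)]
  -- Tilting the Gamma density of rate c by exp(-l t) gives the Gamma density of rate c + l, up to
  -- the factor (c/(c + l))^β. The weight c^(-β) put on the measure removes the numerator.
  have hpt : ∀ t : ℝ, (gammaPDF β c * fun t : ℝ => ENNReal.ofReal
      (negExp l (Pi.single x t.toNNReal))) t =
      ENNReal.ofReal ((c / (c + l x)) ^ β) * gammaPDF β (c + l x) t := by
    intro t
    rw [Pi.mul_apply]
    rcases lt_or_ge t 0 with ht | ht
    · rw [gammaPDF_of_neg ht, gammaPDF_of_neg ht, zero_mul, mul_zero]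
    · have hsum : ∑ y, (l y : ℝ) * ((Pi.single x t.toNNReal : E → ℝ≥0) y : ℝ) = l x * t := by
        rw [Finset.sum_eq_single x]
        · simp [ht]
        · intro y _ hy; simp [Pi.single_eq_of_ne hy]
        · simp
      have := hpos l
      have hG := Real.Gamma_pos_of_pos hβ
      rw [gammaPDF_of_nonneg ht, gammaPDF_of_nonneg ht, negExp, hsum,
        ← ENNReal.ofReal_mul (by positivity), ← ENNReal.ofReal_mul (by positivity)]
      congr 1
      rw [Real.div_rpow hc.le this.le, show -((c + l x) * t) = -(c * t) + -(l x * t) by ring,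
        Real.exp_add]
      have := (Real.rpow_pos_of_pos this β).ne'
      field_simp
  simp only [hpt]
  rw [lintegral_const_mul _ (f := gammaPDF β (c + l x)) (measurable_gammaPDFReal _ _).ennreal_ofReal,
    lintegral_gammaPDF_eq_one hβ (hpos l), mul_one, smul_eq_mul,
    ← ENNReal.ofReal_mul (by positivity)]
  congr 1
  rw [← Real.mul_rpow (by positivity) (by have := hpos l; positivity)]
  congr 1
  field_simp

end IsLaplaceTransform

end LaplaceTransform

/-! ### From the sign condition to infinite divisibility. -/

section Sufficiency

variable {E : Type*} [Fintype E]

/-- A measure on the nonnegative orthant is infinitely divisible if all roots of its Laplace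
transform are Laplace transforms. -/
lemma isInfinitelyDivisibleLaw_of_isLaplaceTransform (P : Measure (E → ℝ≥0))
    [IsProbabilityMeasure P]
    (h : ∀ n : ℕ, 1 ≤ n → IsLaplaceTransform fun l => (∫ v, negExp l v ∂P) ^ ((n : ℝ)⁻¹)) :
    IsInfinitelyDivisibleLaw (P.map fun v x => (v x : ℝ)) := by
  intro n hn
  obtain ⟨-, ν, -, hL⟩ := h n hn
  have hn0 : (n : ℝ) ≠ 0 := by positivity
  have hν : IsProbabilityMeasure ν := ⟨by
    have := hL 0
    simpa [negExp_zero_left] using this⟩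
  have hLν : ∀ l, ∫ v, negExp l v ∂ν = (∫ v, negExp l v ∂P) ^ ((n : ℝ)⁻¹) := by
    intro l
    rw [integral_eq_lintegral_of_nonneg_ae (ae_of_all _ fun v => negExp_nonneg l v)
      (by fun_prop), hL l, ENNReal.toReal_ofReal]
    exact Real.rpow_nonneg (integral_nonneg fun v => negExp_nonneg l v) _
  -- The n-fold convolution of ν has the Laplace transform of P, and Laplace transforms determine
  -- measures.
  have hP : P = (Measure.pi (fun _ : Fin n => ν)).map (fun v => ∑ i, v i) := by
    have : IsProbabilityMeasure ((Measure.pi (fun _ : Fin n => ν)).map (fun v => ∑ i, v i)) :=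
      Measure.isProbabilityMeasure_map (by fun_prop)
    refine ext_of_laplaceTransform fun l => ?_
    rw [integral_map (by fun_prop) (by fun_prop)]
    simp only [negExp_sum_right]
    rw [integral_fintype_prod_eq_prod (f := fun _ => negExp l)]
    simp only [hLν, Finset.prod_const, Finset.card_univ, Fintype.card_fin]
    rw [← Real.rpow_natCast, ← Real.rpow_mul (integral_nonneg fun v => negExp_nonneg l v),
      inv_mul_cancel₀ hn0, Real.rpow_one]
  have hcoe : Measurable (fun (v : E → ℝ≥0) x => (v x : ℝ)) := by fun_prop
  have hν' : IsProbabilityMeasure (ν.map fun v x => (v x : ℝ)) :=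
    Measure.isProbabilityMeasure_map hcoe.aemeasurable
  refine ⟨ν.map fun v x => (v x : ℝ), hν', ?_⟩
  rw [← Measure.pi_map_pi (fun _ => hcoe.aemeasurable),
    Measure.map_map (by fun_prop) (by fun_prop)]
  conv_lhs => rw [hP]
  rw [Measure.map_map (by fun_prop) (by fun_prop)]
  congr 1
  ext v x
  simp

lemma dotProduct_mulVec_le_sum_abs (A : Matrix E E ℝ) (v : E → ℝ) :
    v ⬝ᵥ A.mulVec v ≤ (∑ x, ∑ y, |A x y|) * (v ⬝ᵥ v) := by
  have hsq : ∀ x, v x ^ 2 ≤ v ⬝ᵥ v := fun x => by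
    simp only [dotProduct, ← sq]
    exact Finset.single_le_sum (f := fun x => v x ^ 2) (fun y _ => sq_nonneg _) (Finset.mem_univ x)
  simp only [dotProduct, Matrix.mulVec, Finset.mul_sum, Finset.sum_mul] at hsq ⊢
  simp only [← Finset.mul_sum, ← Finset.sum_mul] at hsq ⊢
  rw [Finset.sum_mul]
  refine Finset.sum_le_sum fun x _ => ?_
  rw [Finset.mul_sum, Finset.sum_mul]
  refine Finset.sum_le_sum fun y _ => ?_
  have h1 := hsq x
  have h2 := hsq y
  have h3 : |v x * v y| ≤ ∑ i, v i * v i := by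
    rw [abs_le]; constructor <;> nlinarith [sq_nonneg (v x - v y), sq_nonneg (v x + v y)]
  calc v x * (A x y * v y) ≤ |v x * (A x y * v y)| := le_abs_self _
    _ = |A x y| * |v x * v y| := by rw [← abs_mul]; congr 1; ring
    _ ≤ _ := by gcongr

variable [DecidableEq E]

/-- Makes B = c - A positive definite for large c, which supplies the lower spectral bound in the
trace expansion of log det(1 - uB). -/
lemma posDef_diagonal_const_sub (A : Matrix E E ℝ) (hA : A.IsSymm) {c : ℝ}
    (hc : ∑ x, ∑ y, |A x y| < c) : (Matrix.diagonal (fun _ => c) - A).PosDef := by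
  refine Matrix.PosDef.of_dotProduct_mulVec_pos ?_ fun v hv => ?_
  · rw [Matrix.IsHermitian, Matrix.conjTranspose_eq_transpose_of_trivial, Matrix.transpose_sub,
      Matrix.diagonal_transpose, hA.eq]
  · have h1 := dotProduct_mulVec_le_sum_abs A v
    have h2 : 0 < v ⬝ᵥ v := by
      have := Matrix.dotProduct_star_self_pos_iff.2 hv
      simpa using this
    have h3 : v ⬝ᵥ (Matrix.diagonal (fun _ => c)).mulVec v = c * (v ⬝ᵥ v) := by
      simp only [dotProduct, Matrix.mulVec_diagonal, Finset.mul_sum]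
      exact Finset.sum_congr rfl fun x _ => by ring
    rw [star_trivial, Matrix.sub_mulVec, dotProduct_sub, h3]
    nlinarith

/-- Powers of the determinantal Laplace transform of a matrix which is, up to a diagonal
congruence, an M-matrix. -/
lemma isLaplaceTransform_det_rpow (A : Matrix E E ℝ) (hA : A.PosDef) (d : E → ℝ)
    (hd : ∀ x, d x ≠ 0) (hdA : ∀ x y, x ≠ y → d x * A x y * d y ≤ 0) {β : ℝ} (hβ : 0 < β) :
    IsLaplaceTransform fun l : E → ℝ≥0 =>
      (A.det / (A + Matrix.diagonal (fun x => (l x : ℝ))).det) ^ β := by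
  have hAs : A.IsSymm := by
    have := hA.isHermitian
    rwa [Matrix.IsHermitian, Matrix.conjTranspose_eq_transpose_of_trivial] at this
  -- The sum dominates the diagonal of A, so B has a nonnegative diagonal; the extra 1 gives the
  -- strict inequality needed for B to be positive definite.
  set c : ℝ := ∑ x, ∑ y, |A x y| + 1 with hc
  have hsum0 : 0 ≤ ∑ x, ∑ y, |A x y| := by positivity
  have hc0 : 0 < c := by positivity
  have hAc : ∀ x, A x x ≤ c := fun x => by
    have h1 : |A x x| ≤ ∑ y, |A x y| :=
      Finset.single_le_sum (f := fun y => |A x y|) (fun y _ => abs_nonneg _) (Finset.mem_univ x)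
    have h2 : ∑ y, |A x y| ≤ ∑ x, ∑ y, |A x y| :=
      Finset.single_le_sum (f := fun x => ∑ y, |A x y|) (fun y _ => by positivity)
        (Finset.mem_univ x)
    linarith [le_abs_self (A x x)]
  set B : Matrix E E ℝ := Matrix.diagonal (fun _ => c) - A with hB
  have hBs : B.IsSymm := by
    rw [Matrix.IsSymm, hB, Matrix.transpose_sub, Matrix.diagonal_transpose, hAs.eq]
  have hBpos : B.PosDef := posDef_diagonal_const_sub A hAs (by linarith)
  -- Conjugation by diag(d) commutes with diag(u), so it keeps the traces of (uB)^k while making all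
  -- entries nonnegative.
  set B' : Matrix E E ℝ := Matrix.diagonal d * B * Matrix.diagonal (fun x => (d x)⁻¹) with hB'
  have hB'0 : ∀ x y, 0 ≤ B' x y := by
    intro x y
    rw [hB', Matrix.mul_diagonal, Matrix.diagonal_mul, hB, Matrix.sub_apply]
    by_cases hxy : x = y
    · subst hxy
      rw [Matrix.diagonal_apply_eq, mul_right_comm, mul_inv_cancel₀ (hd x), one_mul]
      linarith [hAc x]
    · rw [Matrix.diagonal_apply_ne _ hxy, zero_sub]
      have h1 := hdA x y hxy
      have h2 : d x * -A x y * (d y)⁻¹ = -(d x * A x y * d y) * ((d y)⁻¹) ^ 2 := by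
        have := hd y
        field_simp
      rw [h2]
      have : 0 ≤ -(d x * A x y * d y) := by linarith
      positivity
  set u : (E → ℝ≥0) → E → ℝ := fun l x => (c + l x)⁻¹ with hu
  have hcl : ∀ (l : E → ℝ≥0) x, 0 < c + (l x : ℝ) := fun l x => by positivity
  have hu0 : ∀ l x, 0 < u l x := fun l x => inv_pos.2 (hcl l x)
  have huL : ∀ x, IsLaplaceTransform fun l => u l x := fun x => by
    simpa using IsLaplaceTransform.gamma x hc0 one_pos
  -- The entries are polynomials with nonnegative coefficients in the functions 1/(c + l x).
  have hentry : ∀ k x y, IsLaplaceTransform fun l => ((Matrix.diagonal (u l) * B') ^ k) x y := by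
    intro k
    induction k with
    | zero =>
      intro x y
      simp only [pow_zero]
      refine IsLaplaceTransform.const ?_
      rw [Matrix.one_apply]; split_ifs <;> norm_num
    | succ k ih =>
      intro x y
      simp only [pow_succ, Matrix.mul_apply (M := _ ^ k), Matrix.diagonal_mul]
      exact IsLaplaceTransform.sum fun z =>
        (ih x z).mul ((huL z).mul (IsLaplaceTransform.const (hB'0 z y)))
  have htr : ∀ l k, ((Matrix.diagonal (u l) * B) ^ k).trace =
      ∑ x, ((Matrix.diagonal (u l) * B') ^ k) x x := by
    intro l k
    have hdd : Matrix.diagonal (fun x => (d x)⁻¹) * Matrix.diagonal d = 1 := by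
      rw [Matrix.diagonal_mul_diagonal, ← Matrix.diagonal_one]
      congr 1; ext x; exact inv_mul_cancel₀ (hd x)
    have h1 : Matrix.diagonal (u l) * B' =
        Matrix.diagonal d * (Matrix.diagonal (u l) * B) * Matrix.diagonal (fun x => (d x)⁻¹) := by
      rw [hB']
      simp only [← Matrix.mul_assoc, Matrix.diagonal_mul_diagonal]
      congr 4; ext x; ring
    have h2 : (Matrix.diagonal (u l) * B') ^ k =
        Matrix.diagonal d * (Matrix.diagonal (u l) * B) ^ k *
          Matrix.diagonal (fun x => (d x)⁻¹) := by
      induction k with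
      | zero => simpa using (mul_eq_one_comm.1 hdd).symm
      | succ k ih =>
        rw [pow_succ, ih, h1, pow_succ]
        set X := Matrix.diagonal (u l) * B
        calc Matrix.diagonal d * X ^ k * Matrix.diagonal (fun x => (d x)⁻¹) *
              (Matrix.diagonal d * X * Matrix.diagonal (fun x => (d x)⁻¹))
            = Matrix.diagonal d * X ^ k * (Matrix.diagonal (fun x => (d x)⁻¹) *
              Matrix.diagonal d) * X * Matrix.diagonal (fun x => (d x)⁻¹) := by
              simp only [Matrix.mul_assoc]
          _ = _ := by rw [hdd, Matrix.mul_one]; simp only [Matrix.mul_assoc]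
    have h3 : ∑ x, ((Matrix.diagonal (u l) * B') ^ k) x x =
        ((Matrix.diagonal (u l) * B') ^ k).trace := rfl
    rw [h3, h2, Matrix.trace_mul_comm, ← Matrix.mul_assoc, hdd, Matrix.one_mul]
  have hdet : ∀ l : E → ℝ≥0, A + Matrix.diagonal (fun x => (l x : ℝ)) =
      Matrix.diagonal (fun x => c + (l x : ℝ)) * (1 - Matrix.diagonal (u l) * B) := by
    intro l
    have h1 : Matrix.diagonal (fun x => c + (l x : ℝ)) * Matrix.diagonal (u l) = 1 := by
      rw [Matrix.diagonal_mul_diagonal, ← Matrix.diagonal_one]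
      congr 1; ext x; exact mul_inv_cancel₀ (hcl l x).ne'
    rw [Matrix.mul_sub, Matrix.mul_one, ← Matrix.mul_assoc, h1, Matrix.one_mul, hB,
      ← Matrix.diagonal_add]
    abel
  have hlog : ∀ l : E → ℝ≥0,
      HasSum (fun k : ℕ => ((Matrix.diagonal (u l) * B) ^ (k + 1)).trace / ((k : ℝ) + 1))
        (-Real.log (1 - Matrix.diagonal (u l) * B).det) ∧
      0 < (1 - Matrix.diagonal (u l) * B).det := by
    intro l
    have hui : (fun x => (u l x)⁻¹) = fun x => c + (l x : ℝ) := by ext x; simp [hu]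
    refine hasSum_trace_pow_neg_log_det (u l) (hu0 l) B hBs ?_ ?_
    · have : Matrix.diagonal (fun x => (u l x)⁻¹) - B =
          A + Matrix.diagonal (fun x => (l x : ℝ)) := by
        rw [hui, hB, ← Matrix.diagonal_add]; abel
      rw [this]
      exact hA.add_posSemidef (Matrix.PosSemidef.diagonal fun x => (l x).2)
    · rw [hui, add_comm]
      exact hBpos.add_posSemidef (Matrix.PosSemidef.diagonal fun x => (hcl l x).le)
  have hexp : IsLaplaceTransform fun l => Real.exp (β *
      (-Real.log (1 - Matrix.diagonal (u l) * B).det)) := by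
    refine ((IsLaplaceTransform.const hβ.le).mul (IsLaplaceTransform.of_hasSum
      (fun k => ?_) fun l => (hlog l).1)).exp
    simp only [htr, div_eq_inv_mul]
    exact (IsLaplaceTransform.const (by positivity)).mul
      (IsLaplaceTransform.sum fun x => hentry _ x x)
  have hfinal := ((IsLaplaceTransform.const (E := E)
    (Real.rpow_nonneg hA.det_pos.le β)).mul
    (IsLaplaceTransform.prod Finset.univ fun x => IsLaplaceTransform.gamma x hc0 hβ)).mul hexp
  convert hfinal using 2 with l
  have hprod : 0 < ∏ x, (c + (l x : ℝ)) := Finset.prod_pos fun x _ => hcl l x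
  rw [hdet, Matrix.det_mul, Matrix.det_diagonal, Real.div_rpow hA.det_pos.le
    (mul_nonneg hprod.le (hlog l).2.le), Real.mul_rpow hprod.le (hlog l).2.le,
    Real.finsetProd_rpow _ _ fun x _ => (inv_pos.2 (hcl l x)).le, Finset.prod_inv_distrib,
    Real.inv_rpow hprod.le, mul_neg, Real.exp_neg, mul_comm β, ← Real.rpow_def_of_pos (hlog l).2,
    div_eq_mul_inv, mul_inv, mul_assoc]

end Sufficiency

/-! ### Inclusion–exclusion sums. -/

section AlternatingSums

variable {E : Type*}

lemma sum_powerset_neg_one_pow_card_mul_prod (S : Finset E) (g : E → ℝ) :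
    ∑ T ∈ S.powerset, (-1 : ℝ) ^ T.card * ∏ x ∈ T, g x = ∏ x ∈ S, (1 - g x) := by
  simp only [sub_eq_add_neg]
  rw [Finset.prod_one_add]
  exact Finset.sum_congr rfl fun T _ => by rw [Finset.prod_neg]

/-- The terms of T and T ∪ {x} cancel. This removes constants, and cyclic words that miss a point of
S. -/
lemma sum_powerset_neg_one_pow_card_mul_eq_zero [DecidableEq E] {S : Finset E} {x : E} (hx : x ∈ S)
    (F : Finset E → ℝ) (hF : ∀ T, x ∉ T → F (insert x T) = F T) :
    ∑ T ∈ S.powerset, (-1 : ℝ) ^ T.card * F T = 0 := by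
  have hxS : x ∉ S.erase x := Finset.notMem_erase x S
  rw [← Finset.insert_erase hx, Finset.sum_powerset_insert hxS, ← Finset.sum_add_distrib]
  refine Finset.sum_eq_zero fun T hT => ?_
  have hxT : x ∉ T := fun h => hxS (Finset.mem_powerset.1 hT h)
  rw [hF T hxT, Finset.card_insert_of_notMem hxT, pow_succ]
  ring

end AlternatingSums

/-! ### Alternating differences of the logarithm of an infinitely divisible Laplace transform. -/

section LogComplete

variable {E : Type*} [Fintype E]

lemma integrable_exp_neg_sum {ν : Measure (E → ℝ)} [IsFiniteMeasure ν]
    (hν : ∀ᵐ v ∂ν, ∀ x, 0 ≤ v x) (l : E → ℝ) (hl : ∀ x, 0 ≤ l x) :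
    Integrable (fun v : E → ℝ => Real.exp (-∑ x, l x * v x)) ν := by
  refine Integrable.of_bound
    (by fun_prop : Continuous fun v : E → ℝ => Real.exp (-∑ x, l x * v x)).aestronglyMeasurable 1 ?_
  filter_upwards [hν] with v hv
  rw [Real.norm_of_nonneg (Real.exp_pos _).le]
  exact Real.exp_le_one_iff.2 (neg_nonpos.2 (Finset.sum_nonneg fun x _ =>
    mul_nonneg (hl x) (hv x)))

/-- The roots of an infinitely divisible law on the nonnegative orthant are carried by it. -/
lemma ae_nonneg_of_map_sum {ν : Measure (E → ℝ)} [IsProbabilityMeasure ν] {n : ℕ}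
    (hn : 1 ≤ n)
    (h : ∀ᵐ v ∂((Measure.pi (fun _ : Fin n => ν)).map (fun v => ∑ i, v i)), ∀ x, 0 ≤ v x) :
    ∀ᵐ v ∂ν, ∀ x, 0 ≤ v x := by
  rw [ae_map_iff (by fun_prop) (by
    simp only [Set.ofPred_forall]
    exact MeasurableSet.iInter fun x => measurableSet_le (by fun_prop) (by fun_prop))] at h
  rw [ae_all_iff]
  intro x
  rw [ae_iff]
  by_contra hne
  -- If coordinate x were negative with positive ν-probability, all n independent copies would be
  -- negative there with positive probability, and so would their sum.
  have h1 : (Measure.pi (fun _ : Fin n => ν)) (Set.univ.pi fun _ => {v | ¬ 0 ≤ v x}) = 0 := by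
    refine measure_mono_null (fun w hw => ?_) (ae_iff.1 h)
    simp only [Set.mem_pi, Set.mem_univ, forall_const, Set.mem_ofPred_eq, not_le] at hw
    simp only [Set.mem_ofPred_eq, not_forall, not_le]
    refine ⟨x, ?_⟩
    rw [Finset.sum_apply]
    exact Finset.sum_neg (fun i _ => hw i) ⟨⟨0, hn⟩, Finset.mem_univ _⟩
  rw [Measure.pi_pi, Finset.prod_const] at h1
  exact hne (pow_eq_zero_iff (by simp; omega) |>.1 h1)

variable [DecidableEq E]

/-- Under the integral, the alternating sum is exp(-∑ l v) ∏_{x ∈ S} (1 - exp(-h v)), which is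
nonnegative. -/
lemma sum_powerset_integral_exp_nonneg {ν : Measure (E → ℝ)} [IsFiniteMeasure ν]
    (hν : ∀ᵐ v ∂ν, ∀ x, 0 ≤ v x) (S : Finset E) (l h : E → ℝ) (hl : ∀ x, 0 ≤ l x)
    (hh : ∀ x, 0 ≤ h x) :
    0 ≤ ∑ T ∈ S.powerset, (-1 : ℝ) ^ T.card *
      ∫ v, Real.exp (-∑ x, (l x + if x ∈ T then h x else 0) * v x) ∂ν := by
  have hint : ∀ T : Finset E, Integrable (fun v : E → ℝ =>
      Real.exp (-∑ x, (l x + if x ∈ T then h x else 0) * v x)) ν := fun T =>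
    integrable_exp_neg_sum hν _ fun x => by split_ifs <;> simp [hl x, hh x, add_nonneg]
  simp only [← integral_const_mul]
  rw [← integral_finsetSum _ fun T _ => (hint T).const_mul _]
  refine integral_nonneg_of_ae ?_
  filter_upwards [hν] with v hv
  have h1 : ∀ T ∈ S.powerset, (-1 : ℝ) ^ T.card *
      Real.exp (-∑ x, (l x + if x ∈ T then h x else 0) * v x) =
      Real.exp (-∑ x, l x * v x) * ((-1 : ℝ) ^ T.card * ∏ x ∈ T, Real.exp (-(h x * v x))) := by
    intro T _
    have h2 : ∑ x, (l x + if x ∈ T then h x else 0) * v x =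
        ∑ x, l x * v x + ∑ x ∈ T, h x * v x := by
      simp only [add_mul, Finset.sum_add_distrib, ite_mul, zero_mul, Finset.sum_ite_mem,
        Finset.univ_inter]
    rw [h2, neg_add, Real.exp_add, ← Real.exp_sum, Finset.sum_neg_distrib]
    ring
  rw [Finset.sum_congr rfl h1, ← Finset.mul_sum, sum_powerset_neg_one_pow_card_mul_prod]
  refine mul_nonneg (Real.exp_pos _).le (Finset.prod_nonneg fun x _ => sub_nonneg.2 ?_)
  exact Real.exp_le_one_iff.2 (neg_nonpos.2 (mul_nonneg (hh x) (hv x)))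

/-- The logarithm of the Laplace transform of an infinitely divisible law on the nonnegative
orthant has nonnegative alternating differences. -/
lemma sum_powerset_log_integral_exp_nonneg {P : Measure (E → ℝ)} [IsProbabilityMeasure P]
    (hP : ∀ᵐ v ∂P, ∀ x, 0 ≤ v x) (hdiv : IsInfinitelyDivisibleLaw P) (S : Finset E)
    (hS : S.Nonempty) (l h : E → ℝ) (hl : ∀ x, 0 ≤ l x) (hh : ∀ x, 0 ≤ h x) :
    0 ≤ ∑ T ∈ S.powerset, (-1 : ℝ) ^ T.card *
      Real.log (∫ v, Real.exp (-∑ x, (l x + if x ∈ T then h x else 0) * v x) ∂P) := by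
  set L : Finset E → E → ℝ := fun T x => l x + if x ∈ T then h x else 0 with hL
  have hL0 : ∀ T x, 0 ≤ L T x := fun T x => by
    simp only [hL]; split_ifs <;> simp [hl x, hh x, add_nonneg]
  have hpos : ∀ T, 0 < ∫ v, Real.exp (-∑ x, L T x * v x) ∂P := fun T =>
    integral_exp_pos (integrable_exp_neg_sum hP _ (hL0 T))
  -- With p = 1/(n + 1), this concerns (φ^p - 1)/p, which tends to log φ; the double inverse matches
  -- `tendsto_rpow_sub_one_log`. Here φ^p is the Laplace transform of the root ν, and the constant
  -- -1 drops out because S is nonempty.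
  have hroot : ∀ n : ℕ, 0 ≤ ∑ T ∈ S.powerset, (-1 : ℝ) ^ T.card *
      ((((n : ℝ) + 1)⁻¹)⁻¹ * ((∫ v, Real.exp (-∑ x, L T x * v x) ∂P) ^ ((n : ℝ) + 1)⁻¹ - 1)) := by
    intro n
    obtain ⟨ν, hν, hPν⟩ := hdiv (n + 1) (by omega)
    have hν0 : ∀ᵐ v ∂ν, ∀ x, 0 ≤ v x :=
      ae_nonneg_of_map_sum (n := n + 1) (by omega) (hPν ▸ hP)
    have hpow : ∀ T, (∫ v, Real.exp (-∑ x, L T x * v x) ∂P) ^ ((n : ℝ) + 1)⁻¹ =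
        ∫ v, Real.exp (-∑ x, L T x * v x) ∂ν := by
      intro T
      have h1 : ∫ v, Real.exp (-∑ x, L T x * v x) ∂P =
          (∫ v, Real.exp (-∑ x, L T x * v x) ∂ν) ^ (n + 1) := by
        rw [hPν, integral_map (by fun_prop) (by fun_prop : Continuous fun v : E → ℝ =>
          Real.exp (-∑ x, L T x * v x)).aestronglyMeasurable]
        have h2 : ∀ w : Fin (n + 1) → E → ℝ, Real.exp (-∑ x, L T x * (∑ i, w i) x) =
            ∏ i, Real.exp (-∑ x, L T x * w i x) := by
          intro w
          rw [← Real.exp_sum, Finset.sum_neg_distrib, Finset.sum_comm]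
          simp only [Finset.sum_apply, Finset.mul_sum]
        simp only [h2]
        rw [integral_fintype_prod_eq_prod (f := fun _ (v : E → ℝ) => Real.exp (-∑ x, L T x * v x))]
        simp
      rw [h1, ← Nat.cast_succ, Real.pow_rpow_inv_natCast
        (integral_nonneg fun v => (Real.exp_pos _).le) (by omega)]
    have h3 := sum_powerset_integral_exp_nonneg hν0 S l h hl hh
    have h4 : ∑ T ∈ S.powerset, (-1 : ℝ) ^ T.card * 1 = 0 := by
      obtain ⟨x, hx⟩ := hS
      exact sum_powerset_neg_one_pow_card_mul_eq_zero hx (fun _ => 1) fun _ _ => rfl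
    have h5 : ∑ T ∈ S.powerset, (-1 : ℝ) ^ T.card *
        ((((n : ℝ) + 1)⁻¹)⁻¹ * ((∫ v, Real.exp (-∑ x, L T x * v x) ∂P) ^ ((n : ℝ) + 1)⁻¹ - 1)) =
        ((n : ℝ) + 1) * (∑ T ∈ S.powerset, (-1 : ℝ) ^ T.card *
          (∫ v, Real.exp (-∑ x, L T x * v x) ∂ν) - ∑ T ∈ S.powerset, (-1 : ℝ) ^ T.card * 1) := by
      rw [← Finset.sum_sub_distrib, Finset.mul_sum]
      refine Finset.sum_congr rfl fun T _ => ?_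
      rw [hpow, inv_inv]; ring
    rw [h5, h4, sub_zero]
    exact mul_nonneg (by positivity) h3
  have hinv : Tendsto (fun n : ℕ => ((n : ℝ) + 1)⁻¹) atTop (𝓝[>] 0) := by
    refine tendsto_nhdsWithin_iff.2 ⟨?_, Eventually.of_forall fun n => by
      simp only [Set.mem_Ioi]; positivity⟩
    simpa using tendsto_one_div_add_atTop_nhds_zero_nat (𝕜 := ℝ)
  refine ge_of_tendsto' (tendsto_finsetSum _ fun T _ =>
    ((tendsto_rpow_sub_one_log (hpos T)).comp hinv).const_mul _) hroot

end LogComplete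

/-! ### Leading terms of log-determinants and cyclic words. -/

section CyclicSums

variable {E : Type*} [Fintype E] [DecidableEq E]

/-- The remainder of the logarithmic series after N terms is of order ε^(N+1). -/
lemma tendsto_log_one_add_sub_taylor (e : ℝ) (N : ℕ) :
    Tendsto (fun ε : ℝ => (Real.log (1 + ε * e) +
      ∑ j ∈ Finset.range N, (-(ε * e)) ^ (j + 1) / (j + 1)) / ε ^ N) (𝓝[>] 0) (𝓝 0) := by
  have hb : Tendsto (fun ε : ℝ => |e| ^ (N + 1) * ε / (1 - ε * |e|)) (𝓝[>] 0) (𝓝 0) := by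
    have : ContinuousAt (fun ε : ℝ => |e| ^ (N + 1) * ε / (1 - ε * |e|)) 0 :=
      ContinuousAt.div (by fun_prop) (by fun_prop) (by simp)
    have h := this.tendsto
    simp only [mul_zero, zero_div] at h
    exact h.mono_left nhdsWithin_le_nhds
  have hsmall : ∀ᶠ ε : ℝ in 𝓝[>] 0, ε * |e| < 1 := by
    have : ContinuousAt (fun ε : ℝ => ε * |e|) 0 := by fun_prop
    have h := this.tendsto
    simp only [zero_mul] at h
    exact (h.mono_left nhdsWithin_le_nhds).eventually (gt_mem_nhds one_pos)
  refine squeeze_zero_norm' ?_ hb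
  filter_upwards [hsmall, self_mem_nhdsWithin] with ε h1 h0
  have h0' : 0 < ε := h0
  have habs : |-(ε * e)| = ε * |e| := by rw [abs_neg, abs_mul, abs_of_pos h0']
  have h2 := Real.abs_log_sub_add_sum_range_le (x := -(ε * e)) (by rwa [habs]) N
  rw [habs, sub_neg_eq_add] at h2
  rw [norm_div, Real.norm_eq_abs, norm_pow, Real.norm_of_nonneg h0'.le, add_comm,
    div_le_iff₀ (by positivity)]
  refine h2.trans_eq ?_
  rw [mul_pow]; ring

/-- The first nonvanishing term of an alternating sum of log-determinants. -/
lemma tendsto_sum_log_det_div_pow {ι : Type*} (s : Finset ι) (c : ι → ℝ) (u : ι → E → ℝ)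
    (hu : ∀ i x, 0 < u i x) (A : Matrix E E ℝ) (hA : A.IsSymm) (n : ℕ)
    (hvan : ∀ j < n, ∑ i ∈ s, c i * ((Matrix.diagonal (u i) * A) ^ (j + 1)).trace = 0) :
    Tendsto (fun ε : ℝ => (∑ i ∈ s, c i *
        Real.log (1 + ε • (Matrix.diagonal (u i) * A)).det) / ε ^ (n + 1)) (𝓝[>] 0)
      (𝓝 (-((-1) ^ (n + 1) / (n + 1) *
        ∑ i ∈ s, c i * ((Matrix.diagonal (u i) * A) ^ (n + 1)).trace))) := by
  have hspec := fun i => exists_spectrum_diagonal_mul (u i) (hu i) A hA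
  choose e htr hdet _ _ using hspec
  -- The logarithm is expanded at each eigenvalue. Power sums of eigenvalues are traces, so `hvan`
  -- kills every order below n + 1.
  have hlim := tendsto_finsetSum s fun i (_ : i ∈ s) =>
    (tendsto_finsetSum Finset.univ fun x (_ : x ∈ Finset.univ) =>
      tendsto_log_one_add_sub_taylor (e i x) (n + 1)).const_mul (c i)
  simp only [Finset.sum_const_zero, mul_zero] at hlim
  have hlim2 := hlim.add_const (-((-1) ^ (n + 1) / (n + 1) *
        ∑ i ∈ s, c i * ((Matrix.diagonal (u i) * A) ^ (n + 1)).trace))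
  rw [zero_add] at hlim2
  refine hlim2.congr' ?_
  have hne : ∀ᶠ ε : ℝ in 𝓝[>] 0, ∀ i ∈ s, ∀ x, 1 + ε * e i x ≠ 0 := by
    refine (Finset.eventually_all s).2 fun i _ => eventually_all.2 fun x => ?_
    have : ContinuousAt (fun ε : ℝ => 1 + ε * e i x) 0 := by fun_prop
    have h := this.tendsto
    simp only [zero_mul, add_zero] at h
    exact (h.mono_left nhdsWithin_le_nhds).eventually_ne one_ne_zero
  filter_upwards [hne, self_mem_nhdsWithin] with ε h1 h0
  have h0' : (0 : ℝ) < ε := h0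
  have hlog : ∀ i ∈ s, Real.log (1 + ε • (Matrix.diagonal (u i) * A)).det =
      ∑ x, Real.log (1 + ε * e i x) := by
    intro i hi
    have := hdet i (-ε)
    rw [neg_smul, sub_neg_eq_add] at this
    rw [this, Real.log_prod]
    · simp
    · intro x _; simpa using h1 i hi x
  have hpoly : ∑ i ∈ s, c i * ∑ x, ∑ j ∈ Finset.range (n + 1),
      (-(ε * e i x)) ^ (j + 1) / ((j : ℝ) + 1) =
      (-ε) ^ (n + 1) / ((n : ℝ) + 1) *
        ∑ i ∈ s, c i * ((Matrix.diagonal (u i) * A) ^ (n + 1)).trace := by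
    have h2 : ∀ i, ∑ x, ∑ j ∈ Finset.range (n + 1), (-(ε * e i x)) ^ (j + 1) / ((j : ℝ) + 1) =
        ∑ j ∈ Finset.range (n + 1), (-ε) ^ (j + 1) / ((j : ℝ) + 1) *
          ((Matrix.diagonal (u i) * A) ^ (j + 1)).trace := by
      intro i
      rw [Finset.sum_comm]
      refine Finset.sum_congr rfl fun j _ => ?_
      rw [htr, Finset.mul_sum]
      refine Finset.sum_congr rfl fun x _ => ?_
      rw [← neg_mul, mul_pow]; ring
    simp only [h2, Finset.mul_sum]
    rw [Finset.sum_comm, Finset.sum_range_succ, Finset.sum_eq_zero, zero_add]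
    · exact Finset.sum_congr rfl fun i _ => by ring
    · intro j hj
      have := hvan j (Finset.mem_range.1 hj)
      calc _ = (-ε) ^ (j + 1) / ((j : ℝ) + 1) *
            ∑ i ∈ s, c i * ((Matrix.diagonal (u i) * A) ^ (j + 1)).trace := by
            rw [Finset.mul_sum]; exact Finset.sum_congr rfl fun i _ => by ring
        _ = 0 := by rw [this, mul_zero]
  have hsum : ∑ i ∈ s, c i * Real.log (1 + ε • (Matrix.diagonal (u i) * A)).det =
      ∑ i ∈ s, c i * ∑ x, Real.log (1 + ε * e i x) :=
    Finset.sum_congr rfl fun i hi => by rw [hlog i hi]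
  rw [hsum]
  simp only [← Finset.sum_div, Finset.sum_add_distrib, mul_add, add_div, mul_div_assoc']
  rw [hpoly, neg_pow ε]
  have : ε ^ (n + 1) ≠ 0 := by positivity
  have hn : (n : ℝ) + 1 ≠ 0 := by positivity
  field_simp
  ring

/-- The combinatorial consequence of infinite divisibility: sums over cyclic words through all
points of `S`. -/
lemma sum_cyclic_words_nonneg (A : Matrix E E ℝ) (hA : A.PosDef) (S : Finset E) (n : ℕ)
    (hn : 1 ≤ n) (hS : S.card = n + 1)
    (hlog : ∀ l h : E → ℝ, (∀ x, 0 ≤ l x) → (∀ x, 0 ≤ h x) →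
      ∑ T ∈ S.powerset, (-1 : ℝ) ^ T.card * Real.log
        (A + Matrix.diagonal (fun x => l x + if x ∈ T then h x else 0)).det ≤ 0) :
    0 ≤ ∑ w : Fin (n + 1) → E with S ⊆ Finset.univ.image w, ∏ i, -A (w i) (w (i + 1)) := by
  have hAs : A.IsSymm := by
    have := hA.isHermitian
    rwa [Matrix.IsHermitian, Matrix.conjTranspose_eq_transpose_of_trivial] at this
  -- For l = h = ε⁻¹ the diagonal added to A is 2ε⁻¹ on T and ε⁻¹ elsewhere, which is the inverse of
  -- ε·u(T).
  set u : Finset E → E → ℝ := fun T x => if x ∈ T then 1 / 2 else 1 with hu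
  have hu0 : ∀ T x, 0 < u T x := fun T x => by simp only [hu]; split_ifs <;> norm_num
  have htrace : ∀ j : ℕ, ∑ T ∈ S.powerset, (-1 : ℝ) ^ T.card *
      ((Matrix.diagonal (u T) * A) ^ (j + 1)).trace =
      ∑ w : Fin (j + 1) → E, (∑ T ∈ S.powerset, (-1 : ℝ) ^ T.card * ∏ i, u T (w i)) *
        ∏ i, A (w i) (w (i + 1)) := by
    intro j
    simp only [trace_pow_eq_sum_prod, Matrix.diagonal_mul, Finset.prod_mul_distrib,
      Finset.mul_sum, Finset.sum_mul]
    rw [Finset.sum_comm]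
    exact Finset.sum_congr rfl fun _ _ => Finset.sum_congr rfl fun _ _ => by ring
  have hmiss : ∀ (j : ℕ) (w : Fin (j + 1) → E), ¬ S ⊆ Finset.univ.image w →
      ∑ T ∈ S.powerset, (-1 : ℝ) ^ T.card * ∏ i, u T (w i) = 0 := by
    intro j w hw
    obtain ⟨x, hxS, hxw⟩ := Finset.not_subset.1 hw
    refine sum_powerset_neg_one_pow_card_mul_eq_zero hxS _ fun T _ => ?_
    refine Finset.prod_congr rfl fun i _ => ?_
    have hne : w i ≠ x := fun h => hxw (Finset.mem_image.2 ⟨i, Finset.mem_univ _, h⟩)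
    simp only [hu, Finset.mem_insert, hne, false_or]
  -- A word with at most n letters cannot visit the n + 1 points of S.
  have hvan : ∀ j < n, ∑ T ∈ S.powerset, (-1 : ℝ) ^ T.card *
      ((Matrix.diagonal (u T) * A) ^ (j + 1)).trace = 0 := by
    intro j hj
    rw [htrace]
    refine Finset.sum_eq_zero fun w _ => ?_
    rw [hmiss j w, zero_mul]
    intro hsub
    have h1 := Finset.card_le_card hsub
    have h2 := (Finset.card_image_le (s := Finset.univ) (f := w))
    rw [Finset.card_univ, Fintype.card_fin] at h2
    omega
  -- Such a word visits each point of S exactly once, so the sum is ∏_{x ∈ S} (1 - 1/2).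
  have hfull : ∀ w : Fin (n + 1) → E, S ⊆ Finset.univ.image w →
      ∑ T ∈ S.powerset, (-1 : ℝ) ^ T.card * ∏ i, u T (w i) = (1 / 2) ^ (n + 1) := by
    intro w hw
    have h2 := (Finset.card_image_le (s := Finset.univ) (f := w))
    rw [Finset.card_univ, Fintype.card_fin] at h2
    have heq : S = Finset.univ.image w := Finset.eq_of_subset_of_card_le hw (by omega)
    have hinj : Set.InjOn w (Finset.univ : Finset (Fin (n + 1))) := by
      rw [← Finset.card_image_iff, ← heq, hS]; simp
    have h3 : ∀ T ∈ S.powerset, (-1 : ℝ) ^ T.card * ∏ i, u T (w i) =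
        (-1 : ℝ) ^ T.card * ∏ x ∈ T, (1 / 2 : ℝ) := by
      intro T hT
      rw [← Finset.prod_image (f := u T) hinj, ← heq]
      congr 1
      rw [← Finset.prod_subset (Finset.mem_powerset.1 hT)]
      · exact Finset.prod_congr rfl fun x hx => by simp [hu, hx]
      · intro x _ hx; simp [hu, hx]
    rw [Finset.sum_congr rfl h3, sum_powerset_neg_one_pow_card_mul_prod, Finset.prod_const, hS]
    norm_num
  have hlead : ∑ T ∈ S.powerset, (-1 : ℝ) ^ T.card *
      ((Matrix.diagonal (u T) * A) ^ (n + 1)).trace = (1 / 2) ^ (n + 1) *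
        ∑ w : Fin (n + 1) → E with S ⊆ Finset.univ.image w, ∏ i, A (w i) (w (i + 1)) := by
    rw [htrace, Finset.sum_filter, Finset.mul_sum]
    refine Finset.sum_congr rfl fun w _ => ?_
    split_ifs with h
    · rw [hfull w h]
    · rw [hmiss n w h, zero_mul, mul_zero]
  have hneg : ∀ ε : ℝ, 0 < ε → ∑ T ∈ S.powerset, (-1 : ℝ) ^ T.card *
      Real.log (1 + ε • (Matrix.diagonal (u T) * A)).det ≤ 0 := by
    intro ε hε
    have h1 := hlog (fun _ => ε⁻¹) (fun _ => ε⁻¹) (fun _ => by positivity) fun _ => by positivity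
    have h2 : ∀ T : Finset E, Real.log
        (A + Matrix.diagonal (fun x => ε⁻¹ + if x ∈ T then ε⁻¹ else 0)).det =
        ∑ x, Real.log (ε⁻¹ * (u T x)⁻¹) +
          Real.log (1 + ε • (Matrix.diagonal (u T) * A)).det := by
      intro T
      have h3 : (fun x => ε⁻¹ + if x ∈ T then ε⁻¹ else 0) = fun x => ε⁻¹ * (u T x)⁻¹ := by
        ext x; simp only [hu]; split_ifs <;> (norm_num; try ring)
      have h4 : Matrix.diagonal (fun x => ε⁻¹ * (u T x)⁻¹) *
          (1 + ε • (Matrix.diagonal (u T) * A)) =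
          A + Matrix.diagonal (fun x => ε⁻¹ * (u T x)⁻¹) := by
        have h5 : Matrix.diagonal (fun x => ε⁻¹ * (u T x)⁻¹) * (ε • Matrix.diagonal (u T)) = 1 := by
          rw [← Matrix.diagonal_smul, Matrix.diagonal_mul_diagonal, ← Matrix.diagonal_one]
          congr 1; ext x
          have := (hu0 T x).ne'
          simp only [Pi.smul_apply, smul_eq_mul]
          field_simp
        rw [Matrix.mul_add, Matrix.mul_one, ← Matrix.smul_mul, ← Matrix.mul_assoc, h5,
          Matrix.one_mul, add_comm]
      have h6 : 0 < (A + Matrix.diagonal (fun x => ε⁻¹ * (u T x)⁻¹)).det :=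
        (hA.add_posSemidef (Matrix.PosSemidef.diagonal fun x => by
          have := hu0 T x; simp only [Pi.zero_apply]; positivity)).det_pos
      rw [h3, ← h4, Matrix.det_mul, Matrix.det_diagonal] at *
      rw [Real.log_mul (left_ne_zero_of_mul h6.ne') (right_ne_zero_of_mul h6.ne'), Real.log_prod]
      intro x _
      have := hu0 T x
      positivity
    simp only [h2, mul_add, Finset.sum_add_distrib] at h1
    have h7 : ∑ T ∈ S.powerset, (-1 : ℝ) ^ T.card * ∑ x, Real.log (ε⁻¹ * (u T x)⁻¹) = 0 := by
      simp only [Finset.mul_sum]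
      rw [Finset.sum_comm]
      refine Finset.sum_eq_zero fun x _ => ?_
      -- The diagonal factor at x does not see whether another point y of S lies in T; such a y
      -- exists because S has at least two points.
      obtain ⟨y, hyS, hyx⟩ := Finset.exists_mem_ne (by omega : 1 < S.card) x
      refine sum_powerset_neg_one_pow_card_mul_eq_zero hyS _ fun T _ => ?_
      simp only [hu, Finset.mem_insert, hyx.symm, false_or]
    linarith
  have hlim := tendsto_sum_log_det_div_pow S.powerset (fun T => (-1 : ℝ) ^ T.card) u hu0 A hAs n
    hvan
  have hle := le_of_tendsto hlim (by
    filter_upwards [self_mem_nhdsWithin] with ε hε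
    have hε' : (0 : ℝ) < ε := hε
    exact div_nonpos_of_nonpos_of_nonneg (hneg ε hε') (by positivity))
  rw [hlead] at hle
  have hsum : ∑ w : Fin (n + 1) → E with S ⊆ Finset.univ.image w, ∏ i, -A (w i) (w (i + 1)) =
      (-1) ^ (n + 1) *
        ∑ w : Fin (n + 1) → E with S ⊆ Finset.univ.image w, ∏ i, A (w i) (w (i + 1)) := by
    rw [Finset.mul_sum]
    refine Finset.sum_congr rfl fun w _ => ?_
    rw [Finset.prod_neg]; simp
  rw [hsum]
  set X := ∑ w : Fin (n + 1) → E with S ⊆ Finset.univ.image w, ∏ i, A (w i) (w (i + 1))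
  have h8 : 0 ≤ ((1 / 2 : ℝ) ^ (n + 1) / (n + 1)) * ((-1) ^ (n + 1) * X) := by
    calc (0 : ℝ) ≤ (-1) ^ (n + 1) / (n + 1) * ((1 / 2) ^ (n + 1) * X) := by linarith
      _ = _ := by ring
  exact nonneg_of_mul_nonneg_right h8 (by positivity)

end CyclicSums

/-! ### From cyclic sums to a signature. -/

section Signature

variable {E : Type*}

/-- The graph on `F` of the nonzero off-diagonal entries of a symmetric matrix. -/
def supportGraph (C : Matrix E E ℝ) (hC : C.IsSymm) (F : Finset E) : SimpleGraph E where
  Adj x y := x ≠ y ∧ x ∈ F ∧ y ∈ F ∧ C x y ≠ 0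
  symm := ⟨fun x y ⟨h1, h2, h3, h4⟩ => ⟨h1.symm, h3, h2, by rwa [hC.apply]⟩⟩
  loopless := ⟨fun _ h => h.1 rfl⟩

lemma supportGraph_mem_of_reachable {C : Matrix E E ℝ} {hC : C.IsSymm} {F : Finset E} {x y : E}
    (hx : x ∈ F) (h : (supportGraph C hC F).Reachable x y) : y ∈ F := by
  obtain ⟨p⟩ := h
  induction p with
  | nil => exact hx
  | cons hadj _ ih => exact ih hadj.2.2.1

variable [DecidableEq E]

/-- A cyclic word through all points of `insert v K` has nonpositive weight if the weights in `K`
are nonnegative and `v` has exactly one positive and at most one negative neighbour in `K`. -/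
lemma prod_cyclic_word_nonpos (c : Matrix E E ℝ) (hc : c.IsSymm) (K : Finset E) (v x y : E)
    (hv : v ∉ K) (hK : ∀ a ∈ K, ∀ b ∈ K, a ≠ b → 0 ≤ c a b)
    (hx : ∀ z ∈ K, 0 < c v z → z = x) (hy : ∀ z ∈ K, c v z < 0 → z = y) {n : ℕ} (hn : 2 ≤ n)
    (hcard : K.card = n) (w : Fin (n + 1) → E) (hw : insert v K ⊆ Finset.univ.image w) :
    ∏ i, c (w i) (w (i + 1)) ≤ 0 := by
  have hcard' : (insert v K).card = n + 1 := by rw [Finset.card_insert_of_notMem hv, hcard]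
  have h2 := (Finset.card_image_le (s := Finset.univ) (f := w))
  rw [Finset.card_univ, Fintype.card_fin] at h2
  have heq : insert v K = Finset.univ.image w := Finset.eq_of_subset_of_card_le hw (by omega)
  have hinj : Function.Injective w := by
    rw [← Set.injOn_univ, ← Finset.coe_univ, ← Finset.card_image_iff, ← heq, hcard']; simp
  have hmem : ∀ i, w i ∈ insert v K := fun i => by
    rw [heq]; exact Finset.mem_image_of_mem _ (Finset.mem_univ i)
  obtain ⟨i, -, hi⟩ := Finset.mem_image.1 (hw (Finset.mem_insert_self v K))
  have hmemK : ∀ j, j ≠ i → w j ∈ K := fun j hj => by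
    refine (Finset.mem_insert.1 (hmem j)).resolve_left fun h => hj (hinj (h.trans hi.symm))
  have hone : (1 : Fin (n + 1)) ≠ 0 := by
    intro h; have := congrArg Fin.val h
    simp [Nat.mod_eq_of_lt (by omega : 1 < n + 1)] at this
  -- Since n ≥ 2 the cycle has at least three places, so the two neighbours of v in it are distinct.
  -- They cannot have weights of the same strict sign, and every factor away from v is nonnegative.
  have htwo : (1 + 1 : Fin (n + 1)) ≠ 0 := by
    intro h; have := congrArg Fin.val h
    simp [Fin.val_add, Nat.mod_eq_of_lt (by omega : 1 < n + 1),
      Nat.mod_eq_of_lt (by omega : 1 + 1 < n + 1)] at this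
  have h1 : i + 1 ≠ i := by simpa using hone
  have h3 : i - 1 ≠ i := by simpa using hone
  have h4 : i + 1 ≠ i - 1 := by
    intro h
    apply htwo
    have : i + (1 + 1) = i := by rw [← add_assoc, h, sub_add_cancel]
    simpa using this
  rw [← Finset.mul_prod_erase _ _ (Finset.mem_univ i),
    ← Finset.mul_prod_erase _ _ (Finset.mem_erase.2 ⟨h3, Finset.mem_univ (i - 1)⟩), ← mul_assoc,
    sub_add_cancel, hi, hc.apply v (w (i - 1))]
  refine mul_nonpos_of_nonpos_of_nonneg ?_ (Finset.prod_nonneg fun j hj => ?_)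
  · have hne : w (i + 1) ≠ w (i - 1) := fun h => h4 (hinj h)
    have hp := hmemK _ h1
    have hm := hmemK _ h3
    rcases lt_trichotomy (c v (w (i + 1))) 0 with ha | ha | ha <;>
    rcases lt_trichotomy (c v (w (i - 1))) 0 with hb | hb | hb
    · exact absurd ((hy _ hp ha).trans (hy _ hm hb).symm) hne
    · simp [hb]
    · exact mul_nonpos_of_nonpos_of_nonneg ha.le hb.le
    · simp [ha]
    · simp [ha]
    · simp [ha]
    · exact mul_nonpos_of_nonneg_of_nonpos ha.le hb.le
    · simp [hb]
    · exact absurd ((hx _ hp ha).trans (hx _ hm hb).symm) hne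
  · rw [Finset.mem_erase, Finset.mem_erase] at hj
    refine hK _ (hmemK j hj.2.1) _ (hmemK (j + 1) fun h => hj.1 (by rw [← h, add_sub_cancel_right]))
      fun h => ?_
    have := hinj h
    exact hone (by simpa using this.symm)

variable [Fintype E]

/-- A vertex cannot have neighbours of both signs in a connected component on which the weights are
nonnegative, if all sums over cyclic words are nonnegative. -/
lemma not_reachable_of_cyclic_sums_nonneg (C : Matrix E E ℝ) (hC : C.IsSymm)
    (H : ∀ (S : Finset E) (n : ℕ), 1 ≤ n → S.card = n + 1 →
      0 ≤ ∑ w : Fin (n + 1) → E with S ⊆ Finset.univ.image w, ∏ i, C (w i) (w (i + 1)))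
    (F : Finset E) (v : E) (hv : v ∉ F) (d : E → ℝ) (hd : ∀ x, d x ^ 2 = 1)
    (hdv : d v = 1)
    (hF : ∀ x ∈ F, ∀ y ∈ F, x ≠ y → 0 ≤ d x * C x y * d y) (x y : E) (hxF : x ∈ F)
    (hx : 0 < d x * C x v) (hy : d y * C y v < 0) :
    ¬ (supportGraph C hC F).Reachable x y := by
  intro hreach
  set Γ := supportGraph C hC F with hΓ
  -- Take neighbours of v of opposite signs at minimal distance. On a geodesic between them, x is
  -- then the only positive and y the only negative neighbour of v.
  obtain ⟨⟨x, y⟩, ⟨hxF, hx, hy, hreach⟩, hmin⟩ := Set.exists_min_image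
    {q : E × E | q.1 ∈ F ∧ 0 < d q.1 * C q.1 v ∧ d q.2 * C q.2 v < 0 ∧ Γ.Reachable q.1 q.2}
    (fun q => Γ.dist q.1 q.2) (Set.toFinite _) ⟨(x, y), hxF, hx, hy, hreach⟩
  simp only at hxF hx hy hreach hmin
  obtain ⟨p, hpath, hlen⟩ := hreach.exists_path_of_dist
  set K : Finset E := p.support.toFinset with hK
  have hKF : ∀ z ∈ K, z ∈ F := fun z hz =>
    supportGraph_mem_of_reachable hxF (p.takeUntil z (List.mem_toFinset.1 hz)).reachable
  have hvK : v ∉ K := fun h => hv (hKF v h)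
  have hKcard : K.card = p.length + 1 := by
    rw [hK, List.toFinset_card_of_nodup hpath.support_nodup, SimpleGraph.Walk.length_support]
  have hxy : x ≠ y := by rintro rfl; exact lt_asymm hx hy
  have hlen1 : 1 ≤ p.length := by
    rw [Nat.one_le_iff_ne_zero]
    exact fun h => hxy (SimpleGraph.Walk.eq_of_length_eq_zero h)
  set c : Matrix E E ℝ := fun a b => d a * C a b * d b with hcdef
  have hcs : c.IsSymm := by
    ext a b
    change d b * C b a * d a = d a * C a b * d b
    rw [hC.apply]; ring
  have hcv : ∀ z, c v z = d z * C z v := fun z => by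
    simp only [hcdef]; rw [hdv, hC.apply]; ring
  -- Each sign occurs twice along a cycle, so a change of signature does not affect cyclic products.
  have hprod : ∀ w : Fin (p.length + 1 + 1) → E,
      ∏ i, C (w i) (w (i + 1)) = ∏ i, c (w i) (w (i + 1)) := by
    intro w
    simp only [hcdef, Finset.prod_mul_distrib]
    have h1 : ∏ i, d (w (i + 1)) = ∏ i, d (w i) :=
      Fintype.prod_equiv (Equiv.addRight (1 : Fin (p.length + 1 + 1))) _ _ fun _ => rfl
    rw [h1, mul_right_comm, ← Finset.prod_mul_distrib]
    simp only [← sq, hd, Finset.prod_const_one, one_mul]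
  have hle : ∀ w : Fin (p.length + 1 + 1) → E, insert v K ⊆ Finset.univ.image w →
      ∏ i, C (w i) (w (i + 1)) ≤ 0 := by
    intro w hw
    rw [hprod]
    refine prod_cyclic_word_nonpos c hcs K v x y hvK
      (fun a ha b hb hab => hF a (hKF a ha) b (hKF b hb) hab) ?_ ?_ (by omega) hKcard w hw
    · intro z hz hpos
      rw [hcv] at hpos
      have hzs := List.mem_toFinset.1 hz
      by_contra hzx
      have h1 := hmin (z, y) ⟨hKF z hz, hpos, hy, (p.dropUntil z hzs).reachable⟩
      have h2 := SimpleGraph.dist_le (p.dropUntil z hzs)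
      have h3 := p.length_dropUntil_lt_length hzs hzx
      simp only at h1
      omega
    · intro z hz hneg
      rw [hcv] at hneg
      have hzs := List.mem_toFinset.1 hz
      by_contra hzy
      have h1 := hmin (x, z) ⟨hxF, hx, hneg, (p.takeUntil z hzs).reachable⟩
      have h2 := SimpleGraph.dist_le (p.takeUntil z hzs)
      have h3 := p.length_takeUntil_lt_length hzs hzy
      simp only at h1
      omega
  -- The cycle that runs from v along the geodesic and back to v has nonzero weight. All words in
  -- the sum have nonpositive weight, so the sum is strictly negative.
  set w₀ : Fin (p.length + 1 + 1) → E := Fin.cons v fun i => p.getVert i with hw₀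
  have hw₀S : insert v K ⊆ Finset.univ.image w₀ := by
    intro z hz
    rw [Finset.mem_image]
    rcases Finset.mem_insert.1 hz with rfl | hz
    · exact ⟨0, Finset.mem_univ _, rfl⟩
    · obtain ⟨k, hk, hkl⟩ := SimpleGraph.Walk.mem_support_iff_exists_getVert.1
        (List.mem_toFinset.1 hz)
      exact ⟨Fin.succ ⟨k, by omega⟩, Finset.mem_univ _, by rw [hw₀, Fin.cons_succ, hk]⟩
  have hw₀ne : ∏ i, C (w₀ i) (w₀ (i + 1)) ≠ 0 := by
    refine Finset.prod_ne_zero_iff.2 fun i _ => ?_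
    induction i using Fin.lastCases with
    | last =>
      rw [Fin.last_add_one]
      have : w₀ (Fin.last (p.length + 1)) = y := by
        rw [hw₀, ← Fin.succ_last, Fin.cons_succ]; simp
      rw [this]
      exact right_ne_zero_of_mul hy.ne
    | cast i =>
      rw [Fin.coeSucc_eq_succ]
      induction i using Fin.cases with
      | zero =>
        have : w₀ (Fin.succ 0) = x := by simp [hw₀]
        rw [this, Fin.castSucc_zero]
        simp only [hw₀, Fin.cons_zero]
        rw [hC.apply]
        exact right_ne_zero_of_mul hx.ne'
      | succ i =>
        rw [← Fin.succ_castSucc]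
        simp only [hw₀, Fin.cons_succ]
        exact (p.adj_getVert_succ (i := i) (by simp)).2.2.2
  have hH := H (insert v K) (p.length + 1) (by omega)
    (by rw [Finset.card_insert_of_notMem hvK, hKcard])
  refine absurd hH (not_le.2 (Finset.sum_neg' (fun w hw => hle w (Finset.mem_filter.1 hw).2)
    ⟨w₀, Finset.mem_filter.2 ⟨Finset.mem_univ _, hw₀S⟩, lt_of_le_of_ne (hle w₀ hw₀S) hw₀ne⟩))

/-- If all sums over cyclic words are nonnegative, the off-diagonal entries become nonnegative
after a change of signs of the coordinates. -/
lemma exists_signature_of_cyclic_sums_nonneg (C : Matrix E E ℝ) (hC : C.IsSymm)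
    (H : ∀ (S : Finset E) (n : ℕ), 1 ≤ n → S.card = n + 1 →
      0 ≤ ∑ w : Fin (n + 1) → E with S ⊆ Finset.univ.image w, ∏ i, C (w i) (w (i + 1))) :
    ∃ d : E → ℝ, (∀ x, d x ^ 2 = 1) ∧ ∀ x y, x ≠ y → 0 ≤ d x * C x y * d y := by
  classical
  suffices h : ∀ F : Finset E, ∃ d : E → ℝ, (∀ x, d x ^ 2 = 1) ∧
      ∀ x ∈ F, ∀ y ∈ F, x ≠ y → 0 ≤ d x * C x y * d y by
    obtain ⟨d, h1, h2⟩ := h Finset.univ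
    exact ⟨d, h1, fun x y => h2 x (Finset.mem_univ _) y (Finset.mem_univ _)⟩
  intro F
  induction F using Finset.induction_on with
  | empty => exact ⟨fun _ => 1, by simp, by simp⟩
  | insert v F hv ih =>
    obtain ⟨d₀, hd₀, hF₀⟩ := ih
    set d : E → ℝ := Function.update d₀ v 1 with hd_def
    have hdv : d v = 1 := by simp [hd_def]
    have hdF : ∀ x ∈ F, d x = d₀ x := fun x hx => by
      rw [hd_def, Function.update_of_ne]; rintro rfl; exact hv hx
    have hd : ∀ x, d x ^ 2 = 1 := fun x => by
      by_cases h : x = v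
      · rw [h, hdv]; norm_num
      · rw [hd_def, Function.update_of_ne h, hd₀]
    have hF : ∀ x ∈ F, ∀ y ∈ F, x ≠ y → 0 ≤ d x * C x y * d y := fun x hx y hy hxy => by
      rw [hdF x hx, hdF y hy]; exact hF₀ x hx y hy hxy
    set Γ := supportGraph C hC F with hΓ
    -- Flip the components in which v has a negative neighbour; those contain no positive one.
    -- Flipping whole components keeps the signs within F. The condition `x ≠ v` is needed because v
    -- reaches itself and C v v may be negative.
    set s : E → ℝ := fun x => if x ≠ v ∧ ∃ y, Γ.Reachable x y ∧ d y * C y v < 0 then -1 else 1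
      with hs
    have hs2 : ∀ x, s x ^ 2 = 1 := fun x => by simp only [hs]; split_ifs <;> norm_num
    have hsv : s v = 1 := by simp [hs]
    have hsv' : ∀ x ∈ F, 0 ≤ s x * (d x * C x v) := by
      intro x hx
      have hxv : x ≠ v := by rintro rfl; exact hv hx
      rcases lt_trichotomy (d x * C x v) 0 with h | h | h
      · have : s x = -1 := if_pos ⟨hxv, x, SimpleGraph.Reachable.refl _, h⟩
        rw [this]; linarith
      · rw [h, mul_zero]
      · have : s x = 1 := if_neg fun ⟨_, y, hr, hy⟩ =>
          not_reachable_of_cyclic_sums_nonneg C hC H F v hv d hd hdv hF x y hx h hy hr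
        rw [this]; linarith
    refine ⟨fun x => s x * d x, fun x => by rw [mul_pow, hs2, hd, one_mul], ?_⟩
    intro x hx y hy hxy
    change 0 ≤ s x * d x * C x y * (s y * d y)
    by_cases hxv : x = v
    · have hyv : y ≠ v := fun h => hxy (hxv.trans h.symm)
      have := hsv' y ((Finset.mem_insert.1 hy).resolve_left hyv)
      rw [hxv, hsv, hdv, hC.apply]
      linarith
    have hxF := (Finset.mem_insert.1 hx).resolve_left hxv
    by_cases hyv : y = v
    · have := hsv' x hxF
      rw [hyv, hsv, hdv]
      linarith
    have hyF := (Finset.mem_insert.1 hy).resolve_left hyv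
    by_cases h0 : C x y = 0
    · simp [h0]
    · have hadj : Γ.Adj x y := ⟨hxy, hxF, hyF, h0⟩
      have hsxy : s x = s y := by
        simp only [hs]
        refine if_congr ?_ rfl rfl
        constructor
        · rintro ⟨_, z, hr, hz⟩; exact ⟨hyv, z, hadj.symm.reachable.trans hr, hz⟩
        · rintro ⟨_, z, hr, hz⟩; exact ⟨hxv, z, hadj.reachable.trans hr, hz⟩
      have h1 := hF x hxF y hyF hxy
      calc 0 ≤ s y ^ 2 * (d x * C x y * d y) := by rw [hs2, one_mul]; exact h1
        _ = _ := by rw [hsxy]; ring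

end Signature

/-! ### Semigroup and potential of a transient Markov process. -/

namespace FiniteMarkovProcess

variable {E : Type*} [Fintype E] (Y : FiniteMarkovProcess E)

/-- The transition matrix at time `t`, extended to negative times by its value at time zero. -/
noncomputable def transitionMatrix (t : ℝ) : Matrix E E ℝ :=
  Matrix.of fun x y => (Y.transition t.toNNReal x y).toReal

lemma transition_le_one (t : ℝ≥0) (x y : E) : Y.transition t x y ≤ 1 :=
  have := Y.isProbabilityMeasure x
  @prob_le_one _ Y.mΩ _ _ _

lemma transition_ne_top (t : ℝ≥0) (x y : E) : Y.transition t x y ≠ ∞ :=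
  ((Y.transition_le_one t x y).trans_lt ENNReal.one_lt_top).ne

lemma transition_add (s t : ℝ≥0) (x y : E) :
    Y.transition (s + t) x y = ∑ z, Y.transition s x z * Y.transition t z y := by
  have := Y.markov x y s t Set.univ MeasurableSet.univ
  simpa [transition] using this

lemma transition_zero [DecidableEq E] (x y : E) :
    Y.transition 0 x y = if x = y then 1 else 0 := by
  let := Y.mΩ
  have := Y.isProbabilityMeasure x
  split_ifs with h
  · rw [← h]; exact Y.start x
  · have h1 : Y.P x {ω | Y.X 0 ω = some x}ᶜ = 0 :=
      (prob_compl_eq_zero_iff (Y.measurableSet_eq 0 (some x))).2 (Y.start x)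
    refine measure_mono_null ?_ h1
    intro ω (h3 : Y.X 0 ω = some y) (h2 : Y.X 0 ω = some x)
    exact h (Option.some_injective _ (h2.symm.trans h3))

/-- Right-continuity of the paths makes the indicators converge pointwise, and the measure is
finite. -/
lemma tendsto_transition_zero (x y : E) :
    Tendsto (fun t => Y.transition t x y) (𝓝[>] 0) (𝓝 (Y.transition 0 x y)) := by
  let := Y.mΩ
  have := Y.isProbabilityMeasure x
  refine tendsto_measure_of_tendsto_indicator_of_isFiniteMeasure _ _
    (fun t => Y.measurableSet_eq t (some y)) fun ω => ?_
  filter_upwards [Y.right_continuous ω 0] with t ht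
  simp only [ht]

lemma transitionMatrix_nonneg (t : ℝ) (x y : E) : 0 ≤ Y.transitionMatrix t x y :=
  ENNReal.toReal_nonneg

lemma transitionMatrix_le_one (t : ℝ) (x y : E) : Y.transitionMatrix t x y ≤ 1 :=
  ENNReal.toReal_le_of_le_ofReal zero_le_one (by simpa using Y.transition_le_one _ x y)

lemma transitionMatrix_add {s t : ℝ} (hs : 0 ≤ s) (ht : 0 ≤ t) :
    Y.transitionMatrix (s + t) = Y.transitionMatrix s * Y.transitionMatrix t := by
  ext x y
  simp only [transitionMatrix, Matrix.mul_apply, Matrix.of_apply]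
  rw [Real.toNNReal_add hs ht, transition_add, ENNReal.toReal_sum fun z _ =>
    ENNReal.mul_ne_top (Y.transition_ne_top _ _ _) (Y.transition_ne_top _ _ _)]
  simp only [ENNReal.toReal_mul]

lemma transitionMatrix_zero [DecidableEq E] : Y.transitionMatrix 0 = 1 := by
  ext x y
  simp only [transitionMatrix, Matrix.of_apply, Real.toNNReal_zero, transition_zero,
    Matrix.one_apply]
  split_ifs <;> simp

lemma tendsto_transitionMatrix_zero [DecidableEq E] (x y : E) :
    Tendsto (fun t => Y.transitionMatrix t x y) (𝓝 0) (𝓝 ((1 : Matrix E E ℝ) x y)) := by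
  have h1 : Tendsto (fun t : ℝ≥0 => (Y.transition t x y).toReal) (𝓝 0)
      (𝓝 ((1 : Matrix E E ℝ) x y)) := by
    have h2 : Y.transition 0 x y = ENNReal.ofReal ((1 : Matrix E E ℝ) x y) := by
      rw [transition_zero, Matrix.one_apply]; split_ifs <;> simp
    have h3 : ((1 : Matrix E E ℝ) x y) = (Y.transition 0 x y).toReal := by
      rw [h2, ENNReal.toReal_ofReal]
      rw [Matrix.one_apply]; split_ifs <;> norm_num
    have h4 : (Set.Ici (0 : ℝ≥0)) = Set.univ := by ext; simp
    rw [h3, ← nhdsWithin_univ, ← h4, ← Set.Ioi_insert, nhdsWithin_insert]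
    refine Tendsto.sup ?_ ((ENNReal.tendsto_toReal (Y.transition_ne_top _ _ _)).comp
      (Y.tendsto_transition_zero x y))
    exact tendsto_pure_nhds _ _
  have h5 : Tendsto Real.toNNReal (𝓝 0) (𝓝 0) := by
    have := (continuous_real_toNNReal.tendsto 0)
    rwa [Real.toNNReal_zero] at this
  exact h1.comp h5

/-- By the semigroup property, P_t - P_s = (P_{t-s} - 1) P_s, and the entries of P_s are at most 1.
Two-sided continuity thus reduces to continuity at time zero; negative times are clamped to 0. -/
lemma continuous_transitionMatrix (x y : E) : Continuous fun t => Y.transitionMatrix t x y := by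
  classical
  have hmax : ∀ t, Y.transitionMatrix t = Y.transitionMatrix (max t 0) := fun t => by
    simp only [transitionMatrix, Real.toNNReal, max_assoc, max_self]
  have hbound : ∀ s t : ℝ, 0 ≤ s → s ≤ t →
      |Y.transitionMatrix t x y - Y.transitionMatrix s x y| ≤
        ∑ z, |Y.transitionMatrix (t - s) x z - (1 : Matrix E E ℝ) x z| := by
    intro s t hs hst
    have h1 : Y.transitionMatrix t - Y.transitionMatrix s =
        (Y.transitionMatrix (t - s) - 1) * Y.transitionMatrix s := by
      rw [Matrix.sub_mul, Matrix.one_mul, ← transitionMatrix_add _ (by linarith) hs,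
        sub_add_cancel]
    rw [← Matrix.sub_apply, h1, Matrix.mul_apply]
    refine (Finset.abs_sum_le_sum_abs _ _).trans (Finset.sum_le_sum fun z _ => ?_)
    rw [abs_mul, abs_of_nonneg (Y.transitionMatrix_nonneg s z y)]
    exact mul_le_of_le_one_right (abs_nonneg _) (Y.transitionMatrix_le_one s z y)
  have hbound' : ∀ s t : ℝ, |Y.transitionMatrix t x y - Y.transitionMatrix s x y| ≤
        ∑ z, |Y.transitionMatrix |max t 0 - max s 0| x z - (1 : Matrix E E ℝ) x z| := by
    intro s t
    rw [hmax s, hmax t]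
    rcases le_total s t with h | h
    · have h2 : max s 0 ≤ max t 0 := max_le_max_right 0 h
      rw [abs_of_nonneg (sub_nonneg.2 h2)]
      exact hbound _ _ (le_max_right _ _) h2
    · have h2 : max t 0 ≤ max s 0 := max_le_max_right 0 h
      rw [abs_sub_comm, abs_sub_comm (max t 0), abs_of_nonneg (sub_nonneg.2 h2)]
      exact hbound _ _ (le_max_right _ _) h2
  rw [continuous_iff_continuousAt]
  intro s
  rw [ContinuousAt, tendsto_iff_dist_tendsto_zero]
  simp only [Real.dist_eq]
  refine squeeze_zero (fun _ => abs_nonneg _) (hbound' s) ?_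
  have hlim : Tendsto (fun t : ℝ => |max t 0 - max s 0|) (𝓝 s) (𝓝 0) := by
    have : Continuous fun t : ℝ => |max t 0 - max s 0| := by fun_prop
    simpa using this.tendsto s
  have hz : ∀ z, Tendsto (fun t : ℝ => |Y.transitionMatrix |max t 0 - max s 0| x z -
      (1 : Matrix E E ℝ) x z|) (𝓝 s) (𝓝 0) := fun z => by
    have := ((((Y.tendsto_transitionMatrix_zero x z).comp hlim).sub_const
      ((1 : Matrix E E ℝ) x z))).abs
    simpa using this
  simpa using tendsto_finsetSum Finset.univ fun z _ => hz z

lemma integrableOn_transitionMatrix (hT : Y.IsTransient) (x y : E) :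
    IntegrableOn (fun t => Y.transitionMatrix t x y) (Set.Ioi 0) := by
  refine ⟨(Y.continuous_transitionMatrix x y).aestronglyMeasurable, ?_⟩
  rw [hasFiniteIntegral_iff_ofReal (ae_of_all _ fun t => Y.transitionMatrix_nonneg t x y)]
  have := hT x y
  rw [potential] at this
  convert this using 3 with t
  exact ENNReal.ofReal_toReal (Y.transition_ne_top _ _ _)

lemma toReal_potential (x y : E) :
    (Y.potential x y).toReal = ∫ t in Set.Ioi 0, Y.transitionMatrix t x y := by
  rw [integral_eq_lintegral_of_nonneg_ae (ae_of_all _ fun t => Y.transitionMatrix_nonneg t x y)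
    (Y.continuous_transitionMatrix x y).aestronglyMeasurable, potential]
  congr 2 with t
  exact (ENNReal.ofReal_toReal (Y.transition_ne_top _ _ _)).symm

/-- The off-diagonal entries of the inverse of a potential matrix are nonpositive. -/
lemma inverse_potential_offDiag_nonpos [DecidableEq E] (hT : Y.IsTransient) (V : Matrix E E ℝ)
    (hV : (Matrix.of fun x y => (Y.potential x y).toReal) * V = 1) {x y : E} (hxy : x ≠ y) :
    V x y ≤ 0 := by
  set U : Matrix E E ℝ := Matrix.of fun x y => (Y.potential x y).toReal with hU
  set J : ℝ → Matrix E E ℝ := fun t => Matrix.of fun x y =>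
    ∫ s in (0 : ℝ)..t, Y.transitionMatrix s x y with hJ
  -- Shifting time by t, P_t U is the integral of the semigroup over (t, ∞). Multiplied by V = U⁻¹
  -- this gives J_t V = 1 - P_t, with nonpositive off-diagonal entries, while J_t/t → 1 as t
  -- decreases to 0.
  have hUJ : ∀ t : ℝ, 0 ≤ t → (1 - Y.transitionMatrix t) * U = J t := by
    intro t ht
    ext a b
    have h1 : U a b = J t a b + ∫ s in Set.Ioi t, Y.transitionMatrix s a b := by
      simp only [hU, hJ, Matrix.of_apply, toReal_potential]
      rw [intervalIntegral.integral_of_le ht, ← setIntegral_union (Set.Ioc_disjoint_Ioi le_rfl)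
        measurableSet_Ioi ((Y.integrableOn_transitionMatrix hT a b).mono_set
          Set.Ioc_subset_Ioi_self) ((Y.integrableOn_transitionMatrix hT a b).mono_set
          (Set.Ioi_subset_Ioi ht)), Set.Ioc_union_Ioi_eq_Ioi ht]
    have h2 : ∫ s in Set.Ioi t, Y.transitionMatrix s a b = (Y.transitionMatrix t * U) a b := by
      have h3 := (measurePreserving_add_right (volume : Measure ℝ) t).setIntegral_preimage_emb
        (measurableEmbedding_addRight t) (fun s => Y.transitionMatrix s a b) (Set.Ioi t)
      rw [← h3, Set.preimage_add_const_Ioi, sub_self]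
      have h4 : ∀ s ∈ Set.Ioi (0 : ℝ), Y.transitionMatrix (s + t) a b =
          ∑ z, Y.transitionMatrix t a z * Y.transitionMatrix s z b := by
        intro s hs
        rw [add_comm, Y.transitionMatrix_add ht (le_of_lt hs), Matrix.mul_apply]
      rw [setIntegral_congr_fun measurableSet_Ioi h4, integral_finsetSum _ fun z _ =>
        (Y.integrableOn_transitionMatrix hT z b).const_mul _, Matrix.mul_apply]
      simp only [integral_const_mul, hU, Matrix.of_apply, toReal_potential]
    rw [Matrix.sub_mul, Matrix.one_mul, Matrix.sub_apply, h1, h2, add_sub_cancel_right]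
  have hsign : ∀ t : ℝ, 0 < t → (t⁻¹ • (J t * V)) x y ≤ 0 := by
    intro t ht
    rw [← hUJ t ht.le, Matrix.mul_assoc, hV, Matrix.mul_one, Matrix.smul_apply, Matrix.sub_apply,
      Matrix.one_apply_ne hxy, zero_sub, smul_eq_mul]
    have := Y.transitionMatrix_nonneg t x y
    exact mul_nonpos_of_nonneg_of_nonpos (by positivity) (by linarith)
  have hlimJ : ∀ z, Tendsto (fun t : ℝ => t⁻¹ * J t x z) (𝓝[>] 0)
      (𝓝 ((1 : Matrix E E ℝ) x z)) := by
    intro z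
    have h1 := intervalIntegral.integral_hasDerivAt_right
      (f := fun s => Y.transitionMatrix s x z) (a := 0) (b := 0)
      ((Y.continuous_transitionMatrix x z).intervalIntegrable _ _)
      ((Y.continuous_transitionMatrix x z).stronglyMeasurableAtFilter _ _)
      (Y.continuous_transitionMatrix x z).continuousAt
    rw [transitionMatrix_zero] at h1
    have h2 := (hasDerivAt_iff_tendsto_slope_zero.1 h1).mono_left
      (nhdsWithin_mono 0 (s := Set.Ioi 0) fun t ht => ne_of_gt ht)
    simpa [hJ] using h2
  have hlim : Tendsto (fun t : ℝ => (t⁻¹ • (J t * V)) x y) (𝓝[>] 0) (𝓝 (V x y)) := by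
    have h1 : Tendsto (fun t : ℝ => ∑ z, (t⁻¹ * J t x z) * V z y) (𝓝[>] 0)
        (𝓝 (∑ z, (1 : Matrix E E ℝ) x z * V z y)) :=
      tendsto_finsetSum _ fun z _ => (hlimJ z).mul_const _
    rw [← Matrix.mul_apply, Matrix.one_mul] at h1
    refine h1.congr fun t => ?_
    rw [Matrix.smul_apply, Matrix.mul_apply, smul_eq_mul, Finset.mul_sum]
    exact Finset.sum_congr rfl fun z _ => by ring
  exact le_of_tendsto hlim (by
    filter_upwards [self_mem_nhdsWithin] with t ht using hsign t ht)

end FiniteMarkovProcess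

/-- A positive definite matrix that is diagonally congruent to a Green function has an inverse
which is diagonally congruent to a matrix with nonpositive off-diagonal entries. -/
lemma IsSymmetricTransientGreenFunction.inverse_offDiag_nonpos {E : Type*} [Fintype E]
    [DecidableEq E] {g : E → E → ℝ} (hg : IsSymmetricTransientGreenFunction g)
    {G : Matrix E E ℝ} (hG : G.PosDef) {d : E → ℝ} (hGd : ∀ x y, G x y = d x * g x y * d y) :
    (∀ x, d x ≠ 0) ∧ ∀ x y, x ≠ y → d x * G⁻¹ x y * d y ≤ 0 := by
  obtain ⟨Y, m, hm, hT, -, hgY⟩ := hg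
  have hd : ∀ x, d x ≠ 0 := fun x h => by
    have := hG.diag_pos (i := x)
    rw [hGd, h] at this
    simp at this
  refine ⟨hd, fun x y hxy => ?_⟩
  have hGinv : G * G⁻¹ = 1 := Matrix.mul_nonsing_inv _ hG.det_pos.ne'.isUnit
  set U : Matrix E E ℝ := Matrix.of fun x y => (Y.potential x y).toReal with hU
  have hUG : Matrix.diagonal d * U * Matrix.diagonal (fun x => (m x)⁻¹ * d x) = G := by
    ext a b
    rw [Matrix.mul_diagonal, Matrix.diagonal_mul, hGd, hgY,
      FiniteMarkovProcess.potentialDensity, hU, Matrix.of_apply]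
    ring
  -- The inverse of U is diag(d/m) G⁻¹ diag(d). Its off-diagonal signs are those of d G⁻¹ d because
  -- m is positive.
  have hUV : U * (Matrix.diagonal (fun x => (m x)⁻¹ * d x) * G⁻¹ * Matrix.diagonal d) = 1 := by
    have h1 : Matrix.diagonal d * (U * (Matrix.diagonal (fun x => (m x)⁻¹ * d x) * G⁻¹)) = 1 := by
      rw [← hGinv, ← hUG]; simp only [Matrix.mul_assoc]
    rw [← Matrix.mul_assoc]
    exact mul_eq_one_comm.1 h1
  have h2 := Y.inverse_potential_offDiag_nonpos hT _ hUV hxy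
  rw [Matrix.mul_diagonal, Matrix.diagonal_mul] at h2
  have h3 := hm x
  have h4 : d x * G⁻¹ x y * d y = m x * ((m x)⁻¹ * d x * G⁻¹ x y * d y) := by
    field_simp
  rw [h4]
  exact mul_nonpos_of_nonneg_of_nonpos h3.le h2

/-! ### The exponential law and its memoryless property. -/

section ExponentialLaw

/-- The standard exponential law, as a measure on `ℝ≥0`. -/
noncomputable def expLaw : Measure ℝ≥0 :=
  ((volume.restrict (Set.Ioi (0 : ℝ))).withDensity fun t => ENNReal.ofReal (Real.exp (-t))).map
    Real.toNNReal

lemma lintegral_expLaw {f : ℝ≥0 → ℝ≥0∞} (hf : Measurable f) :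
    ∫⁻ τ, f τ ∂expLaw = ∫⁻ t in Set.Ioi (0 : ℝ), ENNReal.ofReal (Real.exp (-t)) * f t.toNNReal := by
  rw [expLaw, lintegral_map hf measurable_real_toNNReal,
    lintegral_withDensity_eq_lintegral_mul _ (by fun_prop) (by fun_prop)]
  rfl

lemma setLIntegral_Ioi_comp_sub (s : ℝ) (f : ℝ → ℝ≥0∞) :
    ∫⁻ t in Set.Ioi s, f (t - s) = ∫⁻ t in Set.Ioi 0, f t := by
  have h := (measurePreserving_sub_right (volume : Measure ℝ) s).setLIntegral_comp_preimage_emb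
    (measurableEmbedding_subRight s) f (Set.Ioi 0)
  rwa [Set.preimage_sub_const_Ioi, zero_add] at h

/-- The memoryless property of the exponential law. -/
lemma lintegral_expLaw_overshoot {f : ℝ≥0 → ℝ≥0∞} (hf : Measurable f) (s : ℝ≥0) :
    ∫⁻ τ, (if s < τ then f (τ - s) else 0) ∂expLaw =
      ENNReal.ofReal (Real.exp (-s)) * ∫⁻ τ, f τ ∂expLaw := by
  rw [lintegral_expLaw (Measurable.ite measurableSet_Ioi (by fun_prop) measurable_const),
    lintegral_expLaw hf, ← lintegral_const_mul _ (by fun_prop)]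
  have h1 : ∀ t : ℝ, ENNReal.ofReal (Real.exp (-t)) *
      (if s < t.toNNReal then f (t.toNNReal - s) else 0) =
      (Set.Ioi (s : ℝ)).indicator (fun t => ENNReal.ofReal (Real.exp (-s)) *
        (ENNReal.ofReal (Real.exp (-(t - s))) * f (t - s).toNNReal)) t := by
    intro t
    by_cases h : (s : ℝ) < t
    · have h2 : s < t.toNNReal := Real.lt_toNNReal_iff_coe_lt.2 h
      rw [if_pos h2, Set.indicator_of_mem (Set.mem_Ioi.2 h), ← mul_assoc,
        ← ENNReal.ofReal_mul (Real.exp_pos _).le, ← Real.exp_add]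
      congr 3
      · ring
      · rw [NNReal.sub_def, Real.coe_toNNReal _ (s.2.trans h.le)]
    · have h2 : ¬ s < t.toNNReal := fun h' => h (Real.lt_toNNReal_iff_coe_lt.1 h')
      rw [if_neg h2, Set.indicator_of_notMem (by simpa using h), mul_zero]
  simp only [h1]
  rw [setLIntegral_indicator measurableSet_Ioi, Set.inter_eq_left.2 (Set.Ioi_subset_Ioi s.coe_nonneg)]
  exact setLIntegral_Ioi_comp_sub s fun t => ENNReal.ofReal (Real.exp (-s)) *
        (ENNReal.ofReal (Real.exp (-t)) * f t.toNNReal)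

instance isProbabilityMeasure_expLaw : IsProbabilityMeasure expLaw := ⟨by
  have h := lintegral_expLaw (f := fun _ => 1) measurable_const
  simp only [lintegral_one, mul_one] at h
  rw [h, ← ofReal_integral_eq_lintegral_ofReal (integrableOn_exp_neg_Ioi 0)
    (ae_of_all _ fun t => (Real.exp_pos _).le), integral_exp_neg_Ioi_zero, ENNReal.ofReal_one]⟩

end ExponentialLaw

/-! ### Splitting off the first term of an independent sequence. -/

section ConsSequence

variable {α : Type*}

/-- Prepending a term to a sequence. -/
def consSeq (a : α) (w : ℕ → α) : ℕ → α
  | 0 => a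
  | n + 1 => w n

@[simp] lemma consSeq_zero (a : α) (w : ℕ → α) : consSeq a w 0 = a := rfl

@[simp] lemma consSeq_succ (a : α) (w : ℕ → α) (n : ℕ) : consSeq a w (n + 1) = w n := rfl

variable [MeasurableSpace α]

@[fun_prop]
lemma measurable_consSeq : Measurable fun p : α × (ℕ → α) => consSeq p.1 p.2 :=
  measurable_pi_lambda _ fun n => by
    cases n with
    | zero => exact measurable_fst
    | succ n => exact (measurable_pi_apply n).comp measurable_snd

lemma infinitePi_eq_map_consSeq (ξ : Measure α) [IsProbabilityMeasure ξ] :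
    (ξ.prod (Measure.infinitePi fun _ : ℕ => ξ)).map (fun p => consSeq p.1 p.2) =
      Measure.infinitePi fun _ : ℕ => ξ := by
  refine Measure.eq_infinitePi _ fun s t ht => ?_
  classical
  rw [Measure.map_apply measurable_consSeq (MeasurableSet.pi s.countable_toSet fun i _ => ht i)]
  set t' : ℕ → Set α := fun i => if i ∈ s then t i else Set.univ with ht'
  have ht'm : ∀ i, MeasurableSet (t' i) := fun i => by
    simp only [ht']; split_ifs <;> simp [ht]
  obtain ⟨N, hN⟩ : ∃ N, ∀ i ∈ s, i < N + 1 := ⟨s.sup id, fun i hi =>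
    Nat.lt_succ_of_le (Finset.le_sup (f := id) hi)⟩
  have hset : (fun p : α × (ℕ → α) => consSeq p.1 p.2) ⁻¹' (Set.pi s t) =
      t' 0 ×ˢ Set.pi (Finset.range N) (fun i => t' (i + 1)) := by
    ext ⟨a, w⟩
    simp only [Set.mem_preimage, Set.mem_pi, Set.mem_prod, ht', Finset.mem_coe, Finset.mem_range]
    constructor
    · intro h
      refine ⟨?_, fun i _ => ?_⟩
      · split_ifs with h0
        · exact h 0 h0
        · trivial
      · split_ifs with h0
        · exact h _ h0
        · trivial
    · rintro ⟨h0, h1⟩ i hi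
      cases i with
      | zero => simpa [hi] using h0
      | succ i => simpa [hi] using h1 i (by have := hN _ hi; omega)
  rw [hset, Measure.prod_prod, Measure.infinitePi_pi _ fun i _ => ht'm _]
  have h2 : ∏ i ∈ s, ξ (t i) = ∏ i ∈ Finset.range (N + 1), ξ (t' i) := by
    rw [← Finset.prod_subset (fun i hi => Finset.mem_range.2 (hN i hi))]
    · exact Finset.prod_congr rfl fun i hi => by simp [ht', hi]
    · intro i _ hi; simp [ht', hi]
  rw [h2, Finset.prod_range_succ', mul_comm]

/-- Conditioning on the first term: the source of all inductions on the number of jumps. -/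
lemma infinitePi_apply_eq_lintegral_consSeq (ξ : Measure α) [IsProbabilityMeasure ξ]
    {S : Set (ℕ → α)} (hS : MeasurableSet S) :
    (Measure.infinitePi fun _ : ℕ => ξ) S =
      ∫⁻ a, (Measure.infinitePi fun _ : ℕ => ξ) {w | consSeq a w ∈ S} ∂ξ := by
  conv_lhs => rw [← infinitePi_eq_map_consSeq, Measure.map_apply measurable_consSeq hS,
    Measure.prod_apply (measurable_consSeq hS)]
  rfl

end ConsSequence

/-! ### Paths of the jump chain. -/

/-- A choice, for every state, of the state (or the cemetery point) to jump to. -/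
def JumpMap.{u} (E : Type u) : Type u := E → Option E

namespace JumpMap

instance (E : Type*) : MeasurableSpace (JumpMap E) := ⊤

instance (E : Type*) : DiscreteMeasurableSpace (JumpMap E) := ⟨fun _ => trivial⟩

instance (E : Type*) [Finite E] : Finite (JumpMap E) :=
  inferInstanceAs (Finite (E → Option E))

end JumpMap

namespace JumpChain

variable {E : Type*}

/-- The time of the `k`-th jump. -/
noncomputable def jumpTime (k : ℕ) (w : ℕ → ℝ≥0 × JumpMap E) : ℝ≥0 :=
  ∑ j ∈ Finset.range k, (w j).1

/-- The state after `k` jumps. -/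
def skeleton (x : E) : ℕ → (ℕ → ℝ≥0 × JumpMap E) → Option E
  | 0, _ => some x
  | k + 1, w => (skeleton x k w).bind (w k).2

/-- The event that exactly `k` jumps occur up to time `t`. -/
def level (k : ℕ) (t : ℝ≥0) : Set (ℕ → ℝ≥0 × JumpMap E) :=
  {w | jumpTime k w ≤ t ∧ t < jumpTime (k + 1) w}

open Classical in
/-- The position at time `t` of the process started from `x`. -/
noncomputable def position (x : E) (t : ℝ≥0) (w : ℕ → ℝ≥0 × JumpMap E) : Option E :=
  -- After an explosion the path is sent to the cemetery, so absorption and right-continuity hold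
  -- for every sequence and not only almost surely.
  if h : ∃ k, t < jumpTime (k + 1) w then skeleton x (Nat.find h) w else none

/-- The jumps after time `s`, seen from time `s`, when `k` jumps have occurred before. -/
noncomputable def restart (k : ℕ) (s : ℝ≥0) (w : ℕ → ℝ≥0 × JumpMap E) : ℕ → ℝ≥0 × JumpMap E :=
  consSeq (jumpTime (k + 1) w - s, (w k).2) fun n => w (n + (k + 1))

variable {x y z : E} {k : ℕ} {s t : ℝ≥0} {w : ℕ → ℝ≥0 × JumpMap E}

lemma jumpTime_zero : jumpTime 0 w = 0 := by simp [jumpTime]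

lemma jumpTime_succ : jumpTime (k + 1) w = jumpTime k w + (w k).1 := by
  simp [jumpTime, Finset.sum_range_succ]

lemma jumpTime_mono : Monotone fun k => jumpTime k w :=
  monotone_nat_of_le_succ fun k => by rw [jumpTime_succ]; exact le_self_add

lemma jumpTime_consSeq (a : ℝ≥0 × JumpMap E) :
    jumpTime (k + 1) (consSeq a w) = a.1 + jumpTime k w := by
  simp [jumpTime, Finset.sum_range_succ', add_comm]

lemma skeleton_consSeq (a : ℝ≥0 × JumpMap E) :
    skeleton x (k + 1) (consSeq a w) = (a.2 x).bind fun z => skeleton z k w := by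
  induction k with
  | zero =>
    simp only [skeleton, consSeq_zero]
    exact (Option.bind_fun_some _).symm
  | succ k ih =>
    rw [skeleton, ih, consSeq_succ]
    exact Option.bind_assoc _ _ _

lemma skeleton_eq_none_of_le {j : ℕ} (hjk : j ≤ k) (h : skeleton x j w = none) :
    skeleton x k w = none := by
  induction k, hjk using Nat.le_induction with
  | base => exact h
  | succ k _ ih => rw [skeleton, ih]; rfl

lemma position_of_mem_level (h : w ∈ level k t) : position x t w = skeleton x k w := by
  have hex : ∃ k, t < jumpTime (k + 1) w := ⟨k, h.2⟩
  classical
  rw [position, dif_pos hex]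
  congr 1
  refine le_antisymm (Nat.find_min' hex h.2) ?_
  by_contra hlt
  push Not at hlt
  exact absurd (Nat.find_spec hex) (not_lt.2 ((jumpTime_mono hlt).trans h.1))

lemma position_eq_none (h : ∀ k, jumpTime (k + 1) w ≤ t) : position x t w = none :=
  dif_neg fun ⟨k, hk⟩ => absurd hk (not_lt.2 (h k))

lemma exists_mem_level_or (t : ℝ≥0) (w : ℕ → ℝ≥0 × JumpMap E) :
    (∃ k, w ∈ level k t) ∨ ∀ k, jumpTime (k + 1) w ≤ t := by
  classical
  by_cases h : ∃ k, t < jumpTime (k + 1) w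
  · refine Or.inl ⟨Nat.find h, ?_, Nat.find_spec h⟩
    rcases Nat.eq_zero_or_pos (Nat.find h) with h0 | h0
    · rw [h0, jumpTime_zero]; exact zero_le
    · have := Nat.find_min h (m := Nat.find h - 1) (by omega)
      rw [Nat.sub_add_cancel h0] at this
      exact not_lt.1 this
  · push Not at h
    exact Or.inr h

lemma level_disjoint : Pairwise (Function.onFun Disjoint fun k => level (E := E) k t) := by
  have : ∀ {j k : ℕ}, j < k → Disjoint (level (E := E) j t) (level k t) := by
    intro j k hjk
    rw [Set.disjoint_left]
    intro w h1 h2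
    exact absurd h1.2 (not_lt.2 ((jumpTime_mono hjk).trans h2.1))
  intro j k hjk
  rcases lt_or_gt_of_ne hjk with h | h
  · exact this h
  · exact (this h).symm

lemma position_eq_some_iff :
    position x t w = some y ↔ ∃ k, w ∈ level k t ∧ skeleton x k w = some y := by
  constructor
  · intro h
    rcases exists_mem_level_or t w with ⟨k, hk⟩ | hk
    · exact ⟨k, hk, by rw [← position_of_mem_level hk, h]⟩
    · rw [position_eq_none hk] at h; exact absurd h (by simp)
  · rintro ⟨k, hk, h⟩
    rw [position_of_mem_level hk, h]

lemma position_absorbing (hst : s ≤ t) (h : position x s w = none) : position x t w = none := by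
  rcases exists_mem_level_or t w with ⟨k, hk⟩ | hk
  · rcases exists_mem_level_or s w with ⟨j, hj⟩ | hj
    · rw [position_of_mem_level hk]
      rw [position_of_mem_level hj] at h
      refine skeleton_eq_none_of_le ?_ h
      by_contra hlt
      push Not at hlt
      exact absurd (hst.trans_lt hk.2) (not_lt.2 ((jumpTime_mono hlt).trans hj.1))
    · exact absurd (hst.trans_lt hk.2) (not_lt.2 (hj k))
  · exact position_eq_none hk

lemma position_right_continuous (x : E) (t : ℝ≥0) (w : ℕ → ℝ≥0 × JumpMap E) :
    ∀ᶠ s in 𝓝[>] t, position x s w = position x t w := by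
  rcases exists_mem_level_or t w with ⟨k, hk⟩ | hk
  · filter_upwards [Ioo_mem_nhdsGT hk.2] with s hs
    rw [position_of_mem_level hk, position_of_mem_level (k := k) ⟨hk.1.trans hs.1.le, hs.2⟩]
  · filter_upwards [self_mem_nhdsWithin] with s hs
    rw [position_eq_none hk, position_eq_none fun k => (hk k).trans (le_of_lt hs)]

lemma jumpTime_restart (h : w ∈ level k s) (j : ℕ) :
    s + jumpTime (j + 1) (restart k s w) = jumpTime (k + j + 1) w := by
  induction j with
  | zero =>
    rw [jumpTime_succ, jumpTime_zero, zero_add, restart, consSeq_zero, add_zero]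
    exact add_tsub_cancel_of_le h.2.le
  | succ j ih =>
    rw [jumpTime_succ, ← add_assoc, ih, restart, consSeq_succ, jumpTime_succ (k := k + (j + 1)),
      show j + (k + 1) = k + (j + 1) by omega, add_assoc k j 1]

lemma skeleton_restart (h : skeleton x k w = some z) (j : ℕ) :
    skeleton z j (restart k s w) = skeleton x (k + j) w := by
  induction j with
  | zero => rw [add_zero, h]; rfl
  | succ j ih =>
    rw [skeleton, ih, ← add_assoc, skeleton]
    cases j with
    | zero => rfl
    | succ j =>
      rw [restart, consSeq_succ]
      congr 3
      omega

/-- The flow property of the paths. -/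
lemma position_add (h : w ∈ level k s) (hz : skeleton x k w = some z) :
    position x (s + t) w = position z t (restart k s w) := by
  rcases exists_mem_level_or t (restart k s w) with ⟨j, hj⟩ | hj
  · rw [position_of_mem_level hj, skeleton_restart hz]
    refine position_of_mem_level ⟨?_, ?_⟩
    · cases j with
      | zero => exact h.1.trans le_self_add
      | succ j =>
        rw [← add_assoc, ← jumpTime_restart h]
        exact add_le_add_right hj.1 s
    · rw [← jumpTime_restart h]
      exact add_lt_add_right hj.2 s
  · rw [position_eq_none hj]
    refine position_eq_none fun i => ?_
    calc jumpTime (i + 1) w ≤ jumpTime (k + i + 1) w := jumpTime_mono (by omega)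
      _ = s + jumpTime (i + 1) (restart k s w) := (jumpTime_restart h i).symm
      _ ≤ s + t := add_le_add_right (hj i) s

lemma level_zero_consSeq (a : ℝ≥0 × JumpMap E) : consSeq a w ∈ level 0 s ↔ s < a.1 := by
  simp [level, jumpTime_zero, jumpTime_succ]

lemma level_succ_consSeq (a : ℝ≥0 × JumpMap E) :
    consSeq a w ∈ level (k + 1) s ↔ a.1 ≤ s ∧ w ∈ level k (s - a.1) := by
  simp only [level, Set.mem_ofPred_eq, jumpTime_consSeq]
  constructor
  · rintro ⟨h1, h2⟩
    have h3 : a.1 ≤ s := le_self_add.trans h1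
    exact ⟨h3, le_tsub_of_add_le_left h1, (tsub_lt_iff_left h3).2 h2⟩
  · rintro ⟨h1, h2, h3⟩
    exact ⟨(le_tsub_iff_left h1).1 h2, (tsub_lt_iff_left h1).1 h3⟩

lemma restart_succ_consSeq (a : ℝ≥0 × JumpMap E) (ha : a.1 ≤ s) :
    restart (k + 1) s (consSeq a w) = restart k (s - a.1) w := by
  rw [restart, restart, jumpTime_consSeq]
  congr 2
  rw [tsub_tsub_eq_add_tsub_of_le ha, add_comm]

lemma skeleton_congr {w' : ℕ → ℝ≥0 × JumpMap E} (h : ∀ j < k, w j = w' j) :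
    skeleton x k w = skeleton x k w' := by
  induction k with
  | zero => rfl
  | succ k ih => rw [skeleton, skeleton, ih fun j hj => h j (by omega), h k (by omega)]

lemma jumpTime_congr {w' : ℕ → ℝ≥0 × JumpMap E} (h : ∀ j < k, w j = w' j) :
    jumpTime k w = jumpTime k w' :=
  Finset.sum_congr rfl fun j hj => by rw [h j (Finset.mem_range.1 hj)]

/-- The sequence stopped after `k` jumps, followed by a jump after time `s`. -/
noncomputable def freeze (k : ℕ) (s : ℝ≥0) (w : ℕ → ℝ≥0 × JumpMap E) : ℕ → ℝ≥0 × JumpMap E :=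
  fun j => if j < k then w j else (s + 1, fun _ => none)

/-- On `level k s` the path up to time s depends only on the first k jumps, so events of the history
become events about these jumps. The waiting time s + 1 prevents a further jump before s. -/
lemma position_freeze (h : w ∈ level k s) (hts : t ≤ s) :
    position x t (freeze k s w) = position x t w := by
  have hj : ∀ j ≤ k, jumpTime j (freeze k s w) = jumpTime j w := fun j hj =>
    jumpTime_congr fun i hi => if_pos (by omega)
  have hsk : ∀ j ≤ k, skeleton x j (freeze k s w) = skeleton x j w := fun j hj =>
    skeleton_congr fun i hi => if_pos (by omega)
  have hlast : s < jumpTime (k + 1) (freeze k s w) := by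
    rw [jumpTime_succ]
    have : (freeze k s w k).1 = s + 1 := by simp [freeze]
    rw [this]
    exact (lt_add_one s).trans_le le_add_self
  rcases exists_mem_level_or t w with ⟨j, hjl⟩ | hno
  · have hjk : j ≤ k := by
      by_contra hlt
      push Not at hlt
      exact absurd (hts.trans_lt h.2) (not_lt.2 ((jumpTime_mono hlt).trans hjl.1))
    rw [position_of_mem_level hjl, ← hsk j hjk]
    refine position_of_mem_level ⟨by rw [hj j hjk]; exact hjl.1, ?_⟩
    rcases hjk.lt_or_eq with h1 | h1
    · rw [hj (j + 1) h1]; exact hjl.2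
    · rw [h1]; exact hts.trans_lt hlast
  · exact absurd (hts.trans_lt h.2) (not_lt.2 (hno k))

section Measurability

@[fun_prop]
lemma measurable_jumpTime (k : ℕ) : Measurable (jumpTime (E := E) k) := by
  unfold jumpTime; fun_prop

lemma measurableSet_level (k : ℕ) (t : ℝ≥0) : MeasurableSet (level (E := E) k t) :=
  (measurableSet_le (by fun_prop) measurable_const).inter
    (measurableSet_lt measurable_const (by fun_prop))

lemma measurableSet_level_prod (k : ℕ) :
    MeasurableSet {p : ℝ≥0 × (ℕ → ℝ≥0 × JumpMap E) | p.2 ∈ level k p.1} :=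
  (measurableSet_le ((measurable_jumpTime k).comp measurable_snd) measurable_fst).inter
    (measurableSet_lt (f := fun p : ℝ≥0 × (ℕ → ℝ≥0 × JumpMap E) => p.1)
      (g := fun p => jumpTime (k + 1) p.2) measurable_fst
      ((measurable_jumpTime (k + 1)).comp measurable_snd))

lemma measurableSet_skeleton [Finite E] (x : E) (k : ℕ) (o : Option E) :
    MeasurableSet {w : ℕ → ℝ≥0 × JumpMap E | skeleton x k w = o} := by
  induction k generalizing o with
  | zero => exact MeasurableSet.const (some x = o)
  | succ k ih =>
    have : {w : ℕ → ℝ≥0 × JumpMap E | skeleton x (k + 1) w = o} =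
        ⋃ p : Option E, {w | skeleton x k w = p} ∩
          {w | (w k).2 ∈ {f : JumpMap E | p.bind f = o}} := by
      ext w
      simp only [Set.mem_iUnion, Set.mem_inter_iff, Set.mem_ofPred_eq, exists_eq_left']
      rfl
    rw [this]
    exact MeasurableSet.iUnion fun p => (ih p).inter
      ((measurable_snd.comp (measurable_pi_apply k)) trivial)

@[fun_prop]
lemma measurable_restart (k : ℕ) (s : ℝ≥0) : Measurable (restart (E := E) k s) := by
  unfold restart
  fun_prop

lemma measurable_freeze (k : ℕ) (s : ℝ≥0) : Measurable (freeze (E := E) k s) := by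
  refine measurable_pi_lambda _ fun j => ?_
  unfold freeze
  split_ifs
  · fun_prop
  · exact measurable_const

lemma measurableSet_position [Finite E] (x : E) (t : ℝ≥0) (o : Option E) :
    MeasurableSet {w : ℕ → ℝ≥0 × JumpMap E | position x t w = o} := by
  have hsome : ∀ y, MeasurableSet {w : ℕ → ℝ≥0 × JumpMap E | position x t w = some y} := by
    intro y
    simp only [position_eq_some_iff, Set.ofPred_exists]
    exact MeasurableSet.iUnion fun k =>
      (measurableSet_level k t).inter (measurableSet_skeleton x k (some y))
  cases o with
  | some y => exact hsome y
  | none =>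
    have : {w : ℕ → ℝ≥0 × JumpMap E | position x t w = none} =
        (⋃ y, {w | position x t w = some y})ᶜ := by
      ext w
      simp only [Set.mem_ofPred_eq, Set.mem_compl_iff, Set.mem_iUnion, not_exists]
      exact Option.eq_none_iff_forall_ne_some
    rw [this]
    exact (MeasurableSet.iUnion hsome).compl

end Measurability

end JumpChain

/-! ### Law of the jump sequence. -/

namespace JumpChain

variable {E : Type*}

/-- The law of a sequence of independent jumps with independent standard exponential waiting
times and jump maps of law `m`. -/
noncomputable def seqLaw (m : Measure (JumpMap E)) : Measure (ℕ → ℝ≥0 × JumpMap E) :=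
  Measure.infinitePi fun _ : ℕ => expLaw.prod m

variable (m : Measure (JumpMap E)) [IsProbabilityMeasure m]

instance : IsProbabilityMeasure (seqLaw m) := by
  unfold seqLaw; infer_instance

lemma seqLaw_apply {S : Set (ℕ → ℝ≥0 × JumpMap E)} (hS : MeasurableSet S) :
    seqLaw m S = ∫⁻ a, seqLaw m {w | consSeq a w ∈ S} ∂(expLaw.prod m) :=
  infinitePi_apply_eq_lintegral_consSeq _ hS

lemma measurable_seqLaw_consSeq {S : Set (ℕ → ℝ≥0 × JumpMap E)} (hS : MeasurableSet S) :
    Measurable fun a => seqLaw m {w | consSeq a w ∈ S} :=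
  measurable_measure_prodMk_left (measurable_consSeq hS)

/-- Memorylessness: given that the first jump comes after s, the residual waiting time is again
exponential, and all later terms are untouched. -/
lemma seqLaw_level_zero_inter_restart (s : ℝ≥0) {C : Set (ℕ → ℝ≥0 × JumpMap E)}
    (hC : MeasurableSet C) :
    seqLaw m (level 0 s ∩ restart 0 s ⁻¹' C) = ENNReal.ofReal (Real.exp (-s)) * seqLaw m C := by
  have hf : Measurable fun a => seqLaw m {w | consSeq a w ∈ C} := measurable_seqLaw_consSeq m hC
  rw [seqLaw_apply m ((measurableSet_level 0 s).inter (measurable_restart 0 s hC)),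
    seqLaw_apply m hC]
  have h1 : ∀ a : ℝ≥0 × JumpMap E,
      seqLaw m {w | consSeq a w ∈ level 0 s ∩ restart 0 s ⁻¹' C} =
        if s < a.1 then seqLaw m {w | consSeq (a.1 - s, a.2) w ∈ C} else 0 := by
    intro a
    have h2 : ∀ w : ℕ → ℝ≥0 × JumpMap E,
        restart 0 s (consSeq a w) = consSeq (a.1 - s, a.2) w := fun w => by
      rw [restart, jumpTime_consSeq, jumpTime_zero, add_zero]; rfl
    simp only [Set.mem_inter_iff, Set.mem_preimage, level_zero_consSeq, h2]
    split_ifs with h <;> simp [h]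
  simp only [h1]
  have hf' : Measurable fun a : ℝ≥0 × JumpMap E =>
      if s < a.1 then seqLaw m {w | consSeq (a.1 - s, a.2) w ∈ C} else 0 :=
    Measurable.ite (measurableSet_lt measurable_const measurable_fst)
      (hf.comp (by fun_prop : Measurable fun a : ℝ≥0 × JumpMap E => (a.1 - s, a.2)))
      measurable_const
  rw [lintegral_prod_symm' _ hf', lintegral_prod_symm' _ hf,
    ← lintegral_const_mul _ hf.lintegral_prod_left']
  refine lintegral_congr fun f => ?_
  exact lintegral_expLaw_overshoot (hf.comp (measurable_id.prodMk measurable_const)) s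

lemma seqLaw_level_zero (s : ℝ≥0) :
    seqLaw m (level 0 s) = ENNReal.ofReal (Real.exp (-s)) := by
  simpa using seqLaw_level_zero_inter_restart m s MeasurableSet.univ

/-- Given what has happened up to time `s`, the future is a fresh copy of the sequence. -/
lemma seqLaw_inter_level_inter_restart (k : ℕ) (s : ℝ≥0) {H C : Set (ℕ → ℝ≥0 × JumpMap E)}
    (hHm : MeasurableSet H) (hH : ∀ w w', (∀ j < k, w j = w' j) → w ∈ H → w' ∈ H)
    (hC : MeasurableSet C) :
    seqLaw m (H ∩ level k s ∩ restart k s ⁻¹' C) = seqLaw m (H ∩ level k s) * seqLaw m C := by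
  induction k generalizing s H with
  -- For k = 0 the event H depends on no coordinate, so it is empty or everything.
  | zero =>
    rcases H.eq_empty_or_nonempty with rfl | ⟨w₀, hw₀⟩
    · simp
    · have : H = Set.univ := Set.eq_univ_of_forall fun w => hH w₀ w (by simp) hw₀
      rw [this, Set.univ_inter, seqLaw_level_zero_inter_restart m s hC, seqLaw_level_zero]
  | succ k ih =>
    have hL := hHm.inter (measurableSet_level (k + 1) s)
    rw [seqLaw_apply m (hL.inter (measurable_restart (k + 1) s hC)), seqLaw_apply m hL,
      ← lintegral_mul_const' _ _ (measure_ne_top _ _)]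
    refine lintegral_congr fun a => ?_
    by_cases ha : a.1 ≤ s
    · have hcons : Measurable fun w : ℕ → ℝ≥0 × JumpMap E => consSeq a w :=
        measurable_consSeq.comp (measurable_const.prodMk measurable_id)
      have := ih (s - a.1) (H := {w | consSeq a w ∈ H}) (hcons hHm)
        (fun w w' h hw => hH _ _ (fun j hj => by
          cases j with
          | zero => rfl
          | succ j => exact h j (by omega)) hw)
      convert this using 2
      · ext w
        simp [level_succ_consSeq, restart_succ_consSeq, ha]
      · congr 1
        ext w
        simp [level_succ_consSeq, ha]
    · simp [level_succ_consSeq, ha]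

/-- The probability that exactly `k` jumps occur up to time `t`. -/
noncomputable def levelProb (k : ℕ) (t : ℝ≥0) : ℝ≥0∞ := seqLaw m (level k t)

/-- The jump rates: the probability that the jump map sends `x` to `y`. -/
noncomputable def kernelMatrix : Matrix E E ℝ≥0∞ := fun x y => m {f | f x = some y}

lemma measurable_levelProb (k : ℕ) : Measurable (levelProb m k) :=
  measurable_measure_prodMk_left (measurableSet_level_prod k)

lemma levelProb_succ (k : ℕ) (t : ℝ≥0) :
    levelProb m (k + 1) t =
      ∫⁻ τ, (if τ ≤ t then levelProb m k (t - τ) else 0) ∂expLaw := by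
  have hf : Measurable fun τ => if τ ≤ t then levelProb m k (t - τ) else 0 :=
    Measurable.ite measurableSet_Iic ((measurable_levelProb m k).comp (by fun_prop))
      measurable_const
  rw [levelProb, seqLaw_apply m (measurableSet_level (k + 1) t)]
  have h1 : ∀ a : ℝ≥0 × JumpMap E, seqLaw m {w | consSeq a w ∈ level (k + 1) t} =
      if a.1 ≤ t then levelProb m k (t - a.1) else 0 := by
    intro a
    by_cases ha : a.1 ≤ t <;> simp [level_succ_consSeq, ha, levelProb]
  simp only [h1]
  have hf' : Measurable fun a : ℝ≥0 × JumpMap E =>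
      if a.1 ≤ t then levelProb m k (t - a.1) else 0 := hf.comp measurable_fst
  rw [lintegral_prod_symm' _ hf']
  simp

/-- The integral is the mean time between two successive jumps, which is one. The induction
integrates the renewal equation and exchanges the integrals. -/
lemma lintegral_levelProb (k : ℕ) :
    ∫⁻ t in Set.Ioi (0 : ℝ), levelProb m k t.toNNReal = 1 := by
  induction k with
  | zero =>
    have h := lintegral_expLaw (f := fun _ => 1) measurable_const
    simp only [lintegral_one, measure_univ, mul_one] at h
    rw [h]
    refine setLIntegral_congr_fun measurableSet_Ioi fun t ht => ?_
    simp only [levelProb, seqLaw_level_zero, Real.coe_toNNReal t (le_of_lt ht)]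
  | succ k ih =>
    simp only [levelProb_succ]
    rw [lintegral_lintegral_swap]
    · have h1 : ∀ τ : ℝ≥0, ∫⁻ t in Set.Ioi (0 : ℝ),
          (if τ ≤ t.toNNReal then levelProb m k (t.toNNReal - τ) else 0) = 1 := by
        intro τ
        rw [← ih, ← setLIntegral_Ioi_comp_sub τ fun t => levelProb m k t.toNNReal, ← lintegral_indicator measurableSet_Ioi,
          ← lintegral_indicator measurableSet_Ioi]
        refine lintegral_congr_ae ?_
        -- The two integrands may differ only at the single time t = τ.
        filter_upwards [compl_mem_ae_iff.2 (measure_singleton (τ : ℝ))] with t ht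
        have ht' : t ≠ τ := ht
        by_cases h : (τ : ℝ) < t
        · have h0 : 0 < t := τ.2.trans_lt h
          rw [Set.indicator_of_mem (Set.mem_Ioi.2 h0), Set.indicator_of_mem (Set.mem_Ioi.2 h),
            if_pos (NNReal.le_toNNReal_of_coe_le h.le), NNReal.sub_def,
            Real.coe_toNNReal _ h0.le]
        · rw [Set.indicator_of_notMem (s := Set.Ioi (τ : ℝ)) (by simpa using h)]
          refine Set.indicator_apply_eq_zero.2 fun h0 => if_neg fun h2 => h ?_
          refine lt_of_le_of_ne ?_ ht'.symm
          rwa [Real.le_toNNReal_iff_coe_le (le_of_lt h0)] at h2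
      simp [h1]
    · refine Measurable.aemeasurable ?_
      exact Measurable.ite (measurableSet_le measurable_snd (by fun_prop))
        ((measurable_levelProb m k).comp (by fun_prop)) measurable_const

/-- Waiting times are independent of jump maps, so the probability factorises. -/
lemma seqLaw_level_inter_skeleton [Fintype E] [DecidableEq E] (x y : E) (k : ℕ) (t : ℝ≥0) :
    seqLaw m (level k t ∩ {w | skeleton x k w = some y}) =
      (kernelMatrix m ^ k) x y * levelProb m k t := by
  induction k generalizing x t with
  | zero =>
    by_cases h : x = y <;> simp [skeleton, h, levelProb]
  | succ k ih =>
    have hf : Measurable fun τ => if τ ≤ t then levelProb m k (t - τ) else 0 :=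
      Measurable.ite measurableSet_Iic ((measurable_levelProb m k).comp (by fun_prop))
        measurable_const
    have hmeas : Measurable fun f : JumpMap E => ∑ z, (if f x = some z then 1 else 0) *
        (kernelMatrix m ^ k) z y := fun _ _ => trivial
    rw [seqLaw_apply m ((measurableSet_level (k + 1) t).inter (measurableSet_skeleton x _ _))]
    have h1 : ∀ a : ℝ≥0 × JumpMap E, seqLaw m {w | consSeq a w ∈ level (k + 1) t ∩
        {w | skeleton x (k + 1) w = some y}} =
        (if a.1 ≤ t then levelProb m k (t - a.1) else 0) *
          ∑ z, (if a.2 x = some z then 1 else 0) * (kernelMatrix m ^ k) z y := by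
      intro a
      simp only [Set.mem_inter_iff, level_succ_consSeq, Set.mem_ofPred_eq, skeleton_consSeq]
      by_cases ha : a.1 ≤ t
      · cases hz : a.2 x with
        | none => simp
        | some z =>
          simp only [ha, true_and, Option.bind_some, Option.some.injEq, ite_mul, one_mul, zero_mul,
            Finset.sum_ite_eq, Finset.mem_univ, if_true]
          rw [mul_comm, ← ih]
          rfl
      · simp [ha]
    simp only [h1]
    rw [lintegral_prod_mul hf.aemeasurable hmeas.aemeasurable, ← levelProb_succ, mul_comm,
      pow_succ', Matrix.mul_apply]
    congr 1
    rw [lintegral_finsetSum]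
    swap
    · exact fun z _ _ _ => trivial
    refine Finset.sum_congr rfl fun z _ => ?_
    rw [lintegral_mul_const]
    swap
    · exact fun _ _ => trivial
    congr 1
    rw [kernelMatrix, ← lintegral_indicator_one MeasurableSet.of_discrete]
    exact lintegral_congr fun f => by simp [Set.indicator_apply]

end JumpChain

/-! ### The Markov process built from the jump sequence. -/

/-- Two outcomes with the same path up to time `s` belong to the same events of the history up to
time `s`. -/
lemma mem_of_measurableSet_iSup_comap {Ω ι α : Type*} [LE ι] {X : ι → Ω → α} {s : ι} {A : Set Ω}
    (hA : MeasurableSet[⨆ (u : ι) (_ : u ≤ s), MeasurableSpace.comap (X u) ⊤] A) {ω ω' : Ω}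
    (h : ∀ u ≤ s, X u ω = X u ω') (hω : ω ∈ A) : ω' ∈ A := by
  -- The σ-algebra pushed forward from the trivial one on `Bool` consists of the sets that do not
  -- separate ω from ω'. It contains the history.
  have hle : (⨆ (u : ι) (_ : u ≤ s), MeasurableSpace.comap (X u) ⊤) ≤
      MeasurableSpace.map (fun b : Bool => cond b ω ω') ⊥ := by
    refine iSup₂_le fun u hu => ?_
    rintro _ ⟨S, -, rfl⟩
    refine MeasurableSpace.measurableSet_bot_iff.2 ?_
    by_cases hS : X u ω ∈ S
    · refine Or.inr (Set.eq_univ_of_forall fun b => ?_)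
      cases b
      · change X u ω' ∈ S
        exact (h u hu) ▸ hS
      · exact hS
    · refine Or.inl (Set.eq_empty_of_forall_notMem fun b hb => hS ?_)
      cases b
      · change X u ω' ∈ S at hb
        exact (h u hu).symm ▸ hb
      · exact hb
  rcases MeasurableSpace.measurableSet_bot_iff.1 (hle A hA) with h0 | h0
  · have : true ∈ (fun b : Bool => cond b ω ω') ⁻¹' A := hω
    rw [h0] at this
    exact this.elim
  · have : false ∈ (fun b : Bool => cond b ω ω') ⁻¹' A := h0 ▸ trivial
    exact this

namespace JumpChain

variable {E : Type*}

/-- The sequence of jumps `w`, together with the initial state `x`. -/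
def fromState (x : E) (w : ℕ → ℝ≥0 × JumpMap E) : Σ _ : E, (ℕ → ℝ≥0 × JumpMap E) := ⟨x, w⟩

lemma measurableSet_sigma_iff {S : Set (Σ _ : E, (ℕ → ℝ≥0 × JumpMap E))} :
    MeasurableSet S ↔ ∀ x, MeasurableSet (fromState x ⁻¹' S) :=
  MeasurableSpace.measurableSet_iInf

lemma measurable_fromState (x : E) : Measurable (fromState x) :=
  fun _ hS => measurableSet_sigma_iff.1 hS x

lemma seqLaw_position_zero (m : Measure (JumpMap E)) [IsProbabilityMeasure m] (x : E) : seqLaw m {w | position x 0 w = some x} = 1 := by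
  refine le_antisymm prob_le_one ?_
  have h := seqLaw_level_zero m 0
  simp only [NNReal.coe_zero, neg_zero, Real.exp_zero, ENNReal.ofReal_one] at h
  rw [← h]
  exact measure_mono fun w hw => position_of_mem_level hw

section Fintype

variable [Fintype E]

/-- Split according to the number k of jumps up to time s. On each piece A may be replaced by its
frozen version, an event of the first k jumps, and the future is the path of the restarted sequence,
which is independent with the original law. -/
lemma seqLaw_markov (m : Measure (JumpMap E)) [IsProbabilityMeasure m] (x y z : E) (s t : ℝ≥0) {A : Set (ℕ → ℝ≥0 × JumpMap E)}
    (hAm : MeasurableSet A)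
    (hA : ∀ w w', (∀ u ≤ s, position x u w = position x u w') → w ∈ A → w' ∈ A) :
    seqLaw m (A ∩ {w | position x (s + t) w = some y} ∩ {w | position x s w = some z}) =
      seqLaw m (A ∩ {w | position x s w = some z}) * seqLaw m {w | position z t w = some y} := by
  set C := {w : ℕ → ℝ≥0 × JumpMap E | position z t w = some y} with hC
  have hCm : MeasurableSet C := measurableSet_position z t (some y)
  set H : ℕ → Set (ℕ → ℝ≥0 × JumpMap E) := fun k =>
    freeze k s ⁻¹' A ∩ {w | skeleton x k w = some z} with hHdef
  have hHm : ∀ k, MeasurableSet (H k) := fun k =>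
    (measurable_freeze k s hAm).inter (measurableSet_skeleton x k _)
  have hH : ∀ k w w', (∀ j < k, w j = w' j) → w ∈ H k → w' ∈ H k := by
    rintro k w w' h ⟨h1, h2⟩
    refine ⟨?_, ?_⟩
    · have : freeze k s w = freeze k s w' := by
        funext j
        unfold freeze
        split_ifs with hj
        · exact h j hj
        · rfl
      rwa [Set.mem_preimage, ← this]
    · rwa [Set.mem_ofPred_eq, ← skeleton_congr h]
  have hfreeze : ∀ k w, w ∈ level k s → (freeze k s w ∈ A ↔ w ∈ A) := fun k w hw =>
    ⟨hA _ _ fun u hu => position_freeze hw hu, hA _ _ fun u hu => (position_freeze hw hu).symm⟩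
  have h1 : A ∩ {w | position x s w = some z} = ⋃ k, H k ∩ level k s := by
    ext w
    simp only [Set.mem_inter_iff, Set.mem_ofPred_eq, position_eq_some_iff, Set.mem_iUnion, hHdef,
      Set.mem_preimage]
    constructor
    · rintro ⟨h, k, hk, hz⟩
      exact ⟨k, ⟨(hfreeze k w hk).2 h, hz⟩, hk⟩
    · rintro ⟨k, ⟨h, hz⟩, hk⟩
      exact ⟨(hfreeze k w hk).1 h, k, hk, hz⟩
  have h2 : A ∩ {w | position x (s + t) w = some y} ∩ {w | position x s w = some z} =
      ⋃ k, H k ∩ level k s ∩ restart k s ⁻¹' C := by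
    rw [Set.inter_right_comm, h1, Set.iUnion_inter]
    refine Set.iUnion_congr fun k => ?_
    ext w
    refine and_congr_right fun hw => ?_
    rw [Set.mem_ofPred_eq, position_add hw.2 hw.1.2]
    rfl
  have hdisj : Pairwise (Function.onFun Disjoint fun k => H k ∩ level k s) := fun j k hjk =>
    (level_disjoint hjk).mono Set.inter_subset_right Set.inter_subset_right
  have hm : ∀ k, MeasurableSet (H k ∩ level k s) := fun k =>
    (hHm k).inter (measurableSet_level k s)
  rw [h2, h1, measure_iUnion (fun j k hjk => (hdisj hjk).mono Set.inter_subset_left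
      Set.inter_subset_left) fun k => (hm k).inter (measurable_restart k s hCm),
    measure_iUnion hdisj hm, ← ENNReal.tsum_mul_right]
  exact tsum_congr fun k => seqLaw_inter_level_inter_restart m k s (hHm k) (hH k) hCm

lemma measurableSet_sigma_position (t : ℝ≥0) (o : Option E) : MeasurableSet
    {ω : Σ _ : E, (ℕ → ℝ≥0 × JumpMap E) | position ω.1 t ω.2 = o} :=
  measurableSet_sigma_iff.2 fun x => measurableSet_position x t o

lemma map_fromState_position (m : Measure (JumpMap E)) (x : E) (t : ℝ≥0) (z : E) : (seqLaw m).map (fromState x)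
    {ω : Σ _ : E, (ℕ → ℝ≥0 × JumpMap E) | position ω.1 t ω.2 = some z} =
    seqLaw m {w | position x t w = some z} :=
  Measure.map_apply (measurable_fromState x) (measurableSet_sigma_position t (some z))

variable (m : Measure (JumpMap E)) [IsProbabilityMeasure m]

/-- The Markov process that jumps at rate one, according to independent jump maps of law `m`. -/
noncomputable def process : FiniteMarkovProcess E where
  -- The initial state is recorded in the outcome, because `X` may not depend on the starting point.
  Ω := Σ _ : E, (ℕ → ℝ≥0 × JumpMap E)
  P x := (seqLaw m).map (fromState x)
  isProbabilityMeasure x := Measure.isProbabilityMeasure_map (measurable_fromState x).aemeasurable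
  X t ω := position ω.1 t ω.2
  measurableSet_eq := measurableSet_sigma_position
  right_continuous ω t := position_right_continuous ω.1 t ω.2
  absorbing _ _ _ hst h := position_absorbing hst h
  start x := (map_fromState_position m x 0 x).trans (seqLaw_position_zero m x)
  markov x y s t A hA := by
    have hAm : MeasurableSet A := by
      refine (iSup₂_le fun u _ => ?_ : (⨆ (u : ℝ≥0) (_ : u ≤ s), MeasurableSpace.comap
        (fun ω : Σ _ : E, (ℕ → ℝ≥0 × JumpMap E) => position ω.1 u ω.2) ⊤) ≤ _) A hA
      rintro _ ⟨S, -, rfl⟩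
      refine measurableSet_sigma_iff.2 fun x' => ?_
      have : fromState x' ⁻¹' ((fun ω : Σ _ : E, (ℕ → ℝ≥0 × JumpMap E) =>
          position ω.1 u ω.2) ⁻¹' S) = ⋃ z ∈ S, {w | position x' u w = z} := by
        ext w; simp [fromState]
      rw [this]
      exact MeasurableSet.biUnion (Set.to_countable S) fun z _ => measurableSet_position x' u z
    set B : Set (ℕ → ℝ≥0 × JumpMap E) := fromState x ⁻¹' A with hB
    have hBm : MeasurableSet B := measurable_fromState x hAm
    have hBA : ∀ w w', (∀ u ≤ s, position x u w = position x u w') → w ∈ B → w' ∈ B :=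
      fun w w' h hw => mem_of_measurableSet_iSup_comap hA
        (ω := ⟨x, w⟩) (ω' := ⟨x, w'⟩) h hw
    have hinter : ∀ (t : ℝ≥0) (z : E), (seqLaw m).map (fromState x)
        (A ∩ {ω : Σ _ : E, (ℕ → ℝ≥0 × JumpMap E) | position ω.1 t ω.2 = some z}) =
        seqLaw m (B ∩ {w | position x t w = some z}) := fun t z =>
      Measure.map_apply (measurable_fromState x) (hAm.inter (measurableSet_sigma_position t _))
    rw [hinter]
    simp only [map_fromState_position, hinter, ← seqLaw_markov m x y _ s t hBm hBA]
    -- The cemetery is absorbing, so a path found in E at time s + t was in E at time s.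
    have hcover : B ∩ {w | position x (s + t) w = some y} =
        ⋃ z ∈ (Finset.univ : Finset E),
          B ∩ {w | position x (s + t) w = some y} ∩ {w | position x s w = some z} := by
      ext w
      simp only [Set.mem_iUnion, Set.mem_inter_iff, Set.mem_ofPred_eq, Finset.mem_univ,
        exists_const, exists_and_left]
      refine ⟨fun h => ⟨h, ?_⟩, fun h => h.1⟩
      refine Option.ne_none_iff_exists'.1 fun h0 => ?_
      rw [position_absorbing le_self_add h0] at h
      exact absurd h.2 (by simp)
    conv_lhs => rw [hcover]
    refine measure_biUnion_finset ?_ fun z _ => (hBm.inter (measurableSet_position x _ _)).inter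
      (measurableSet_position x s _)
    intro z _ z' _ hzz
    rw [Function.onFun, Set.disjoint_left]
    rintro w ⟨-, h1⟩ ⟨-, h2⟩
    exact hzz (Option.some.inj (h1.symm.trans h2))

variable [DecidableEq E]

lemma process_transition (t : ℝ≥0) (x y : E) :
    (process m).transition t x y = ∑' k, (kernelMatrix m ^ k) x y * levelProb m k t := by
  have h1 : (process m).transition t x y = seqLaw m {w | position x t w = some y} :=
    map_fromState_position m x t y
  have h2 : {w : ℕ → ℝ≥0 × JumpMap E | position x t w = some y} =
      ⋃ k, level k t ∩ {w | skeleton x k w = some y} := by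
    ext w
    simp [position_eq_some_iff]
  rw [h1, h2, measure_iUnion (fun j k hjk => (level_disjoint hjk).mono Set.inter_subset_left
    Set.inter_subset_left) fun k => (measurableSet_level k t).inter (measurableSet_skeleton x k _)]
  exact tsum_congr fun k => seqLaw_level_inter_skeleton m x y k t

/-- Each step of the skeleton lasts a mean time one, so occupation times are counted by the powers
of the kernel. -/
lemma process_potential (x y : E) :
    (process m).potential x y = ∑' k, (kernelMatrix m ^ k) x y := by
  rw [FiniteMarkovProcess.potential]
  have hm : ∀ k, Measurable fun t : ℝ => levelProb m k t.toNNReal := fun k =>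
    (measurable_levelProb m k).comp measurable_real_toNNReal
  simp only [process_transition]
  rw [lintegral_tsum fun k => ((hm k).const_mul _).aemeasurable]
  refine tsum_congr fun k => ?_
  rw [lintegral_const_mul _ (hm k), lintegral_levelProb, mul_one]

end Fintype

end JumpChain

/-! ### Substochastic matrices as laws of random jump maps. -/

section JumpMapLaw

variable {E : Type*} [Fintype E] [DecidableEq E]

/-- A substochastic matrix is the matrix of transition probabilities of a random jump map. -/
lemma exists_kernelMatrix_eq (p : Matrix E E ℝ) (hp : ∀ x y, 0 ≤ p x y)
    (hrow : ∀ x, ∑ y, p x y ≤ 1) :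
    ∃ m : Measure (JumpMap E), IsProbabilityMeasure m ∧
      ∀ x y, JumpChain.kernelMatrix m x y = ENNReal.ofReal (p x y) := by
  -- The missing row mass goes to the cemetery; the values of the jump map at distinct states are
  -- then chosen independently.
  set κ : E → Option E → ℝ≥0∞ := fun x o =>
    o.elim (ENNReal.ofReal (1 - ∑ y, p x y)) fun y => ENNReal.ofReal (p x y) with hκ
  have hsum : ∀ x, ∑ o, κ x o = 1 := by
    intro x
    rw [Fintype.sum_option]
    simp only [hκ, Option.elim]
    rw [← ENNReal.ofReal_sum_of_nonneg fun y _ => hp x y, ← ENNReal.ofReal_add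
      (sub_nonneg.2 (hrow x)) (Finset.sum_nonneg fun y _ => hp x y), sub_add_cancel,
      ENNReal.ofReal_one]
  set m : Measure (JumpMap E) :=
    ∑ f : E → Option E, (∏ x, κ x (f x)) • @Measure.dirac (JumpMap E) _ f with hm
  have happly : ∀ (q : (E → Option E) → Prop) [DecidablePred q], m {f | q f} =
      ∑ f : E → Option E, (∏ x, κ x (f x)) * if q f then 1 else 0 := fun q _ => by
    simp only [hm, Measure.finsetSum_apply, Measure.smul_apply, smul_eq_mul]
    exact Finset.sum_congr rfl fun f _ =>
      congrArg _ <| (@Measure.dirac_apply' (JumpMap E) _ _ f MeasurableSet.of_discrete).trans <| by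
        by_cases h : q f
        · rw [if_pos h]; exact Set.indicator_of_mem h _
        · rw [if_neg h]; exact Set.indicator_of_notMem h _
  refine ⟨m, ⟨?_⟩, fun x y => ?_⟩
  · have h := happly fun _ => True
    simp only [Set.ofPred_true, if_true, mul_one] at h
    rw [h, ← Fintype.prod_sum fun x o => κ x o]
    simp [hsum]
  · refine (happly fun f => f x = some y).trans ?_
    have h1 : ∀ f : E → Option E, (∏ x', κ x' (f x')) * (if f x = some y then 1 else 0) =
        ∏ x', κ x' (f x') * (if x' = x then (if f x' = some y then 1 else 0) else 1) := by
      intro f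
      rw [Finset.prod_mul_distrib, Finset.prod_ite_eq' Finset.univ x]
      simp
    simp only [h1]
    rw [← Fintype.prod_sum fun x' o => κ x' o *
      (if x' = x then (if o = some y then 1 else 0) else 1)]
    rw [Finset.prod_eq_single x]
    · simp [hκ]
    · intro x' _ hx'
      simp [hx', hsum]
    · simp

/-- Powers of a nonnegative matrix may be computed with extended nonnegative entries. -/
lemma pow_apply_eq_ofReal {K : Matrix E E ℝ≥0∞} {p : Matrix E E ℝ} (hp : ∀ x y, 0 ≤ p x y)
    (hK : ∀ x y, K x y = ENNReal.ofReal (p x y)) (k : ℕ) (x y : E) :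
    0 ≤ (p ^ k) x y ∧ (K ^ k) x y = ENNReal.ofReal ((p ^ k) x y) := by
  induction k generalizing x y with
  | zero => by_cases h : x = y <;> simp [h]
  | succ k ih =>
    simp only [pow_succ, Matrix.mul_apply]
    have h0 : ∀ z, 0 ≤ (p ^ k) x z * p z y := fun z => mul_nonneg (ih x z).1 (hp z y)
    refine ⟨Finset.sum_nonneg fun z _ => h0 z, ?_⟩
    rw [ENNReal.ofReal_sum_of_nonneg fun z _ => h0 z]
    exact Finset.sum_congr rfl fun z _ => by
      rw [(ih x z).2, hK, ENNReal.ofReal_mul (ih x z).1]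

end JumpMapLaw

/-! ### Green functions from M-matrices. -/

section GreenFunction

variable {E : Type*} [Fintype E] [DecidableEq E]

/-- The Neumann series of a nonnegative matrix with row sums less than `r < 1`. -/
lemma tsum_ofReal_pow_apply (p : Matrix E E ℝ) (hp : ∀ x y, 0 ≤ p x y) {r : ℝ} (hr : r < 1)
    (hrow : ∀ x, ∑ y, p x y ≤ r) (B : Matrix E E ℝ) (hB : B * (1 - p) = 1) (x y : E) :
    0 ≤ B x y ∧ ∑' k, ENNReal.ofReal ((p ^ k) x y) = ENNReal.ofReal (B x y) := by
  have hr0 : 0 ≤ r := (Finset.sum_nonneg fun y _ => hp x y).trans (hrow x)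
  have hpow : ∀ k x, ∑ y, (p ^ k) x y ≤ r ^ k := by
    intro k
    induction k with
    | zero => intro x; simp [Matrix.one_apply]
    | succ k ih =>
      intro x
      simp only [pow_succ', Matrix.mul_apply]
      rw [Finset.sum_comm]
      calc ∑ z, ∑ y, p x z * (p ^ k) z y = ∑ z, p x z * ∑ y, (p ^ k) z y := by
            simp only [Finset.mul_sum]
        _ ≤ ∑ z, p x z * r ^ k :=
            Finset.sum_le_sum fun z _ => mul_le_mul_of_nonneg_left (ih z) (hp x z)
        _ = (∑ z, p x z) * r ^ k := by rw [Finset.sum_mul]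
        _ ≤ r * r ^ k := mul_le_mul_of_nonneg_right (hrow x) (pow_nonneg hr0 k)
        _ = r ^ k * r := mul_comm _ _
        _ ≤ _ := le_of_eq (mul_comm _ _)
  have hnn : ∀ k x y, 0 ≤ (p ^ k) x y := fun k x y =>
    (pow_apply_eq_ofReal (K := fun x y => ENNReal.ofReal (p x y)) hp (fun _ _ => rfl) k x y).1
  have hle : ∀ k x y, (p ^ k) x y ≤ r ^ k := fun k x y =>
    (Finset.single_le_sum (f := fun y => (p ^ k) x y) (fun y _ => hnn k x y)
      (Finset.mem_univ y)).trans (hpow k x)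
  have hlim : ∀ x y, Tendsto (fun k => (p ^ k) x y) atTop (𝓝 0) := fun x y =>
    squeeze_zero (fun k => hnn k x y) (fun k => hle k x y) (tendsto_pow_atTop_nhds_zero_of_lt_one hr0 hr)
  -- Since B(1 - p) = 1, the partial sums telescope to B - B pⁿ, and pⁿ → 0.
  have hpartial : ∀ n, ∑ k ∈ Finset.range n, (p ^ k) x y = B x y - ∑ z, B x z * (p ^ n) z y := by
    intro n
    have h1 : ∑ k ∈ Finset.range n, p ^ k = B - B * p ^ n := by
      have h2 := mul_neg_geom_sum p n
      calc ∑ k ∈ Finset.range n, p ^ k = B * (1 - p) * ∑ k ∈ Finset.range n, p ^ k := by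
            rw [hB, one_mul]
        _ = B - B * p ^ n := by rw [mul_assoc, h2, mul_sub, mul_one]
    have h3 := congrFun (congrFun h1 x) y
    rwa [Matrix.sum_apply, Matrix.sub_apply, Matrix.mul_apply] at h3
  have hsum : HasSum (fun k => (p ^ k) x y) (B x y) := by
    rw [hasSum_iff_tendsto_nat_of_nonneg fun k => hnn k x y]
    simp only [hpartial]
    have := tendsto_finsetSum (Finset.univ : Finset E) fun z _ => (hlim z y).const_mul (B x z)
    simpa using (tendsto_const_nhds (x := B x y)).sub this
  refine ⟨hsum.nonneg fun k => hnn k x y, ?_⟩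
  rw [← ENNReal.ofReal_tsum_of_nonneg (fun k => hnn k x y) hsum.summable, hsum.tsum_eq]

/-- The inverse of a symmetric matrix with nonpositive off-diagonal entries and positive row sums
is the Green function of a symmetric transient Markov process. -/
lemma isSymmetricTransientGreenFunction_of_mul_eq_one {A B : Matrix E E ℝ} (hA : A.IsSymm)
    (hoff : ∀ x y, x ≠ y → A x y ≤ 0) (hrow : ∀ x, 0 < ∑ y, A x y) (hBA : B * A = 1) :
    IsSymmetricTransientGreenFunction fun x y => B x y := by
  obtain ⟨c, hc0, hc⟩ : ∃ c : ℝ, 0 < c ∧ ∀ x, A x x ≤ c := by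
    refine ⟨1 + ∑ x, |A x x|, by positivity, fun x => ?_⟩
    have := Finset.single_le_sum (f := fun x => |A x x|) (fun x _ => abs_nonneg _)
      (Finset.mem_univ x)
    linarith [le_abs_self (A x x)]
  -- Uniformisation: A = c(1 - p), where p is nonnegative because c dominates the diagonal of A, and
  -- its row sums are below one because those of A are positive. The potential (1 - p)⁻¹ is then cB.
  set p : Matrix E E ℝ := 1 - c⁻¹ • A with hp
  have hp0 : ∀ x y, 0 ≤ p x y := by
    intro x y
    rw [hp, Matrix.sub_apply, Matrix.smul_apply, smul_eq_mul]
    by_cases h : x = y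
    · subst h
      rw [Matrix.one_apply_eq, sub_nonneg, inv_mul_le_one₀ hc0]
      exact hc x
    · rw [Matrix.one_apply_ne h, zero_sub, neg_nonneg]
      exact mul_nonpos_of_nonneg_of_nonpos (inv_nonneg.2 hc0.le) (hoff x y h)
  have hprow : ∀ x, ∑ y, p x y = 1 - c⁻¹ * ∑ y, A x y := by
    intro x
    simp [hp, Matrix.one_apply, Finset.mul_sum]
  obtain ⟨r, hr, hpr⟩ : ∃ r < 1, ∀ x, ∑ y, p x y ≤ r := by
    rcases isEmpty_or_nonempty E with hE | hE
    · exact ⟨0, one_pos, fun x => hE.elim x⟩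
    · refine ⟨Finset.univ.sup' Finset.univ_nonempty fun x => ∑ y, p x y, ?_, fun x =>
        Finset.le_sup' (fun x => ∑ y, p x y) (Finset.mem_univ x)⟩
      refine (Finset.sup'_lt_iff _).2 fun x _ => ?_
      rw [hprow, sub_lt_self_iff]
      exact mul_pos (inv_pos.2 hc0) (hrow x)
  obtain ⟨m, hm, hK⟩ := exists_kernelMatrix_eq p hp0 fun x => (hpr x).trans hr.le
  have hpotential : ∀ x y, 0 ≤ (c • B) x y ∧
      (JumpChain.process m).potential x y = ENNReal.ofReal ((c • B) x y) := by
    intro x y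
    have h := tsum_ofReal_pow_apply p hp0 hr hpr (c • B) (by
      rw [hp, sub_sub_cancel, Matrix.smul_mul, Matrix.mul_smul, hBA, smul_smul,
        mul_inv_cancel₀ hc0.ne', one_smul]) x y
    refine ⟨h.1, ?_⟩
    rw [JumpChain.process_potential, ← h.2]
    exact tsum_congr fun k => (pow_apply_eq_ofReal hp0 hK k x y).2
  have hKsymm : (JumpChain.kernelMatrix m).IsSymm := by
    ext x y
    have hpsymm : p y x = p x y := by
      simp [hp, Matrix.one_apply, eq_comm, hA.apply x y]
    rw [Matrix.transpose_apply, hK, hK, hpsymm]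
  -- The reference measure has constant mass c, which turns the potential cB into the density B.
  refine ⟨JumpChain.process m, fun _ => c, fun _ => hc0, fun x y => ?_, fun t x y => ?_,
    fun x y => ?_⟩
  · rw [(hpotential x y).2]
    exact ENNReal.ofReal_lt_top
  · rw [JumpChain.process_transition, JumpChain.process_transition]
    congr 1
    exact tsum_congr fun k => by rw [(hKsymm.pow k).apply y x]
  · rw [FiniteMarkovProcess.potentialDensity, (hpotential x y).2,
      ENNReal.toReal_ofReal (hpotential x y).1, Matrix.smul_apply, smul_eq_mul,
      mul_div_cancel_left₀ _ hc0.ne']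

/-- A positive definite matrix with nonpositive off-diagonal entries takes positive values at
some positive vector. -/
lemma exists_pos_mulVec_pos {A : Matrix E E ℝ} (hA : A.PosDef)
    (hoff : ∀ x y, x ≠ y → A x y ≤ 0) :
    ∃ h : E → ℝ, (∀ x, 0 < h x) ∧ ∀ x, 0 < (A.mulVec h) x := by
  have hdet : IsUnit A.det := hA.det_pos.ne'.isUnit
  set h := A⁻¹.mulVec 1 with hh
  have hAh : A.mulVec h = 1 := by
    rw [hh, Matrix.mulVec_mulVec, Matrix.mul_nonsing_inv _ hdet, Matrix.one_mulVec]
  have hnn : ∀ x, 0 ≤ h x := by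
    by_contra! hneg
    obtain ⟨x₀, hx₀⟩ := hneg
    -- For the negative part u of h, the signs of A give uᵀAu ≤ -uᵀAh = -∑ u ≤ 0, contradicting
    -- positive definiteness.
    set u : E → ℝ := fun x => max (-h x) 0 with hu
    have hu0 : u ≠ 0 := fun h0 => by
      have := congrFun h0 x₀
      simp only [hu, Pi.zero_apply] at this
      have h1 := le_max_left (-h x₀) 0
      linarith
    have hpos : 0 < u ⬝ᵥ A.mulVec u := by simpa using hA.dotProduct_mulVec_pos hu0
    have hle : u ⬝ᵥ A.mulVec u ≤ -(u ⬝ᵥ A.mulVec h) := by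
      simp only [dotProduct, Matrix.mulVec, Finset.mul_sum, ← Finset.sum_neg_distrib]
      refine Finset.sum_le_sum fun x _ => Finset.sum_le_sum fun y _ => ?_
      have hux : 0 ≤ u x := le_max_right _ _
      have huy : -h y ≤ u y := le_max_left _ _
      by_cases hxy : x = y
      · subst hxy
        rcases le_total 0 (h x) with h1 | h1
        · have : u x = 0 := max_eq_right (by linarith)
          simp [this]
        · have : u x = -h x := max_eq_left (by linarith)
          rw [this]; exact le_of_eq (by ring)
      · nlinarith [mul_nonneg hux (mul_nonneg (sub_nonneg.2 huy) (neg_nonneg.2 (hoff x y hxy)))]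
    have : 0 ≤ u ⬝ᵥ A.mulVec h := by
      rw [hAh]
      exact Finset.sum_nonneg fun x _ => by simp [hu]
    linarith
  have hpos : ∀ x, 0 < h x := by
    intro x
    -- If h x = 0, only nonpositive off-diagonal terms remain in (Ah)_x, which equals 1.
    refine lt_of_le_of_ne (hnn x) fun h0 => ?_
    have h1 : (A.mulVec h) x = 1 := by rw [hAh]; rfl
    have h2 : (A.mulVec h) x ≤ 0 := by
      refine Finset.sum_nonpos fun y _ => ?_
      by_cases hxy : x = y
      · subst hxy; rw [← h0, mul_zero]
      · exact mul_nonpos_of_nonpos_of_nonneg (hoff x y hxy) (hnn y)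
    linarith
  exact ⟨h, hpos, fun x => by rw [hAh]; exact one_pos⟩

/-- A positive definite matrix whose inverse has nonpositive off-diagonal entries, up to a
signature, is a Green function up to a change of signs and scale. -/
lemma exists_greenFunction_of_inverse_offDiag_nonpos {G : Matrix E E ℝ} (hG : G.PosDef)
    (d : E → ℝ) (hd : ∀ x, d x ^ 2 = 1) (hoff : ∀ x y, x ≠ y → d x * G⁻¹ x y * d y ≤ 0) :
    ∃ (e : E → ℝ) (g : E → E → ℝ), IsSymmetricTransientGreenFunction g ∧
      ∀ x y, G x y = e x * g x y * e y := by
  have hd0 : ∀ x, d x ≠ 0 := fun x h => by simpa [h] using hd x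
  have hconj : ∀ {M : Matrix E E ℝ} {v : E → ℝ}, M.PosDef → (∀ x, v x ≠ 0) →
      (Matrix.diagonal v * M * Matrix.diagonal v).PosDef := by
    intro M v hM hv
    have := hM.conjTranspose_mul_mul_same (B := Matrix.diagonal v) (by
      intro a b hab
      funext x
      have := congrFun hab x
      simp only [Matrix.mulVec_diagonal] at this
      exact mul_left_cancel₀ (hv x) this)
    simpa [Matrix.diagonal_conjTranspose] using this
  have hA : (Matrix.diagonal d * G⁻¹ * Matrix.diagonal d).PosDef := hconj hG.inv hd0
  have happ : ∀ (M : Matrix E E ℝ) (v : E → ℝ) x y,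
      (Matrix.diagonal v * M * Matrix.diagonal v) x y = v x * M x y * v y := fun M v x y => by
    rw [Matrix.mul_diagonal, Matrix.diagonal_mul]
  obtain ⟨h, hpos, hrow⟩ := exists_pos_mulVec_pos hA fun x y hxy => by
    rw [happ]; exact hoff x y hxy
  -- The signs d fix the off-diagonal entries. The factor h makes the row sums positive: at x the
  -- sum is h x times the x-th entry of (d G⁻¹ d)h.
  set v : E → ℝ := fun x => h x * d x with hv
  have hv0 : ∀ x, v x ≠ 0 := fun x => mul_ne_zero (hpos x).ne' (hd0 x)
  have hdet : IsUnit G.det := hG.det_pos.ne'.isUnit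
  refine ⟨v, fun x y => (Matrix.diagonal (fun x => (v x)⁻¹) * G *
    Matrix.diagonal (fun x => (v x)⁻¹)) x y,
    isSymmetricTransientGreenFunction_of_mul_eq_one
      (A := Matrix.diagonal v * G⁻¹ * Matrix.diagonal v) ?_ ?_ ?_ ?_, fun x y => ?_⟩
  · have := (hconj hG.inv hv0).isHermitian
    rwa [Matrix.IsHermitian, Matrix.conjTranspose_eq_transpose_of_trivial] at this
  · intro x y hxy
    rw [happ]
    have := mul_nonpos_of_nonneg_of_nonpos (mul_pos (hpos x) (hpos y)).le (hoff x y hxy)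
    simp only [hv]
    linarith
  · intro x
    have := mul_pos (hpos x) (hrow x)
    simp only [happ, Matrix.mulVec, dotProduct, Finset.mul_sum] at this ⊢
    refine this.trans_le (le_of_eq (Finset.sum_congr rfl fun y _ => ?_))
    simp only [hv]
    ring
  · have h1 : Matrix.diagonal (fun x => (v x)⁻¹) * Matrix.diagonal v = 1 := by
      rw [Matrix.diagonal_mul_diagonal, ← Matrix.diagonal_one]
      congr 1
      funext x
      exact inv_mul_cancel₀ (hv0 x)
    calc Matrix.diagonal (fun x => (v x)⁻¹) * G * Matrix.diagonal (fun x => (v x)⁻¹) *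
          (Matrix.diagonal v * G⁻¹ * Matrix.diagonal v)
        = Matrix.diagonal (fun x => (v x)⁻¹) * G * (Matrix.diagonal (fun x => (v x)⁻¹) *
          Matrix.diagonal v) * G⁻¹ * Matrix.diagonal v := by simp only [Matrix.mul_assoc]
      _ = 1 := by
        rw [h1, Matrix.mul_one, Matrix.mul_assoc _ G, Matrix.mul_nonsing_inv _ hdet,
          Matrix.mul_one, h1]
  · beta_reduce
    rw [happ]
    have := hv0 x
    have := hv0 y
    field_simp

end GreenFunction

/-! ### The two implications through the inverse covariance. -/

section GaussianSquares

variable {E Ω : Type*} [Fintype E] [DecidableEq E] [MeasurableSpace Ω] {μ : Measure Ω}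
  [IsProbabilityMeasure μ] {η : E → Ω → ℝ} {G : Matrix E E ℝ}

lemma inverse_two_smul_apply (hG : G.PosDef) (x y : E) :
    ((2 : ℝ) • G)⁻¹ x y = 2⁻¹ * G⁻¹ x y := by
  have : Invertible (2 : ℝ) := invertibleOfNonzero two_ne_zero
  have h := Matrix.inv_smul (A := G) (2 : ℝ) hG.det_pos.ne'.isUnit
  rw [invOf_eq_inv] at h
  exact congrFun (congrFun h x) y

/-- Infinite divisibility of the squares of a Gaussian vector forces the off-diagonal entries of
the inverse covariance to be nonpositive, up to a signature. -/
lemma exists_signature_of_isInfinitelyDivisibleLaw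
    (hη : HasGaussianLaw (fun ω x => η x ω) μ) (hcentered : ∀ x, ∫ ω, η x ω ∂μ = 0)
    (hcov : ∀ x y, cov[η x, η y; μ] = G x y) (hG : G.PosDef)
    (hdiv : IsInfinitelyDivisibleLaw (μ.map (fun ω x => (η x ω) ^ 2))) :
    ∃ d : E → ℝ, (∀ x, d x ^ 2 = 1) ∧ ∀ x y, x ≠ y → d x * G⁻¹ x y * d y ≤ 0 := by
  set A := ((2 : ℝ) • G)⁻¹ with hAdef
  have hA : A.PosDef := (hG.smul two_pos).inv
  have hm : AEMeasurable (fun ω x => (η x ω) ^ 2) μ :=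
    (by fun_prop : Measurable fun (v : E → ℝ) x => v x ^ 2).comp_aemeasurable hη.aemeasurable
  have hPm : IsProbabilityMeasure (μ.map (fun ω x => (η x ω) ^ 2)) :=
    Measure.isProbabilityMeasure_map hm
  have hP : ∀ᵐ v ∂(μ.map (fun ω x => (η x ω) ^ 2)), ∀ x, 0 ≤ v x := by
    rw [ae_map_iff hm (by measurability)]
    exact ae_of_all _ fun ω x => sq_nonneg _
  have hlog : ∀ S : Finset E, S.Nonempty → ∀ l h : E → ℝ, (∀ x, 0 ≤ l x) → (∀ x, 0 ≤ h x) →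
      ∑ T ∈ S.powerset, (-1 : ℝ) ^ T.card *
        Real.log (A + Matrix.diagonal (fun x => l x + if x ∈ T then h x else 0)).det ≤ 0 := by
    intro S hS l h hl hh
    have h1 := sum_powerset_log_integral_exp_nonneg hP hdiv S hS l h hl hh
    -- The logarithm of the Laplace transform is half of log det A - log det(A + Λ): the constant
    -- disappears in the alternating sum and the sign is reversed.
    have h2 : ∀ T : Finset E, Real.log (∫ v, Real.exp (-∑ x, (l x + if x ∈ T then h x else 0) *
        v x) ∂(μ.map (fun ω x => (η x ω) ^ 2))) = 2⁻¹ * (Real.log A.det - Real.log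
        (A + Matrix.diagonal (fun x => l x + if x ∈ T then h x else 0)).det) := by
      intro T
      have hnn : ∀ x, 0 ≤ l x + if x ∈ T then h x else 0 := fun x =>
        add_nonneg (hl x) (by split_ifs; exacts [hh x, le_rfl])
      have hpos : 0 < (A + Matrix.diagonal (fun x => l x + if x ∈ T then h x else 0)).det :=
        (hA.add_posSemidef (Matrix.PosSemidef.diagonal hnn)).det_pos
      rw [integral_map hm (by fun_prop : Measurable fun v : E → ℝ => Real.exp (-∑ x,
          (l x + if x ∈ T then h x else 0) * v x)).aestronglyMeasurable, integral_exp_neg_sum_mul_sq hη hcentered hcov hG _ hnn,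
        Real.log_sqrt (div_nonneg hA.det_pos.le hpos.le), Real.log_div hA.det_pos.ne' hpos.ne']
      ring
    obtain ⟨x, hx⟩ := hS
    have h3 := sum_powerset_neg_one_pow_card_mul_eq_zero hx (fun _ => Real.log A.det)
      fun _ _ => rfl
    simp only [h2] at h1
    have h4 : ∑ T ∈ S.powerset, (-1 : ℝ) ^ T.card * (2⁻¹ * (Real.log A.det - Real.log
        (A + Matrix.diagonal (fun x => l x + if x ∈ T then h x else 0)).det)) =
        2⁻¹ * (∑ T ∈ S.powerset, (-1 : ℝ) ^ T.card * Real.log A.det -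
          ∑ T ∈ S.powerset, (-1 : ℝ) ^ T.card * Real.log
            (A + Matrix.diagonal (fun x => l x + if x ∈ T then h x else 0)).det) := by
      rw [← Finset.sum_sub_distrib, Finset.mul_sum]
      exact Finset.sum_congr rfl fun T _ => by ring
    rw [h4, h3] at h1
    linarith
  have hsymm : A.IsSymm := by
    have := hA.isHermitian
    rwa [Matrix.IsHermitian, Matrix.conjTranspose_eq_transpose_of_trivial] at this
  obtain ⟨d, hd, hdA⟩ := exists_signature_of_cyclic_sums_nonneg (-A) hsymm.neg fun S n hn hS =>
    sum_cyclic_words_nonneg A hA S n hn hS (hlog S (Finset.card_pos.1 (by omega)))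
  refine ⟨d, hd, fun x y hxy => ?_⟩
  have := hdA x y hxy
  rw [Matrix.neg_apply, hAdef, inverse_two_smul_apply hG] at this
  linarith

/-- The squares of a Gaussian vector are infinitely divisible if the off-diagonal entries of the
inverse covariance are nonpositive, up to scaling. -/
lemma isInfinitelyDivisibleLaw_of_inverse_offDiag_nonpos
    (hη : HasGaussianLaw (fun ω x => η x ω) μ) (hcentered : ∀ x, ∫ ω, η x ω ∂μ = 0)
    (hcov : ∀ x y, cov[η x, η y; μ] = G x y) (hG : G.PosDef) (d : E → ℝ) (hd : ∀ x, d x ≠ 0)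
    (hoff : ∀ x y, x ≠ y → d x * G⁻¹ x y * d y ≤ 0) :
    IsInfinitelyDivisibleLaw (μ.map (fun ω x => (η x ω) ^ 2)) := by
  set A := ((2 : ℝ) • G)⁻¹ with hAdef
  have hA : A.PosDef := (hG.smul two_pos).inv
  have hdA : ∀ x y, x ≠ y → d x * A x y * d y ≤ 0 := fun x y hxy => by
    rw [hAdef, inverse_two_smul_apply hG]
    linarith [hoff x y hxy]
  have hm : AEMeasurable (fun ω x => (η x ω ^ 2).toNNReal) μ :=
    (by fun_prop : Measurable fun (v : E → ℝ) x => (v x ^ 2).toNNReal).comp_aemeasurable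
      hη.aemeasurable
  have hPm : IsProbabilityMeasure (μ.map (fun ω x => (η x ω ^ 2).toNNReal)) :=
    Measure.isProbabilityMeasure_map hm
  have hmap : μ.map (fun ω x => (η x ω) ^ 2) =
      (μ.map (fun ω x => (η x ω ^ 2).toNNReal)).map fun v x => (v x : ℝ) := by
    rw [AEMeasurable.map_map_of_aemeasurable 
      (by fun_prop : Measurable fun (v : E → ℝ≥0) x => (v x : ℝ)).aemeasurable hm]
    congr 1
    funext ω x
    simp [Real.coe_toNNReal _ (sq_nonneg (η x ω))]
  rw [hmap]
  refine isInfinitelyDivisibleLaw_of_isLaplaceTransform _ fun n hn => ?_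
  have hn0 : (0 : ℝ) < n := by exact_mod_cast hn
  -- The exponent 1/(2n) combines the square root in the Gaussian formula with the n-th root.
  have h := isLaplaceTransform_det_rpow A hA d hd hdA (β := 2⁻¹ * (n : ℝ)⁻¹) (by positivity)
  convert h using 2 with l
  have hpos : 0 < (A + Matrix.diagonal fun x => (l x : ℝ)).det :=
    (hA.add_posSemidef (Matrix.PosSemidef.diagonal fun x => (l x).2)).det_pos
  rw [integral_map hm (by fun_prop), Real.rpow_mul (div_nonneg hA.det_pos.le hpos.le)]
  congr 1
  have h2 := integral_exp_neg_sum_mul_sq hη hcentered hcov hG (fun x => (l x : ℝ))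
    fun x => (l x).2
  rw [Real.sqrt_eq_rpow, one_div] at h2
  rw [← h2]
  refine integral_congr_ae (ae_of_all _ fun ω => ?_)
  simp only [negExp, Real.coe_toNNReal _ (sq_nonneg _)]

end GaussianSquares

theorem theorem3p2 {E Ω : Type*} [Fintype E] [MeasurableSpace Ω] (μ : Measure Ω)
    [IsProbabilityMeasure μ] (η : E → Ω → ℝ) (G : Matrix E E ℝ)
    (hη : HasGaussianLaw (fun ω x => η x ω) μ)
    (hcentered : ∀ x, ∫ ω, η x ω ∂μ = 0)
    (hcov : ∀ x y, cov[η x, η y; μ] = G x y)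
    (hG : G.PosDef) :
    IsInfinitelyDivisibleLaw (μ.map (fun ω x => (η x ω) ^ 2)) ↔
      ∃ (d : E → ℝ) (g : E → E → ℝ), IsSymmetricTransientGreenFunction g ∧
        ∀ x y, G x y = d x * g x y * d y := by
  classical
  constructor
  · intro hdiv
    obtain ⟨d, hd, hoff⟩ :=
      exists_signature_of_isInfinitelyDivisibleLaw hη hcentered hcov hG hdiv
    exact exists_greenFunction_of_inverse_offDiag_nonpos hG d hd hoff
  · rintro ⟨d, g, hg, hGd⟩
    obtain ⟨hd, hoff⟩ := hg.inverse_offDiag_nonpos hG hGd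
    exact isInfinitelyDivisibleLaw_of_inverse_offDiag_nonpos hη hcentered hcov hG d hd hoff
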